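/- Let the data domain be $(\mathbb{Q},\le)$ (up to isomorphism, the only countable dense total order without a least or a greatest element). A \emph{data permutation} is an order-preserving bijection $\rho:\mathbb{Q}\to\mathbb{Q}$. An \emph{integer data vector} of dimension $d$ is a function $\mathbf v:\mathbb{Q}\to\mathbb{Z}^d$ that is non-zero at only finitely many data values; data vectors are added pointwise. For a finite set $\mathcal V$ of data vectors put $\mathrm{Perm}(\mathcal V)=\{\mathbf v\circ\rho : \mathbf v\in\mathcal V,\ \rho\text{ a data permutation}\}$. The \emph{$\mathbb{N}$-solvability problem for linear equations over ordered data vectors} asks, given a dimension $d\in\mathbb{N}$, a finite set $\mathcal V$ of integer data vectors of dimension $d$ and a target integer data vector $\mathbf x$ of dimension $d$, whether there are $m\ge 0$ and $\mathbf v_1,\dots,\mathbf v_m\in\mathrm{Perm}(\mathcal V)$, not necessarily distinct, with $\mathbf x=\sum_{i=1}^m \mathbf v_i$. The \emph{VAS reachability problem} asks, given a dimension $d\in\mathbb{N}$, a finite set $A\subseteq\mathbb{Z}^d$ and vectors $\mathbf i,\mathbf f\in\mathbb{N}^d$, whether $\mathbf i\longrightarrow^*\mathbf f$, where $\longrightarrow^*$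 is the reflexive-transitive closure of the relation on $\mathbb{N}^d$ given by $\mathbf c\longrightarrow\mathbf c'$ iff $\mathbf c'=\mathbf c+\mathbf a$ for some $\mathbf a\in A$. Instances of both problems are written as words over a finite alphabet: sets are given by lists of their elements, a data vector is given by the list of the data values at which it is non-zero, in increasing order, together with its values there, all integers (and the numerators and denominators of data values) are written in binary, and the dimension $d$ is written in unary. \textbf{Theorem.} The two problems are inter-reducible with an exponential blowup. That is, there are a function $f$ from instances of the first problem to instances of the second and a function $g$ from instances of the second to instances of the first, each computable by a Turing machine in time at most $2^{p(n)}$ for some polynomial $p$, where $n$ is the length of the word that encodes the input instance, such that \begin{itemize} \item every instance $E$ of the $\mathbb{N}$-solvability problem is a yes-instance if and only if $f(E)$ is a yes-instance of the VAS reachability problem, and \item every instance $V$ of the VAS reachability problem is a yes-instance if and only if $g(V)$ is a yes-instance of the $\mathbb{N}$-solvability problem. \end{itemize} -/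

import Mathlib

/-! ### Vector addition systems and their reachability problem -/

/-- An instance of the VAS reachability problem: a dimension `dim`, a finite set of integer vectors
(presented by a list of its elements), and the initial and the final configuration. -/
structure VAS where
  dim : ℕ
  transitions : List (Fin dim → ℤ)
  initial : Fin dim → ℕ
  final : Fin dim → ℕ

namespace VAS

/-- One transition between configurations (which are nonnegative by their type): `c' = c + a` for
some `a` in the given set of vectors. -/
def Step (V : VAS) (c c' : Fin V.dim → ℕ) : Prop :=
  ∃ a ∈ V.transitions, ∀ i, (c' i : ℤ) = (c i : ℤ) + a i

/-- The VAS reachability problem: the final configuration is reachable from the initial one. -/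
def Reachable (V : VAS) : Prop :=
  Relation.ReflTransGen V.Step V.initial V.final

end VAS

/-! ### Data vectors over the ordered data domain `ℚ` and `ℕ`-solvability -/

/-- Integer data vectors of dimension `d`: finitely supported functions from the data domain
`(ℚ, ≤)` to `ℤ^d`. -/
abbrev DataVector (d : ℕ) : Type := ℚ →₀ (Fin d → ℤ)

namespace DataVector

/-- The composition `v ∘ ρ` of a data vector with a data permutation, that is, with an
order-preserving permutation `ρ` of the data domain. -/
noncomputable def comp {d : ℕ} (v : DataVector d) (ρ : ℚ ≃o ℚ) : DataVector d :=
  Finsupp.comapDomain ρ v ρ.injective.injOn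

theorem comp_apply {d : ℕ} (v : DataVector d) (ρ : ℚ ≃o ℚ) (α : ℚ) : v.comp ρ α = v (ρ α) :=
  rfl

/-- `Perm(S)`: all data vectors obtained from elements of `S` by data permutations. -/
def perm {d : ℕ} (S : Set (DataVector d)) : Set (DataVector d) :=
  {w | ∃ v ∈ S, ∃ ρ : ℚ ≃o ℚ, w = v.comp ρ}

/-- `x` is a permutation sum of `S`: a sum of finitely many, not necessarily distinct, elements of
`Perm(S)`. -/
def IsPermSum {d : ℕ} (x : DataVector d) (S : Set (DataVector d)) : Prop :=
  ∃ l : List (DataVector d), (∀ w ∈ l, w ∈ perm S) ∧ x = l.sum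

end DataVector

/-- A system of linear equations over ordered data vectors: a finite set of integer data vectors
(presented by a list of its elements) and a target integer data vector. -/
structure DataSystem where
  dim : ℕ
  vectors : List (DataVector dim)
  target : DataVector dim

/-- The `ℕ`-solvability problem for linear equations over ordered data vectors. -/
def DataSystem.Solvable (E : DataSystem) : Prop :=
  E.target.IsPermSum {v | v ∈ E.vectors}

/-! ### Encoding of instances as words, with numbers in binary -/

/-- The finite alphabet in which instances are written. -/
inductive Letter
  | bit (b : Bool)
  | minus
  | slash
  | colon
  | comma
  | semicolon
  | bar
  deriving DecidableEq, Fintype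

/-- Binary notation, least significant bit first; zero is the empty word. -/
def encNat (n : ℕ) : List Letter :=
  (Computability.encodeNat n).map Letter.bit

/-- Sign and binary absolute value. -/
def encInt (z : ℤ) : List Letter :=
  (if z < 0 then [Letter.minus] else []) ++ encNat z.natAbs

/-- Numerator and denominator in lowest terms. -/
def encRat (q : ℚ) : List Letter :=
  encInt q.num ++ Letter.slash :: encNat q.den

/-- The coordinates in order, each one terminated by a comma. -/
def encVec {d : ℕ} (a : Fin d → ℤ) : List Letter :=
  (List.ofFn a).flatMap fun z => encInt z ++ [Letter.comma]

/-- The list of all pairs (data value, nonzero vector at that data value), in increasing order of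
data values, each one terminated by a semicolon. -/
noncomputable def encDataVector {d : ℕ} (v : DataVector d) : List Letter :=
  (v.support.sort (· ≤ ·)).flatMap fun α =>
    encRat α ++ Letter.colon :: (encVec (v α) ++ [Letter.semicolon])

/-- The dimension in unary, the transitions, the initial and the final configuration. -/
def VAS.encode (V : VAS) : List Letter :=
  List.replicate V.dim (Letter.bit true) ++ Letter.bar ::
    ((V.transitions.flatMap fun a => encVec a ++ [Letter.semicolon]) ++ Letter.bar ::
      (encVec (fun i => (V.initial i : ℤ)) ++ Letter.bar :: encVec (fun i => (V.final i : ℤ))))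

/-- The dimension in unary, then the target, then the given data vectors, each one followed by a
bar. -/
noncomputable def DataSystem.encode (E : DataSystem) : List Letter :=
  List.replicate E.dim (Letter.bit true) ++ Letter.bar ::
    (encDataVector E.target ++ Letter.bar ::
      (E.vectors.flatMap fun v => encDataVector v ++ [Letter.bar]))

/-! ### Exponential-time many-one reductions -/

/-- `f` is computed by a (multi-stack) Turing machine, relative to the given encodings of arguments
and values as words, in a number of steps that is at most `2 ^ p(n)` for some polynomial `p`, where
`n` is the length of the input word. -/
def ComputableInExpTime {A B Γ Δ : Type} (encA : A → List Γ) (encB : B → List Δ) (f : A → B) :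
    Prop :=
  ∃ (M : Turing.TM2ComputableInTime encA encB f) (p : Polynomial ℕ), ∀ n, M.time n ≤ 2 ^ p.eval n

/-- `P` reduces to `Q` with an exponential blowup: some function that is computable in exponential
time maps instances of `P` to instances of `Q` and preserves the answer. -/
def ReducesWithExpBlowup {A B Γ Δ : Type} (encA : A → List Γ) (P : A → Prop)
    (encB : B → List Δ) (Q : B → Prop) : Prop :=
  ∃ f : A → B, ComputableInExpTime encA encB f ∧ ∀ x, P x ↔ Q (f x)

/-! From vector addition systems to data vectors, the data line plays the role of time. A step with
vector `a` becomes an edge between data values `p < q`, with value `(a, -1)` at `p` and `(0, 1)` at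
`q`; a unit kept on counter `k` becomes a token, with `-e_k` at `p` and `e_k` at `q`. The target is
`(-initial, -1)` at `0` and `(final, 1)` at `1`. Summing a coordinate over all data values below a
cut `r` counts what crosses the cut. For the last coordinate this shows that exactly one edge
crosses each cut in `(0, 1]` and none crosses any other, so the edges form a chain from `0` to `1`.
For counter `k` it shows that the number of tokens crossing `r` is, up to `1`, the initial value
plus the effects of all edges begun before `r`; hence all intermediate values are nonnegative and
the chain is a run (`VAS.reachable_of_isPermSum_run`). Conversely, density of `ℚ` leaves room for
every run (`VAS.isPermSum_run`). This reduction takes only quadratic time.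

From data vectors to vector addition systems, the equation is read as `-x + ∑ vᵢ = 0`, with a
permuted copy of `-x`. Since a finite increasing map extends to an automorphism of `ℚ`, a permuted
data vector is its list of values placed at arbitrary increasing data values. The system sweeps
upward over the data values, one round for each. Every copy is a unit on a counter for its position
on a track, which is the concatenation of all lists of values; in a round it may advance by one
cell, and the vectors passed in a round must have sum zero. The running sum `x` is kept as the pair
`B + x`, `B - x`; subtracting `B` from both at the end of the round tests it for zero.

The test loses no solution if some order of the vectors of a round keeps the running sum within `B`.
`exists_list_partialSum_le` provides it: a zero-sum family splits into zero-sum blocks of bounded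
size, by pigeonhole on one coordinate after the other, and the blocks are listed one after another.
The bound does not depend on the number of vectors and is at most `2 ^ 8 ^ n` for inputs of length
`n`; in binary this number has exponentially many digits, which is the source of the blowup.
Soundness (`Track.exists_fits_of_reachable`) holds for every `B` and reads a run backward;
completeness (`Track.reachable_of_sum_eq_zero`) is an induction on the data values.

For computability, a small structured language with big-step semantics and step counts is compiled
to multi-stack machines (`StackProg.Exec.leads`), and explicit programs are shown to print the
encodings of the constructed instances. -/

/-! ### A structured language of stack programs -/

/-- Structured programs that manipulate finitely many stacks. The loop pops a letter from its stack;
it ends if there is none or if the letter is a halting letter, and otherwise it runs the body that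
belongs to the letter and starts again. -/
inductive StackProg (K A : Type) : Type
  | skip : StackProg K A
  | push (k : K) (a : A) : StackProg K A
  | seq (p q : StackProg K A) : StackProg K A
  | loop (k : K) (halt : A → Bool) (body : A → StackProg K A) : StackProg K A

namespace StackProg

variable {K A : Type}

/-- Program points. -/
def Label : StackProg K A → Type
  | skip => Unit
  | push _ _ => Unit
  | seq p q => Label p ⊕ Label q
  | loop _ _ body => Option (Σ a, Label (body a))

/-- The program point at which the execution starts. -/
def entry : (p : StackProg K A) → Label p
  | skip => ()
  | push _ _ => ()
  | seq p _ => Sum.inl (entry p)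
  | loop _ _ _ => none

instance Label.finite [Finite A] : (p : StackProg K A) → Finite (Label p)
  | skip => inferInstanceAs (Finite Unit)
  | push _ _ => inferInstanceAs (Finite Unit)
  | seq p q =>
    haveI := Label.finite p
    haveI := Label.finite q
    inferInstanceAs (Finite (Label p ⊕ Label q))
  | loop _ _ body =>
    haveI := fun a => Label.finite (body a)
    inferInstanceAs (Finite (Option (Σ a, Label (body a))))

/-- The machine statement at a program point, where `emb` places the program points among the labels
of the machine and `exit` is the label at which to continue after the program. -/
def code : (p : StackProg K A) → {Λ : Type} → (emb : Label p → Λ) → (exit : Λ) → Label p →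
    Turing.TM2.Stmt (fun _ : K => A) Λ (Option A)
  | skip, _, _, exit, _ => .goto fun _ => exit
  | push k a, _, _, exit, _ => .push k (fun _ => a) (.goto fun _ => exit)
  | seq p q, _, emb, _, Sum.inl l => code p (fun l => emb (Sum.inl l)) (emb (Sum.inr (entry q))) l
  | seq _ q, _, emb, exit, Sum.inr l => code q (fun l => emb (Sum.inr l)) exit l
  | loop k halt body, _, emb, exit, none =>
    .pop k (fun _ o => o) (.goto fun v =>
      match v with
      | none => exit
      | some a => if halt a then exit else emb (some ⟨a, entry (body a)⟩))
  | loop _ _ body, _, emb, _, some ⟨a, l⟩ =>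
    code (body a) (fun l => emb (some ⟨a, l⟩)) (emb none) l

variable [DecidableEq K]

/-- `Exec p S S' t`: the program `p` started with stacks `S` ends with stacks `S'` after `t` steps. -/
inductive Exec : StackProg K A → (K → List A) → (K → List A) → ℕ → Prop
  | skip (S) : Exec skip S S 1
  | push (k a S) : Exec (push k a) S (Function.update S k (a :: S k)) 1
  | seq {p q S S' S'' t t'} : Exec p S S' t → Exec q S' S'' t' → Exec (seq p q) S S'' (t + t')
  | loop_nil {k halt body S} : S k = [] → Exec (loop k halt body) S S 1
  | loop_halt {k halt body S a l} : S k = a :: l → halt a = true →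
      Exec (loop k halt body) S (Function.update S k l) 1
  | loop_step {k halt body S a l S' S'' t t'} : S k = a :: l → halt a = false →
      Exec (body a) (Function.update S k l) S' t → Exec (loop k halt body) S' S'' t' →
      Exec (loop k halt body) S S'' (1 + t + t')

/-- `M` leads from `c` to `c'` in `t` steps. -/
def Leads {Λ : Type} (M : Λ → Turing.TM2.Stmt (fun _ : K => A) Λ (Option A)) (t : ℕ)
    (c c' : Turing.TM2.Cfg (fun _ : K => A) Λ (Option A)) : Prop :=
  (flip bind (Turing.TM2.step M))^[t] (some c) = some c'

theorem Leads.trans {Λ : Type} {M : Λ → Turing.TM2.Stmt (fun _ : K => A) Λ (Option A)} {t t' : ℕ}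
    {c c' c'' : Turing.TM2.Cfg (fun _ : K => A) Λ (Option A)}
    (h : Leads M t c c') (h' : Leads M t' c' c'') : Leads M (t + t') c c'' := by
  unfold Leads at *
  rw [add_comm, Function.iterate_add_apply, h, h']

theorem Leads.one {Λ : Type} {M : Λ → Turing.TM2.Stmt (fun _ : K => A) Λ (Option A)} {l : Λ}
    {v : Option A} {S : K → List A} : Leads M 1 ⟨some l, v, S⟩ (Turing.TM2.stepAux (M l) v S) :=
  rfl

/-- Embedding and exit label are arbitrary because the induction applies to subprograms placed
inside larger ones. The final internal state is left open: only loops read it, and each of them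
overwrites it by a pop just before. -/
theorem Exec.leads {p : StackProg K A} {S S' : K → List A} {t : ℕ} (h : Exec p S S' t) :
    ∀ {Λ : Type} (M : Λ → Turing.TM2.Stmt (fun _ : K => A) Λ (Option A)) (emb : Label p → Λ)
      (exit : Λ), (∀ l, M (emb l) = code p emb exit l) →
      ∀ v, ∃ v', Leads M t ⟨some (emb (entry p)), v, S⟩ ⟨some exit, v', S'⟩ := by
  induction h with
  | skip S =>
    intro Λ M emb exit hM v
    refine ⟨v, ?_⟩
    have := Leads.one (M := M) (l := emb (entry StackProg.skip)) (v := v) (S := S)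
    rwa [hM] at this
  | push k a S =>
    intro Λ M emb exit hM v
    refine ⟨v, ?_⟩
    have := Leads.one (M := M) (l := emb (entry (StackProg.push k a))) (v := v) (S := S)
    rwa [hM] at this
  | @seq p q S S' S'' t t' _ _ ih ih' =>
    intro Λ M emb exit hM v
    obtain ⟨v', h'⟩ := ih M (fun l => emb (Sum.inl l)) (emb (Sum.inr (entry q)))
      (fun l => hM (Sum.inl l)) v
    obtain ⟨v'', h''⟩ := ih' M (fun l => emb (Sum.inr l)) exit (fun l => hM (Sum.inr l)) v'
    exact ⟨v'', h'.trans h''⟩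
  | @loop_nil k halt body S hS =>
    intro Λ M emb exit hM v
    refine ⟨none, ?_⟩
    have := Leads.one (M := M) (l := emb (entry (loop k halt body))) (v := v) (S := S)
    rw [hM] at this
    simp only [entry, code, Turing.TM2.stepAux, hS] at this
    have e : Function.update S k ([] : List A) = S := by rw [← hS, Function.update_eq_self]
    have h2 : Leads M 1 ⟨some (emb (entry (StackProg.loop k halt body))), v, S⟩
      ⟨some exit, none, Function.update S k []⟩ := this
    rw [e] at h2
    exact h2
  | @loop_halt k halt body S a l hS hs =>
    intro Λ M emb exit hM v
    refine ⟨some a, ?_⟩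
    have := Leads.one (M := M) (l := emb (entry (loop k halt body))) (v := v) (S := S)
    rw [hM] at this
    simpa [entry, code, Turing.TM2.stepAux, hS, hs] using this
  | @loop_step k halt body S a l S' S'' t t' hS hs _ _ ih ih' =>
    intro Λ M emb exit hM v
    have h1 := Leads.one (M := M) (l := emb (entry (loop k halt body))) (v := v) (S := S)
    rw [hM] at h1
    simp only [entry, code, Turing.TM2.stepAux, hS, hs, List.head?_cons, List.tail_cons,
      Bool.false_eq_true, if_false] at h1
    obtain ⟨v', h'⟩ := ih M (fun l => emb (some ⟨a, l⟩)) (emb none)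
      (fun l => hM (some ⟨a, l⟩)) (some a)
    obtain ⟨v'', h''⟩ := ih' M emb exit hM v'
    exact ⟨v'', (h1.trans h').trans h''⟩

/-- The machine that runs a stack program and then resets its internal state. -/
noncomputable def machine [Fintype K] [Fintype A] (p : StackProg K A) (kin kout : K) :
    Turing.FinTM2 where
  K := K
  k₀ := kin
  k₁ := kout
  Γ := fun _ => A
  Λ := Option (Label p)
  main := some (entry p)
  ΛFin := Fintype.ofFinite _
  σ := Option A
  initialState := none
  Γk₀Fin := inferInstanceAs (Fintype A)
  m := fun l =>
    match l with
    | none => .load (fun _ => none) .halt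
    | some l => code p some none l

/-- A function is computable in exponential time if a stack program computes it in exponential
time. -/
theorem computableInExpTime {X Y : Type} [Fintype K] [Fintype A] {encX : X → List A}
    {encY : Y → List A} {f : X → Y} (p : StackProg K A) (kin kout : K) (b : Polynomial ℕ)
    (h : ∀ x, ∃ t, t + 1 ≤ 2 ^ b.eval (encX x).length ∧
      Exec p (Function.update (fun _ => []) kin (encX x))
        (Function.update (fun _ => []) kout (encY (f x))) t) :
    ComputableInExpTime encX encY f := by
  choose t ht h using h
  refine ⟨⟨⟨machine p kin kout, Equiv.refl A, Equiv.refl A⟩, fun n => 2 ^ b.eval n, fun x =>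
    ⟨⟨t x + 1, ?_⟩, ht x⟩⟩, b, fun n => le_rfl⟩
  obtain ⟨v, hv⟩ := (h x).leads (machine p kin kout).m some none (fun l => rfl) none
  -- The additional step runs the label `none`: it restores the initial internal state, which
  -- `Turing.haltList` demands, and halts.
  have hw := hv.trans Leads.one
  have e1 : Turing.initList (machine p kin kout) (List.map (Equiv.refl A).invFun (encX x)) =
      ⟨some (some (entry p)), none, Function.update (fun _ => []) kin (encX x)⟩ := by
    unfold Turing.initList
    congr 1
    refine funext fun (k : K) => ?_
    by_cases hk : k = kin
    · subst hk
      exact (dif_pos rfl).trans ((List.map_id (encX x)).trans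
        (Function.update_self k (encX x) fun _ => []).symm)
    · exact (dif_neg hk).trans (Function.update_of_ne hk (encX x) fun _ => []).symm
  have e2 : Turing.haltList (machine p kin kout) (List.map (Equiv.refl A).invFun (encY (f x))) =
      ⟨none, none, Function.update (fun _ => []) kout (encY (f x))⟩ := by
    unfold Turing.haltList
    congr 1
    refine funext fun (k : K) => ?_
    by_cases hk : k = kout
    · subst hk
      exact (dif_pos rfl).trans ((List.map_id (encY (f x))).trans
        (Function.update_self k (encY (f x)) fun _ => []).symm)
    · exact (dif_neg hk).trans (Function.update_of_ne hk (encY (f x)) fun _ => []).symm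
  rw [Option.map_some]
  erw [e1, e2]
  exact hw

end StackProg

/-! ### Stack programs on a fixed collection of stacks -/

/-- The names of the stacks of the reduction machines. -/
inductive Stk
  | inp | out | tmp | dim | left | right | big | buf | buf2 | buf3
  deriving DecidableEq

instance : Fintype Stk where
  elems := {.inp, .out, .tmp, .dim, .left, .right, .big, .buf, .buf2, .buf3}
  complete k := by cases k <;> decide

/-- The contents of the stacks. -/
@[ext]
structure Stacks where
  inp : List Letter := []
  out : List Letter := []
  tmp : List Letter := []
  dim : List Letter := []
  left : List Letter := []
  right : List Letter := []
  big : List Letter := []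
  buf : List Letter := []
  buf2 : List Letter := []
  buf3 : List Letter := []

namespace Stacks

/-- The content of a given stack. -/
def get (s : Stacks) : Stk → List Letter
  | .inp => s.inp
  | .out => s.out
  | .tmp => s.tmp
  | .dim => s.dim
  | .left => s.left
  | .right => s.right
  | .big => s.big
  | .buf => s.buf
  | .buf2 => s.buf2
  | .buf3 => s.buf3

/-- Replaces the content of a given stack. -/
def set (s : Stacks) (k : Stk) (l : List Letter) : Stacks :=
  match k with
  | .inp => { s with inp := l }
  | .out => { s with out := l }
  | .tmp => { s with tmp := l }
  | .dim => { s with dim := l }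
  | .left => { s with left := l }
  | .right => { s with right := l }
  | .big => { s with big := l }
  | .buf => { s with buf := l }
  | .buf2 => { s with buf2 := l }
  | .buf3 => { s with buf3 := l }

theorem get_set (s : Stacks) (k : Stk) (l : List Letter) :
    (s.set k l).get = Function.update s.get k l := by
  funext j
  cases k <;> cases j <;> rfl

@[simp] theorem get_set_self (s : Stacks) (k : Stk) (l : List Letter) : (s.set k l).get k = l := by
  rw [get_set, Function.update_self]

theorem get_set_of_ne (s : Stacks) {j k : Stk} (h : j ≠ k) (l : List Letter) :
    (s.set k l).get j = s.get j := by
  rw [get_set, Function.update_of_ne h]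

theorem get_injective : Function.Injective get := by
  intro s s' h
  ext1
  exacts [congrFun h .inp, congrFun h .out, congrFun h .tmp, congrFun h .dim, congrFun h .left,
    congrFun h .right, congrFun h .big, congrFun h .buf, congrFun h .buf2, congrFun h .buf3]

@[simp] theorem set_get (s : Stacks) (k : Stk) : s.set k (s.get k) = s :=
  get_injective (by rw [get_set, Function.update_eq_self])

@[simp] theorem set_set (s : Stacks) (k : Stk) (l l' : List Letter) :
    (s.set k l).set k l' = s.set k l' :=
  get_injective (by simp [get_set])

theorem set_comm (s : Stacks) {j k : Stk} (h : j ≠ k) (l l' : List Letter) :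
    (s.set j l).set k l' = (s.set k l').set j l :=
  get_injective (by simp only [get_set, Function.update_comm h])

/-- Appends a word to the output, which is stored in reverse. -/
def emit (s : Stacks) (w : List Letter) : Stacks := { s with out := w.reverse ++ s.out }

@[simp] theorem emit_emit (s : Stacks) (w w' : List Letter) :
    (s.emit w).emit w' = s.emit (w ++ w') := by
  simp [emit]

@[simp] theorem emit_nil (s : Stacks) : s.emit [] = s := rfl

theorem get_emit (s : Stacks) {k : Stk} (h : k ≠ .out) (w : List Letter) :
    (s.emit w).get k = s.get k := by
  cases k <;> first | rfl | exact absurd rfl h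

theorem set_emit (s : Stacks) {k : Stk} (h : k ≠ .out) (l w : List Letter) :
    (s.emit w).set k l = (s.set k l).emit w := by
  cases k <;> first | rfl | exact absurd rfl h

end Stacks

/-! ### Time-bounded runs and their composition -/

open StackProg

/-- The program leads from `s` to `s'` in at most `t` steps. -/
def Runs (p : StackProg Stk Letter) (s s' : Stacks) (t : ℕ) : Prop :=
  ∃ t' ≤ t, Exec p s.get s'.get t'

namespace Runs

variable {p q : StackProg Stk Letter} {s s' s'' : Stacks} {t t' : ℕ}

theorem mono (h : Runs p s s' t) (ht : t ≤ t') : Runs p s s' t' :=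
  let ⟨u, hu, e⟩ := h
  ⟨u, hu.trans ht, e⟩

theorem skip (s : Stacks) : Runs .skip s s 1 := ⟨1, le_rfl, .skip _⟩

theorem push (k : Stk) (a : Letter) (s : Stacks) :
    Runs (.push k a) s (s.set k (a :: s.get k)) 1 :=
  ⟨1, le_rfl, by rw [Stacks.get_set]; exact .push k a _⟩

theorem seq (h : Runs p s s' t) (h' : Runs q s' s'' t') : Runs (.seq p q) s s'' (t + t') :=
  let ⟨u, hu, e⟩ := h
  let ⟨u', hu', e'⟩ := h'
  ⟨u + u', Nat.add_le_add hu hu', .seq e e'⟩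

variable {k : Stk} {halt : Letter → Bool} {body : Letter → StackProg Stk Letter} {a : Letter}
  {l : List Letter}

theorem loop_nil (h : s.get k = []) : Runs (.loop k halt body) s s 1 :=
  ⟨1, le_rfl, .loop_nil h⟩

theorem loop_halt (h : s.get k = a :: l) (ha : halt a = true) :
    Runs (.loop k halt body) s (s.set k l) 1 :=
  ⟨1, le_rfl, by rw [Stacks.get_set]; exact .loop_halt h ha⟩

theorem loop_step (h : s.get k = a :: l) (ha : halt a = false)
    (hb : Runs (body a) (s.set k l) s' t) (hl : Runs (.loop k halt body) s' s'' t') :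
    Runs (.loop k halt body) s s'' (1 + t + t') :=
  let ⟨u, hu, e⟩ := hb
  let ⟨u', hu', e'⟩ := hl
  ⟨1 + u + u', by omega, .loop_step h ha (by rwa [Stacks.get_set] at e) e'⟩

end Runs

/-- Sequential composition of a list of programs. -/
def block : List (StackProg Stk Letter) → StackProg Stk Letter
  | [] => .skip
  | p :: l => .seq p (block l)

namespace Runs

theorem block_nil (s : Stacks) : Runs (block []) s s 1 := skip s

theorem block_cons {p : StackProg Stk Letter} {l : List (StackProg Stk Letter)} {s s' s'' : Stacks}
    {t t' : ℕ} (h : Runs p s s' t) (h' : Runs (block l) s' s'' t') :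
    Runs (block (p :: l)) s s'' (t + t') :=
  h.seq h'

end Runs

/-- Every step pushes at most one letter. -/
theorem StackProg.Exec.length_le {K A : Type} [DecidableEq K] {p : StackProg K A}
    {S S' : K → List A} {t : ℕ} (h : Exec p S S' t) (k : K) :
    (S' k).length ≤ (S k).length + t := by
  induction h with
  | skip S => omega
  | push j a S =>
    rw [Function.update_apply]
    split_ifs with h
    · subst h; simp
    · omega
  | seq _ _ ih ih' => omega
  | loop_nil => omega
  | @loop_halt j halt body S a l hS _ =>
    rw [Function.update_apply]
    split_ifs with h
    · subst h; simp [hS]; omega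
    · omega
  | @loop_step j halt body S a l S' S'' t t' hS _ _ _ ih ih' =>
    rw [Function.update_apply] at ih
    split_ifs at ih with h
    · subst h; rw [hS]; simp only [List.length_cons]; omega
    · omega

namespace Runs

variable {p : StackProg Stk Letter} {s s' s'' : Stacks} {t : ℕ}

theorem congr (h : Runs p s s' t) (e : s' = s'') : Runs p s s'' t :=
  e ▸ h

theorem block_nil_of_eq (h : s = s') : Runs (block []) s s' 1 :=
  h ▸ .block_nil s

theorem length_le (h : Runs p s s' t) (k : Stk) : (s'.get k).length ≤ (s.get k).length + t :=
  let ⟨_, hu, e⟩ := h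
  (e.length_le k).trans (Nat.add_le_add_left hu _)

end Runs

/-! ### Basic programs: printing, moving and skipping letters -/

/-- No letter is a halting letter. -/
def never : Letter → Bool := fun _ => false

/-- Outputs a fixed word. -/
def emitP : List Letter → StackProg Stk Letter
  | [] => .skip
  | a :: w => .seq (.push .out a) (emitP w)

theorem runs_emitP (w : List Letter) (s : Stacks) : Runs (emitP w) s (s.emit w) (w.length + 1) := by
  induction w generalizing s with
  | nil => exact .skip s
  | cons a w ih =>
    have h := (Runs.push .out a s).seq (ih _)
    have e : (s.set .out (a :: s.get .out)).emit w = s.emit (a :: w) := by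
      simp [Stacks.emit, Stacks.set, Stacks.get]
    rw [e] at h
    exact h.mono (by simp; omega)

/-- Moves the content of stack `j` to stack `k`, in reverse. -/
def transfer (j k : Stk) : StackProg Stk Letter := .loop j never fun a => .push k a

theorem runs_transfer {j k : Stk} (hjk : j ≠ k) (s : Stacks) :
    Runs (transfer j k) s ((s.set j []).set k ((s.get j).reverse ++ s.get k))
      (2 * (s.get j).length + 1) := by
  generalize hl : s.get j = l
  induction l generalizing s with
  | nil =>
    have e : (s.set j []).set k ([].reverse ++ s.get k) = s := by
      rw [← hl, Stacks.set_get, hl]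
      exact Stacks.set_get _ _
    rw [e]
    exact .loop_nil hl
  | cons a l ih =>
    have h := ih ((s.set j l).set k (a :: (s.set j l).get k))
      (by rw [Stacks.get_set_of_ne _ hjk, Stacks.get_set_self])
    have h' := Runs.loop_step (halt := never) (body := fun a => .push k a) hl rfl (Runs.push k a _) h
    rw [Stacks.get_set_self, Stacks.get_set_of_ne _ hjk.symm, ← Stacks.set_comm _ hjk,
      Stacks.set_set, Stacks.set_set] at h'
    simp only [List.reverse_cons, List.append_assoc, List.singleton_append]
    exact h'.mono (by simp; omega)

/-- Empties a stack. -/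
def clear (k : Stk) : StackProg Stk Letter := .loop k never fun _ => .skip

theorem runs_clear (k : Stk) (s : Stacks) :
    Runs (clear k) s (s.set k []) (2 * (s.get k).length + 1) := by
  generalize hl : s.get k = l
  induction l generalizing s with
  | nil => rw [← hl, Stacks.set_get, hl]; exact .loop_nil hl
  | cons a l ih =>
    have h := Runs.loop_step (halt := never) (body := fun _ => .skip) hl rfl (Runs.skip _)
      (ih (s.set k l) (by simp))
    rw [Stacks.set_set] at h
    exact h.mono (by simp; omega)

/-- Removes the top letter of a stack. -/
def drop (k : Stk) : StackProg Stk Letter := .loop k (fun _ => true) fun _ => .skip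

theorem runs_drop {k : Stk} {s : Stacks} {a : Letter} {l : List Letter} (h : s.get k = a :: l) :
    Runs (drop k) s (s.set k l) 1 :=
  .loop_halt h rfl

/-- Skips the letters of the input up to the first letter `c`, inclusively. -/
def skipUntil (c : Letter) : StackProg Stk Letter := .loop .inp (· == c) fun _ => .skip

theorem runs_skipUntil {c : Letter} {w : List Letter} (hw : c ∉ w) (l : List Letter) (s : Stacks)
    (h : s.inp = w ++ c :: l) :
    Runs (skipUntil c) s { s with inp := l } (2 * w.length + 1) := by
  induction w generalizing s with
  | nil => exact .loop_halt (l := l) h (by simp)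
  | cons a w ih =>
    simp only [List.mem_cons, not_or] at hw
    have h' := Runs.loop_step (halt := (· == c)) (body := fun _ => .skip) (k := .inp) (s := s) h
      (by simpa using Ne.symm hw.1) (Runs.skip _) (ih hw.2 _ rfl)
    exact h'.mono (by simp; omega)

/-- Moves the letters of stack `j` up to the first letter `c` to stack `k`, in reverse, and removes
the letter `c`. If there is no letter `c`, then all letters are moved. -/
def moveUntil (c : Letter) (j k : Stk) : StackProg Stk Letter := .loop j (· == c) fun a => .push k a

theorem runs_moveUntil {j k : Stk} (hjk : j ≠ k) {c : Letter} {w : List Letter} (hw : c ∉ w)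
    (l : List Letter) (s : Stacks) (h : s.get j = w ++ c :: l) :
    Runs (moveUntil c j k) s ((s.set j l).set k (w.reverse ++ s.get k)) (2 * w.length + 1) := by
  induction w generalizing s with
  | nil =>
    have e : (s.set j l).set k ([].reverse ++ s.get k) = s.set j l := by
      rw [← Stacks.get_set_of_ne s hjk.symm l]; exact Stacks.set_get _ _
    rw [e]
    exact .loop_halt (l := l) h (by simp)
  | cons a w ih =>
    simp only [List.mem_cons, not_or] at hw
    have h1 := ih hw.2 ((s.set j (w ++ c :: l)).set k (a :: (s.set j (w ++ c :: l)).get k))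
      (by rw [Stacks.get_set_of_ne _ hjk, Stacks.get_set_self])
    have h' := Runs.loop_step (halt := (· == c)) (body := fun a => .push k a) (s := s) h
      (by simpa using Ne.symm hw.1) (Runs.push k a _) h1
    rw [Stacks.get_set_self, Stacks.get_set_of_ne _ hjk.symm, ← Stacks.set_comm _ hjk,
      Stacks.set_set, Stacks.set_set] at h'
    simp only [List.reverse_cons, List.append_assoc, List.singleton_append]
    exact h'.mono (by simp; omega)

/-- Outputs a fixed word once for every letter of stack `k`. -/
def emitPer (k : Stk) (w : List Letter) : StackProg Stk Letter :=
  .seq (.loop k never fun a => .seq (.push .tmp a) (emitP w)) (transfer .tmp k)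

/-- The stack serves as a unary number and survives: its letters are parked on `tmp` in reverse, and
the transfer reverses them back. This is why `tmp` must be empty and must differ from `k`. -/
theorem runs_emitPer {k : Stk} (hk : k ≠ .out) (hk' : k ≠ .tmp) (w : List Letter) (s : Stacks)
    (hs : s.tmp = []) :
    Runs (emitPer k w) s (s.emit (List.replicate (s.get k).length w).flatten)
      ((s.get k).length * (w.length + 5) + 2) := by
  have key : ∀ l s, s.get k = l → Runs (.loop k never fun a => .seq (.push .tmp a) (emitP w)) s
      (((s.set k []).set .tmp (l.reverse ++ s.tmp)).emit (List.replicate l.length w).flatten)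
      (l.length * (w.length + 3) + 1) := by
    intro l
    induction l with
    | nil =>
      intro s hs
      have e : (s.set k []).set .tmp ([].reverse ++ s.tmp) = s := by
        rw [← hs, Stacks.set_get, hs]; rfl
      rw [e]
      exact (Runs.loop_nil hs).mono (by omega)
    | cons a l ih =>
      intro s hs
      have h := ih (((s.set k l).set .tmp (a :: (s.set k l).get .tmp)).emit w)
        (by rw [Stacks.get_emit _ hk, Stacks.get_set_of_ne _ hk', Stacks.get_set_self])
      have h' := Runs.loop_step (halt := never)
        (body := fun a => .seq (.push .tmp a) (emitP w)) hs rfl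
        ((Runs.push .tmp a _).seq (runs_emitP w _)) h
      rw [Stacks.set_emit _ hk, Stacks.set_emit _ (by decide), Stacks.emit_emit,
        ← Stacks.set_comm _ hk', Stacks.set_set, Stacks.set_set] at h'
      refine (?_ : Runs _ _ _ _).mono (t := 1 + (1 + (w.length + 1)) + (l.length * (w.length + 3) + 1)) ?_
      · have e : (((s.set k l).set .tmp (a :: (s.set k l).get .tmp)).emit w).tmp = a :: s.tmp := by
          cases k <;> first | rfl | exact absurd rfl hk'
        rw [e] at h'
        simpa [List.replicate_succ] using h'
      · simp only [List.length_cons]; ring_nf; omega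
  have h1 := key _ s rfl
  have h2 := runs_transfer (j := .tmp) (k := k) hk'.symm
    (((s.set k []).set .tmp ((s.get k).reverse ++ s.tmp)).emit
      (List.replicate (s.get k).length w).flatten)
  rw [Stacks.get_emit _ (by decide), Stacks.get_set_self, Stacks.get_emit _ hk,
    Stacks.get_set_of_ne _ hk', Stacks.get_set_self, hs, Stacks.set_emit _ (by decide),
    Stacks.set_set, Stacks.set_emit _ hk, ← Stacks.set_comm _ hk', Stacks.set_set] at h2
  have e : ((s.set k ((((s.get k).reverse ++ []).reverse ++ []))).set .tmp []) = s := by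
    rw [List.append_nil, List.append_nil, List.reverse_reverse, Stacks.set_get, ← hs]
    exact Stacks.set_get s .tmp
  rw [e] at h2
  rw [hs] at h1
  refine (h1.seq h2).mono ?_
  simp only [List.append_nil, List.length_reverse]
  ring_nf
  omega

/-! ### Sign change of encoded vectors -/

/-- Copies a vector from stack `k` to the output and changes the signs of its entries. -/
def negate (halt : Letter → Bool) (k : Stk) : StackProg Stk Letter :=
  .loop k halt fun a => block
    (if a = .comma then [.push .out .comma]
    else if a = .minus then [moveUntil .comma k .out, .push .out .comma]
    else [emitP [.minus, a], moveUntil .comma k .out, .push .out .comma])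

theorem encodePosNum_eq_cons (n : PosNum) : ∃ b l, Computability.encodePosNum n = b :: l := by
  cases n <;> exact ⟨_, _, rfl⟩

@[simp] theorem encNat_zero : encNat 0 = [] := rfl

theorem encNat_of_ne_zero {n : ℕ} (hn : n ≠ 0) : ∃ b l, encNat n = .bit b :: l := by
  unfold encNat Computability.encodeNat Computability.encodeNum
  cases h : (n : Num) with
  | zero =>
    exact absurd (by rw [← Num.to_of_nat n, h]; rfl) hn
  | pos m =>
    obtain ⟨b, l, e⟩ := encodePosNum_eq_cons m
    exact ⟨b, l.map .bit, by simp [e]⟩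

theorem mem_encNat {n : ℕ} {a : Letter} (h : a ∈ encNat n) : ∃ b, a = .bit b := by
  obtain ⟨b, -, rfl⟩ := List.mem_map.1 h
  exact ⟨b, rfl⟩

theorem mem_encInt {z : ℤ} {a : Letter} (h : a ∈ encInt z) : (∃ b, a = .bit b) ∨ a = .minus := by
  rcases List.mem_append.1 h with h | h
  · split_ifs at h
    · exact .inr (List.mem_singleton.1 h)
    · simp at h
  · exact .inl (mem_encNat h)

theorem comma_notMem_encNat (n : ℕ) : Letter.comma ∉ encNat n := by
  intro h
  obtain ⟨_, h⟩ := mem_encNat h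
  cases h

@[simp] theorem encVec_append {d e : ℕ} (a : Fin d → ℤ) (b : Fin e → ℤ) :
    encVec (Fin.append a b) = encVec a ++ encVec b := by
  simp [encVec, List.ofFn_fin_append]

theorem encVec_cons {d : ℕ} (z : ℤ) (a : Fin d → ℤ) :
    encVec (Fin.cons z a) = encInt z ++ .comma :: encVec a := by
  simp [encVec, List.ofFn_succ]

theorem mem_encVec {d : ℕ} {v : Fin d → ℤ} {a : Letter} (h : a ∈ encVec v) :
    (∃ b, a = .bit b) ∨ a = .minus ∨ a = .comma := by
  simp only [encVec, List.mem_flatMap, List.mem_append, List.mem_singleton] at h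
  obtain ⟨z, -, h | h⟩ := h
  · rcases mem_encInt h with h | h
    exacts [.inl h, .inr (.inl h)]
  · exact .inr (.inr h)

/-- A negated vector is output by `negate`. -/
theorem runs_negate {k : Stk} (hk : k ≠ .out) {d : ℕ} (v : Fin d → ℤ) {halt : Letter → Bool}
    (hhalt : ∀ a, (∃ b, a = .bit b) ∨ a = .minus ∨ a = .comma → halt a = false) (l l' : List Letter)
    (hl : ∀ s : Stacks, s.get k = l → Runs (negate halt k) s (s.set k l') 1) (s : Stacks)
    (h : s.get k = encVec v ++ l) :
    Runs (negate halt k) s ((s.set k l').emit (encVec (-v))) (10 * (encVec v).length + 1) := by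
  induction d generalizing s with
  | zero => simpa [encVec] using hl s (by simpa [encVec] using h)
  | succ d ih =>
    obtain ⟨z, v, rfl⟩ : ∃ z w, v = Fin.cons z w := ⟨v 0, Fin.tail v, (Fin.cons_self_tail v).symm⟩
    have e : -(Fin.cons z v : Fin (d + 1) → ℤ) = Fin.cons (-z) (-v) := by
      funext i
      refine Fin.cases rfl (fun i => rfl) i
    rw [e, encVec_cons, encVec_cons]
    rw [encVec_cons, List.append_assoc, List.cons_append] at h
    -- It remains to run the body on the first entry; the induction hypothesis treats the other
    -- entries.
    have fin : ∀ s' : Stacks, ∀ w, s' = (s.set k (encVec v ++ l)).emit w → ∀ a l'' t,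
        s.get k = a :: l'' → (∃ b, a = .bit b) ∨ a = .minus ∨ a = .comma →
        Runs (block (if a = .comma then [.push .out .comma]
          else if a = .minus then [moveUntil .comma k .out, .push .out .comma]
          else [emitP [.minus, a], moveUntil .comma k .out, .push .out .comma]))
          (s.set k l'') s' t → Runs (negate halt k) s
          ((s.set k l').emit (w ++ encVec (-v))) (1 + t + (10 * (encVec v).length + 1)) := by
      rintro s' w rfl a l'' t h1 h2 h3
      have := ih v _ (by rw [Stacks.get_emit _ hk, Stacks.get_set_self] :
        ((s.set k (encVec v ++ l)).emit w).get k = encVec v ++ l)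
      rw [Stacks.set_emit _ hk, Stacks.set_set, Stacks.emit_emit] at this
      exact Runs.loop_step h1 (hhalt a h2) h3 this
    have copy : ∀ (w : List Letter), Letter.comma ∉ w → ∀ s' : Stacks,
        s'.get k = w ++ .comma :: (encVec v ++ l) →
        Runs (block [moveUntil .comma k .out, .push .out .comma]) s'
          ((s'.set k (encVec v ++ l)).emit (w ++ [.comma])) (2 * w.length + 3) := by
      intro w hw s' hs'
      have h1 := runs_moveUntil hk hw _ s' hs'
      have h2 := Runs.block_cons h1 (Runs.block_cons (Runs.push .out .comma _) (Runs.block_nil _))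
      have e : ∀ s : Stacks, (((s.set .out (w.reverse ++ s.get .out))).set .out
          (Letter.comma :: ((s.set .out (w.reverse ++ s.get .out))).get .out)) =
          s.emit (w ++ [.comma]) := by
        intro s; simp [Stacks.emit, Stacks.set, Stacks.get]
      have e2 : s'.get .out = (s'.set k (encVec v ++ l)).get .out :=
        (Stacks.get_set_of_ne _ hk.symm _).symm
      rw [e2, e] at h2
      exact h2.mono (by omega)
    -- The first letter of an entry decides: a minus is dropped, a bit gets a minus in front, and a
    -- comma means that the entry is zero, whose word is empty and stays without sign.
    rcases lt_trichotomy z 0 with hz | rfl | hz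
    · have e1 : encInt z = .minus :: encNat z.natAbs := by simp [encInt, hz]
      have e2 : encInt (-z) = encNat z.natAbs := by simp [encInt, hz.le]
      rw [e1, List.cons_append] at h
      have := fin _ _ rfl .minus _ _ h (.inr (.inl rfl)) (by
        rw [if_neg (by decide), if_pos rfl]
        have := copy _ (comma_notMem_encNat z.natAbs) (s.set k _) (Stacks.get_set_self _ _ _)
        rwa [Stacks.set_set] at this)
      rw [e2, e1]
      simp only [List.append_assoc, List.singleton_append] at this
      exact this.mono (by simp; omega)
    · have := fin ((s.set k (encVec v ++ l)).emit [.comma]) _ rfl .comma _ _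
        (by simpa [encInt] using h) (.inr (.inr rfl)) (by
          rw [if_pos rfl]
          exact Runs.block_cons (Runs.push _ _ _) (Runs.block_nil _))
      simp only [neg_zero]
      exact this.mono (by simp [encInt]; omega)
    · have e1 : encInt z = encNat z.natAbs := by simp [encInt, hz.le]
      have e2 : encInt (-z) = .minus :: encNat z.natAbs := by simp [encInt, hz]
      obtain ⟨b, w, hw⟩ := encNat_of_ne_zero (n := z.natAbs) (by omega)
      have hc : Letter.comma ∉ w := fun h =>
        comma_notMem_encNat z.natAbs (by rw [hw]; exact List.mem_cons_of_mem _ h)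
      rw [e1, hw, List.cons_append] at h
      have := fin _ _ rfl (.bit b) _ _ h (.inl ⟨b, rfl⟩) (by
        rw [if_neg (by simp), if_neg (by simp)]
        have h1 := copy w hc ((s.set k (w ++ .comma :: (encVec v ++ l))).emit [.minus, .bit b])
          (by rw [Stacks.get_emit _ hk, Stacks.get_set_self])
        rw [Stacks.set_emit _ hk, Stacks.set_set, Stacks.emit_emit] at h1
        exact Runs.block_cons (runs_emitP _ _) h1)
      rw [e2, e1, hw]
      simp only [List.append_assoc, List.cons_append, List.nil_append] at this ⊢
      exact this.mono (by simp; omega)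

/-- A vector is read from stack `k`, negated and output, up to a halting letter. -/
theorem runs_negate_halt {k : Stk} (hk : k ≠ .out) {d : ℕ} (v : Fin d → ℤ) {c : Letter}
    (hc : ¬((∃ b, c = .bit b) ∨ c = .minus ∨ c = .comma)) (l : List Letter) (s : Stacks)
    (h : s.get k = encVec v ++ c :: l) :
    Runs (negate (· == c) k) s ((s.set k l).emit (encVec (-v))) (10 * (encVec v).length + 1) :=
  runs_negate hk v (fun a ha => by
      have : a ≠ c := by rintro rfl; exact hc ha
      simpa using this) (c :: l) l
    (fun s hs => .loop_halt hs (by simp)) s h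

/-- The content of stack `k`, which is a vector, is negated and output. -/
theorem runs_negate_all {k : Stk} (hk : k ≠ .out) {d : ℕ} (v : Fin d → ℤ) (s : Stacks)
    (h : s.get k = encVec v) :
    Runs (negate never k) s ((s.set k []).emit (encVec (-v))) (10 * (encVec v).length + 1) :=
  runs_negate hk v (fun _ _ => rfl) [] [] (fun s hs => by
    have : s.set k [] = s := by rw [← hs, Stacks.set_get]
    rw [this]; exact .loop_nil hs) s (by rw [h, List.append_nil])

/-- A function is computable in exponential time if a stack program outputs its values in exponential
time. -/
theorem computableInExpTime_of_runs {X Y : Type} {encX : X → List Letter} {encY : Y → List Letter}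
    {f : X → Y} (p : StackProg Stk Letter) (b : Polynomial ℕ)
    (h : ∀ x, ∃ t, 3 * t + 2 ≤ 2 ^ b.eval (encX x).length ∧
      Runs p { inp := encX x } (Stacks.emit {} (encY (f x))) t) :
    ComputableInExpTime encX encY f := by
  -- The output is built in reverse; moving it to `inp` reverses it again, so that `inp` is both the
  -- input and the output stack.
  refine computableInExpTime (.seq p (transfer .out .inp)) .inp .inp b fun x => ?_
  obtain ⟨t, ht, h⟩ := h x
  -- At most `t` letters have been output, so the transfer needs at most `2 * t + 1` steps; together
  -- with `t` and the reset step this is `3 * t + 2`.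
  have hl := h.length_le .out
  obtain ⟨u, hu, e⟩ := h.seq (runs_transfer (j := .out) (k := .inp) (by decide) _)
  have get_inp : ∀ w : List Letter,
      Stacks.get { inp := w } = Function.update (fun _ => []) .inp w := by
    intro w
    funext k
    cases k <;> rfl
  refine ⟨u, ?_, ?_⟩
  · have : (Stacks.get { inp := encX x } .out).length = 0 := rfl
    omega
  · rw [← get_inp, ← get_inp]
    convert e using 2
    simp [Stacks.emit, Stacks.set, Stacks.get]

/-! ### From vector addition systems to data vectors -/

namespace DataVector

variable {d : ℕ}

/-- The data vector with value `u` at `p` and value `v` at `q`. -/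
noncomputable def seg (p q : ℚ) (u v : Fin d → ℤ) : DataVector d :=
  Finsupp.single p u + Finsupp.single q v

theorem IsPermSum.add {x y : DataVector d} {S : Set (DataVector d)} (hx : x.IsPermSum S)
    (hy : y.IsPermSum S) : (x + y).IsPermSum S := by
  obtain ⟨l, hl, rfl⟩ := hx
  obtain ⟨l', hl', rfl⟩ := hy
  refine ⟨l ++ l', fun w hw => ?_, by simp⟩
  rcases List.mem_append.1 hw with h | h
  exacts [hl w h, hl' w h]

theorem IsPermSum.zero {S : Set (DataVector d)} : (0 : DataVector d).IsPermSum S :=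
  ⟨[], by simp, by simp⟩

theorem IsPermSum.of_mem {x : DataVector d} {S : Set (DataVector d)} (hx : x ∈ perm S) :
    x.IsPermSum S :=
  ⟨[x], by simpa using hx, by simp⟩

theorem IsPermSum.sum {ι : Type} {S : Set (DataVector d)} (s : Finset ι) (f : ι → DataVector d)
    (h : ∀ i ∈ s, (f i).IsPermSum S) : (∑ i ∈ s, f i).IsPermSum S :=
  Finset.sum_induction f (fun x => x.IsPermSum S) (fun _ _ => .add) .zero h

theorem IsPermSum.nsmul {x : DataVector d} {S : Set (DataVector d)} (hx : x.IsPermSum S) (n : ℕ) :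
    (n • x).IsPermSum S := by
  induction n with
  | zero => simpa using IsPermSum.zero
  | succ n ih => rw [succ_nsmul]; exact ih.add hx

theorem comp_single (ρ : ℚ ≃o ℚ) (p : ℚ) (u : Fin d → ℤ) :
    comp (Finsupp.single p u) ρ = Finsupp.single (ρ.symm p) u := by
  ext1 α
  rw [comp_apply, Finsupp.single_apply, Finsupp.single_apply]
  congr 1
  rw [eq_iff_iff, ← ρ.symm_apply_eq]

theorem comp_add (v w : DataVector d) (ρ : ℚ ≃o ℚ) : comp (v + w) ρ = comp v ρ + comp w ρ := by
  ext1 α; rfl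

theorem comp_seg (ρ : ℚ ≃o ℚ) (p q : ℚ) (u v : Fin d → ℤ) :
    comp (seg p q u v) ρ = seg (ρ.symm p) (ρ.symm q) u v := by
  rw [seg, seg, comp_add, comp_single, comp_single]

/-- The order automorphism of `ℚ` given by an increasing affine map. -/
def affine (a b : ℚ) (ha : 0 < a) : ℚ ≃o ℚ where
  toFun x := a * x + b
  invFun x := (x - b) / a
  left_inv x := by field_simp; ring
  right_inv x := by field_simp; ring
  map_rel_iff' := by
    intro x y
    simp only [Equiv.coe_fn_mk, add_le_add_iff_right]
    exact mul_le_mul_iff_right₀ ha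

/-- Affine maps already act transitively on pairs of increasing points. The inverse appears because
composition with `ρ` moves a mass at `x` to `ρ.symm x`. -/
theorem seg_mem_perm {S : Set (DataVector d)} {u v : Fin d → ℤ} (h : seg 0 1 u v ∈ S) {p q : ℚ}
    (hpq : p < q) : seg p q u v ∈ perm S := by
  refine ⟨_, h, (affine (q - p) p (by linarith)).symm, ?_⟩
  rw [comp_seg]
  simp [affine]

end DataVector

/-! ### Runs as chains of edges and tokens -/

open DataVector

namespace VAS

variable (V : VAS)

/-- A vector with an additional last coordinate. -/
def ext {d : ℕ} (a : Fin d → ℤ) (z : ℤ) : Fin (d + 1) → ℤ := Fin.append a fun _ : Fin 1 => z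

@[simp] theorem ext_castSucc {d : ℕ} (a : Fin d → ℤ) (z : ℤ) (i : Fin d) :
    ext a z (i.castAdd 1) = a i := Fin.append_left _ _ _

@[simp] theorem ext_last {d : ℕ} (a : Fin d → ℤ) (z : ℤ) (i : Fin 1) :
    ext a z (Fin.natAdd d i) = z := Fin.append_right _ _ _

theorem ext_add {d : ℕ} (a b : Fin d → ℤ) (y z : ℤ) : ext a y + ext b z = ext (a + b) (y + z) := by
  funext i
  refine Fin.addCases (fun i => ?_) (fun i => ?_) i <;> simp

theorem ext_zero {d : ℕ} : ext (0 : Fin d → ℤ) 0 = 0 := by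
  funext i
  refine Fin.addCases (fun i => ?_) (fun i => ?_) i <;> simp

/-- The data vector of a transition; the last coordinate forms a chain of transitions. -/
noncomputable def edge {d : ℕ} (p q : ℚ) (a : Fin d → ℤ) : DataVector (d + 1) :=
  seg p q (ext a (-1)) (ext 0 1)

/-- The data vector of a unit that is kept on a counter. -/
noncomputable def token {d : ℕ} (p q : ℚ) (k : Fin d) : DataVector (d + 1) :=
  seg p q (ext (Pi.single k (-1)) 0) (ext (Pi.single k 1) 0)

/-- The data vector of a run between two configurations. -/
noncomputable def run {d : ℕ} (p q : ℚ) (c c' : Fin d → ℕ) : DataVector (d + 1) :=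
  seg p q (ext (-fun i => (c i : ℤ)) (-1)) (ext (fun i => (c' i : ℤ)) 1)

/-- The data vectors that are summed up. -/
noncomputable def dataVectors : List (DataVector (V.dim + 1)) :=
  -- The edge with the zero vector is an idle step: the control entries of the target require at
  -- least one edge, even if the run is empty.
  V.transitions.map (edge 0 1) ++ edge 0 1 0 :: (List.finRange V.dim).map (token 0 1)

/-- The system of data equations of a vector addition system. -/
noncomputable def toDataSystem : DataSystem where
  dim := V.dim + 1
  vectors := V.dataVectors
  target := run 0 1 V.initial V.final

variable {V}

theorem edge_mem_perm {a : Fin V.dim → ℤ} (ha : a ∈ V.transitions ∨ a = 0) {p q : ℚ} (h : p < q) :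
    edge p q a ∈ perm {v | v ∈ V.dataVectors} := by
  refine seg_mem_perm ?_ h
  rcases ha with ha | rfl
  · exact List.mem_append_left _ (List.mem_map_of_mem ha)
  · exact List.mem_append_right _ List.mem_cons_self

theorem token_mem_perm (k : Fin V.dim) {p q : ℚ} (h : p < q) :
    token p q k ∈ perm {v | v ∈ V.dataVectors} :=
  seg_mem_perm (List.mem_append_right _ (List.mem_cons_of_mem _
    (List.mem_map_of_mem (f := token 0 1) (List.mem_finRange k)))) h

/-- What the first run delivers at `q` is what the second one consumes there, in the counters and in
the control coordinate alike. -/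
theorem run_add_run {d : ℕ} (p q r : ℚ) (c c' c'' : Fin d → ℕ) :
    run p q c c' + run q r c' c'' = run p r c c'' := by
  have h : Finsupp.single q (ext (fun i => (c' i : ℤ)) 1) +
      Finsupp.single q (ext (-fun i => (c' i : ℤ)) (-1)) = 0 := by
    rw [← Finsupp.single_add, ext_add, add_neg_cancel, add_neg_cancel, ext_zero,
      Finsupp.single_zero]
  unfold run seg
  rw [add_assoc, ← add_assoc _ _ (Finsupp.single r _), h, zero_add]

/-- The step takes effect at `p`, so the tokens carry the new configuration `c'` over the interval;
at `p` this leaves `a - c' = -c`. -/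
theorem run_eq {d : ℕ} (p q : ℚ) (c c' : Fin d → ℕ) (a : Fin d → ℤ)
    (h : ∀ i, (c' i : ℤ) = c i + a i) :
    run p q c c' = edge p q a + ∑ k, c' k • token p q k := by
  have e : ∀ (z : ℤ) (r : ℚ), ∑ k, c' k • Finsupp.single r (ext (Pi.single k z) 0) =
      Finsupp.single r (ext (fun i => c' i * z) 0) := by
    intro z r
    simp_rw [Finsupp.smul_single, ← Finsupp.singleAddHom_apply]
    rw [← map_sum]
    congr 1
    funext i
    rw [Finset.sum_apply]
    refine Fin.addCases (fun i => ?_) (fun i => ?_) i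
    · simp [Pi.single_apply]
    · simp
  unfold run edge token seg
  simp_rw [smul_add]
  rw [Finset.sum_add_distrib, e, e, add_add_add_comm, ← Finsupp.single_add, ← Finsupp.single_add,
    ext_add, ext_add]
  congr 3
  · funext i
    have := h i
    simp only [Pi.neg_apply, Pi.add_apply]
    linarith
  · simp

theorem isPermSum_run_step {p q : ℚ} (hpq : p < q) {c c' : Fin V.dim → ℕ} {a : Fin V.dim → ℤ}
    (ha : a ∈ V.transitions ∨ a = 0) (h : ∀ i, (c' i : ℤ) = c i + a i) :
    (run p q c c').IsPermSum {v | v ∈ V.dataVectors} := by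
  rw [run_eq p q c c' a h]
  exact (IsPermSum.of_mem (edge_mem_perm ha hpq)).add
    (.sum _ _ fun k _ => (IsPermSum.of_mem (token_mem_perm k hpq)).nsmul _)

/-- Density of `ℚ` allows to split the interval for every further step; the empty run is an idle
edge. -/
theorem isPermSum_run {c c' : Fin V.dim → ℕ} (h : Relation.ReflTransGen V.Step c c') :
    ∀ {p q : ℚ}, p < q → (run p q c c').IsPermSum {v | v ∈ V.dataVectors} := by
  induction h with
  | refl => exact fun hpq => isPermSum_run_step hpq (.inr rfl) (by simp)
  | @tail b c' _ h ih =>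
    intro p q hpq
    obtain ⟨r, hr, hr'⟩ := exists_between hpq
    obtain ⟨a, ha, h⟩ := h
    rw [← run_add_run p r q c b c']
    exact (ih hr).add (isPermSum_run_step hr' (.inl ha) h)

/-! ### Cuts of the data line and the extraction of a run -/

/-- The sum of a coordinate over the data values before `r`. -/
noncomputable def before {d : ℕ} (r : ℚ) (i : Fin d) : DataVector d →+ ℤ :=
  Finsupp.liftAddHom fun α => if α < r then Pi.evalAddMonoidHom (fun _ => ℤ) i else 0

theorem before_single {d : ℕ} (r : ℚ) (i : Fin d) (p : ℚ) (u : Fin d → ℤ) :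
    before r i (Finsupp.single p u) = if p < r then u i else 0 := by
  rw [before, Finsupp.liftAddHom_apply_single]
  split_ifs <;> rfl

theorem before_seg {d : ℕ} (r : ℚ) (i : Fin d) (p q : ℚ) (u v : Fin d → ℤ) :
    before r i (seg p q u v) = (if p < r then u i else 0) + if q < r then v i else 0 := by
  rw [seg, map_add, before_single, before_single]

/-- The sums of permutations consist of edges and tokens. -/
theorem exists_edges_tokens (l : List (DataVector (V.dim + 1)))
    (h : ∀ w ∈ l, w ∈ perm {v | v ∈ V.dataVectors}) :
    ∃ (E : List (ℚ × ℚ × (Fin V.dim → ℤ))) (T : List (ℚ × ℚ × Fin V.dim)),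
      (∀ e ∈ E, e.1 < e.2.1 ∧ (e.2.2 ∈ V.transitions ∨ e.2.2 = 0)) ∧ (∀ e ∈ T, e.1 < e.2.1) ∧
      l.sum = (E.map fun e => edge e.1 e.2.1 e.2.2).sum +
        (T.map fun e => token e.1 e.2.1 e.2.2).sum := by
  induction l with
  | nil => exact ⟨[], [], by simp, by simp, by simp⟩
  | cons w l ih =>
    obtain ⟨E, T, hE, hT, hs⟩ := ih fun w hw => h w (List.mem_cons_of_mem _ hw)
    obtain ⟨v, hv, ρ, rfl⟩ := h w List.mem_cons_self
    have hρ : ρ.symm 0 < ρ.symm 1 := ρ.symm.strictMono (by norm_num)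
    rcases List.mem_append.1 (show v ∈ _ ++ _ from hv) with hv | hv
    · obtain ⟨a, ha, rfl⟩ := List.mem_map.1 hv
      refine ⟨(ρ.symm 0, ρ.symm 1, a) :: E, T, ?_, hT, ?_⟩
      · rintro e (_ | ⟨_, he⟩)
        exacts [⟨hρ, .inl ha⟩, hE e he]
      · rw [List.sum_cons, hs, edge, comp_seg, List.map_cons, List.sum_cons, add_assoc]; rfl
    · rcases List.mem_cons.1 hv with rfl | hv
      · refine ⟨(ρ.symm 0, ρ.symm 1, 0) :: E, T, ?_, hT, ?_⟩
        · rintro e (_ | ⟨_, he⟩)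
          exacts [⟨hρ, .inr rfl⟩, hE e he]
        · rw [List.sum_cons, hs, edge, comp_seg, List.map_cons, List.sum_cons, add_assoc]; rfl
      · obtain ⟨k, -, rfl⟩ := List.mem_map.1 hv
        refine ⟨E, (ρ.symm 0, ρ.symm 1, k) :: T, hE, ?_, ?_⟩
        · rintro e (_ | ⟨_, he⟩)
          exacts [hρ, hT e he]
        · rw [List.sum_cons, hs, token, comp_seg, List.map_cons, List.sum_cons, add_left_comm]; rfl

theorem list_map_sum_filter {α : Type} (l : List α) (p : α → Prop) [DecidablePred p] (f : α → ℤ) :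
    (l.map fun a => if p a then f a else 0).sum = ((l.filter p).map f).sum := by
  induction l with
  | nil => rfl
  | cons a l ih => by_cases h : p a <;> simp [h, ih]

/-- An edge or token with ends `p < q` influences the sum before the cut `r` in a special way if `p
< r ≤ q`: then only its left end is counted. Comparing the sums before `r` on both sides of the
equation for all `r` recovers the run. -/
theorem reachable_of_isPermSum_run
    (h : (run 0 1 V.initial V.final).IsPermSum {v | v ∈ V.dataVectors}) : V.Reachable := by
  obtain ⟨l, hl, hx⟩ := h
  obtain ⟨E, T, hE, hT, hs⟩ := exists_edges_tokens l hl
  rw [hs] at hx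
  -- In the control coordinate an edge with both ends before `r` cancels, so the sum is minus the
  -- number of edges that cross the cut.
  have hctrl : ∀ r : ℚ, ((E.filter fun e => e.1 < r ∧ r ≤ e.2.1).length : ℤ) =
      if 0 < r ∧ r ≤ 1 then 1 else 0 := by
    intro r
    have := congrArg (before r (Fin.natAdd V.dim 0)) hx
    rw [map_add, map_list_sum, map_list_sum, List.map_map, List.map_map] at this
    simp only [Function.comp_def, edge, token, run, before_seg, ext_last, ite_self,
      add_zero, List.map_const', List.sum_replicate, smul_zero] at this
    have e : ∀ e ∈ E, ((if e.1 < r then (-1 : ℤ) else 0) + if e.2.1 < r then 1 else 0) =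
        if e.1 < r ∧ r ≤ e.2.1 then -1 else 0 := by
      intro e he
      have := (hE e he).1
      split_ifs <;> first | rfl | grind
    rw [List.map_congr_left e, list_map_sum_filter, List.map_const', List.sum_replicate] at this
    simp only [nsmul_eq_mul] at this
    split_ifs at this ⊢ <;> grind
  -- The number of tokens crossing the cut is the value of counter `k` there, which is therefore
  -- nonnegative; beyond `1` the final value has left the sum.
  have hcnt : ∀ (r : ℚ) (k : Fin V.dim), 0 < r →
      ((T.filter fun e => (e.1 < r ∧ r ≤ e.2.1) ∧ e.2.2 = k).length : ℤ) +
        (if 1 < r then (V.final k : ℤ) else 0) =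
      V.initial k + ((E.filter fun e => e.1 < r).map fun e => e.2.2 k).sum := by
    intro r k hr
    have := congrArg (before r (Fin.castAdd 1 k)) hx
    rw [map_add, map_list_sum, map_list_sum, List.map_map, List.map_map] at this
    simp only [Function.comp_def, edge, token, run, before_seg, ext_castSucc,
      Pi.zero_apply, ite_self, add_zero, hr, if_true, Pi.neg_apply] at this
    have e : ∀ e ∈ T, ((if e.1 < r then (Pi.single e.2.2 (-1) : Fin V.dim → ℤ) k else 0) +
        if e.2.1 < r then (Pi.single e.2.2 1 : Fin V.dim → ℤ) k else 0) =
        if (e.1 < r ∧ r ≤ e.2.1) ∧ e.2.2 = k then -1 else 0 := by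
      intro e he
      have := hT e he
      simp only [Pi.single_apply]
      split_ifs <;> first | rfl | grind
    rw [List.map_congr_left e, list_map_sum_filter, list_map_sum_filter, List.map_const',
      List.sum_replicate] at this
    simp only [nsmul_eq_mul] at this
    linarith
  -- An edge starting before `0` would cross the cut at the minimum of `0` and its right end, where
  -- no edge crosses.
  have hnonneg : ∀ e ∈ E, 0 ≤ e.1 := by
    intro e he
    by_contra hlt
    push Not at hlt
    have hr : min 0 e.2.1 ≤ e.2.1 := min_le_right _ _
    have h1 : e.1 < min 0 e.2.1 := lt_min hlt (hE e he).1
    have h2 := hctrl (min 0 e.2.1)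
    rw [if_neg (by simp)] at h2
    have h3 : e ∈ E.filter fun e' => e'.1 < min 0 e.2.1 ∧ min 0 e.2.1 ≤ e'.2.1 := by
      simpa [List.mem_filter, he] using lt_min_iff.1 h1
    have := List.length_pos_of_mem h3
    omega
  -- Edges with a common start `σ` all cross a cut slightly to the right of `σ`, but at most one
  -- edge crosses a cut. Hence the starts order the edges strictly.
  have huniq : ∀ σ : ℚ, (E.filter fun e => e.1 = σ).length ≤ 1 := by
    intro σ
    by_contra hlt
    push Not at hlt
    obtain ⟨r, hr, hr'⟩ : ∃ r, σ < r ∧ ∀ e ∈ E, e.1 = σ → r ≤ e.2.1 := by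
      clear hlt hnonneg hcnt hctrl hs hx
      induction E with
      | nil => exact ⟨σ + 1, by linarith, by simp⟩
      | cons e E ih =>
        obtain ⟨r, hr, hr'⟩ := ih fun e he => hE e (List.mem_cons_of_mem _ he)
        by_cases h : e.1 = σ
        · refine ⟨min r e.2.1, lt_min hr (h ▸ (hE e List.mem_cons_self).1), ?_⟩
          rintro e' (_ | ⟨_, he⟩) h'
          exacts [min_le_right _ _, (min_le_left _ _).trans (hr' e' he h')]
        · refine ⟨r, hr, ?_⟩
          rintro e' (_ | ⟨_, he⟩) h'
          exacts [absurd h' h, hr' e' he h']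
    have h2 := hctrl r
    have h3 : (E.filter fun e => e.1 = σ).length ≤
        (E.filter fun e => e.1 < r ∧ r ≤ e.2.1).length := by
      rw [← List.countP_eq_length_filter, ← List.countP_eq_length_filter]
      refine List.countP_mono_left fun e he h => ?_
      simp only [decide_eq_true_eq] at h ⊢
      exact ⟨h ▸ hr, hr' e he h⟩
    split_ifs at h2 <;> omega
  -- The steps begun before `r`, in the order of their starts, form a run; the induction removes the
  -- last of them.
  have key : ∀ (n : ℕ) (r : ℚ), 0 < r → (E.filter fun e => e.1 < r).length = n →
      ∃ c : Fin V.dim → ℕ, Relation.ReflTransGen V.Step V.initial c ∧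
        ∀ k, (c k : ℤ) = V.initial k + ((E.filter fun e => e.1 < r).map fun e => e.2.2 k).sum := by
    intro n
    induction n using Nat.strong_induction_on with
    | _ n ih =>
      intro r hr hn
      obtain hnil | ⟨m, hm⟩ : (E.filter fun e => e.1 < r) = [] ∨
          ∃ m, (E.filter fun e => e.1 < r).argmax (·.1) = some m := by
        rcases h : (E.filter fun e => e.1 < r).argmax (·.1) with _ | m
        · exact .inl (List.argmax_eq_none.1 h)
        · exact .inr ⟨m, h⟩
      · exact ⟨V.initial, .refl, fun k => by rw [hnil]; simp⟩
      · have hmem := List.argmax_mem hm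
        have hmax := fun e he => List.le_of_mem_argmax (a := e) he hm
        rw [List.mem_filter, decide_eq_true_eq] at hmem
        obtain ⟨hmE, hmr⟩ := hmem
        have hone : (E.filter fun e => e.1 = m.1) = [m] := by
          have h1 : m ∈ E.filter fun e => e.1 = m.1 := by simp [hmE]
          have h2 := huniq m.1
          match hl : E.filter fun e => e.1 = m.1 with
          | [] => simp [hl] at h1
          | [x] => rw [hl] at h1; rw [show m = x from List.mem_singleton.1 h1] at hl ⊢; exact hl
          | x :: y :: t => rw [hl] at h2; simp at h2
        have hsum : ∀ f : ℚ × ℚ × (Fin V.dim → ℤ) → ℤ,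
            ((E.filter fun e => e.1 < r).map f).sum =
            ((E.filter fun e => e.1 < m.1).map f).sum + f m := by
          intro f
          have h1 : f m = ((E.filter fun e => e.1 = m.1).map f).sum := by rw [hone]; simp
          rw [h1, ← list_map_sum_filter, ← list_map_sum_filter, ← list_map_sum_filter,
            ← List.sum_map_add]
          refine congrArg List.sum (List.map_congr_left fun e he => ?_)
          by_cases h : e.1 < r
          · have := hmax e (by simp [he, h])
            rcases this.lt_or_eq with h' | h'
            · simp [h, h', h'.ne]
            · simp [h', hmr]
          · have h1 : ¬ e.1 < m.1 := fun h' => h (h'.trans hmr)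
            have h2 : ¬ e.1 = m.1 := fun h' => h (h' ▸ hmr)
            simp [h, h1, h2]
        have hlen : (E.filter fun e => e.1 < m.1).length < n := by
          have := hsum fun _ => 1
          simp only [List.map_const', List.sum_replicate, nsmul_eq_mul] at this
          omega
        have hprev : ∃ c : Fin V.dim → ℕ, Relation.ReflTransGen V.Step V.initial c ∧
            ∀ k, (c k : ℤ) = V.initial k +
              ((E.filter fun e => e.1 < m.1).map fun e => e.2.2 k).sum := by
          -- The induction hypothesis needs a positive cut. If the last edge starts at `0`, then no
          -- edge starts before it.
          rcases (hnonneg m hmE).lt_or_eq with h | h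
          · exact ih _ hlen _ h rfl
          · refine ⟨V.initial, .refl, fun k => ?_⟩
            have : (E.filter fun e => e.1 < m.1) = [] := by
              rw [List.filter_eq_nil_iff]
              intro e he
              simpa [← h] using hnonneg e he
            rw [this]; simp
        obtain ⟨c, hc, hc'⟩ := hprev
        -- By `hcnt` at `r`, the value after the last step is a number of tokens, plus the final
        -- value if `r` lies beyond `1`.
        have hval : ∀ k, 0 ≤ (c k : ℤ) + m.2.2 k := by
          intro k
          have h1 := hcnt r k hr
          rw [hsum fun e => e.2.2 k, ← add_assoc, ← hc' k] at h1
          rw [← h1]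
          split_ifs <;> positivity
        refine ⟨fun k => ((c k : ℤ) + m.2.2 k).toNat, ?_, fun k => ?_⟩
        · rcases (hE m hmE).2 with h | h
          · exact hc.tail ⟨m.2.2, h, fun k => Int.toNat_of_nonneg (hval k)⟩
          · simpa [h] using hc
        · rw [Int.toNat_of_nonneg (hval k), hsum fun e => e.2.2 k, ← add_assoc, ← hc' k]
  -- At a cut behind everything no token crosses, so the configuration reached there is the final
  -- one.
  obtain ⟨r, hr1, hrE, hrT⟩ : ∃ r : ℚ, 1 < r ∧ (∀ e ∈ E, e.1 < r) ∧ ∀ e ∈ T, e.2.1 < r := by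
    obtain ⟨b, hb⟩ := (((1 : ℚ) :: (E.map (·.1) ++ T.map (·.2.1))).toFinset).exists_le
    refine ⟨b + 1, by linarith [hb 1 (by simp)], fun e he => ?_, fun e he => ?_⟩
    · have := hb e.1 (by
        simp only [List.mem_toFinset]
        exact List.mem_cons_of_mem _ (List.mem_append_left _ (List.mem_map_of_mem he)))
      linarith
    · have := hb e.2.1 (by
        simp only [List.mem_toFinset]
        exact List.mem_cons_of_mem _ (List.mem_append_right _
          (List.mem_map_of_mem (f := fun e : ℚ × ℚ × Fin V.dim => e.2.1) he)))
      linarith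
  obtain ⟨c, hc, hc'⟩ := key _ r (by linarith) rfl
  have : c = V.final := by
    funext k
    have h1 := hcnt r k (by linarith)
    have h2 : (T.filter fun e => (e.1 < r ∧ r ≤ e.2.1) ∧ e.2.2 = k) = [] := by
      rw [List.filter_eq_nil_iff]
      intro e he
      have := hrT e he
      simp only [decide_eq_true_eq]
      rintro ⟨⟨-, h⟩, -⟩
      linarith
    rw [h2, if_pos hr1, ← hc' k] at h1
    simpa using h1.symm
  rw [this] at hc
  exact hc

theorem reachable_iff_solvable (V : VAS) : V.Reachable ↔ V.toDataSystem.Solvable :=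
  ⟨fun h => isPermSum_run h (by norm_num), reachable_of_isPermSum_run⟩

end VAS

/-! ### Words that encode zero and unit vectors and two-point data vectors -/

theorem encInt_zero : encInt 0 = [] := rfl
theorem encInt_one : encInt 1 = [.bit true] := rfl
theorem encInt_neg_one : encInt (-1) = [.minus, .bit true] := rfl
theorem encRat_zero : encRat 0 = [.slash, .bit true] := rfl
theorem encRat_one : encRat 1 = [.bit true, .slash, .bit true] := rfl

theorem encVec_const_zero (d : ℕ) : encVec (0 : Fin d → ℤ) = List.replicate d .comma := by
  have : List.ofFn (0 : Fin d → ℤ) = List.replicate d 0 := List.ofFn_const d 0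
  rw [encVec, this]
  clear this
  induction d with
  | zero => rfl
  | succ d ih => simp [List.replicate_succ, encInt_zero, ih]

/-- Zero is written as the empty word, so a zero entry leaves only its comma. -/
theorem encVec_eq_of_val {d : ℕ} (j r : ℕ) (hd : d = j + 1 + r) (z : ℤ) (v : Fin d → ℤ)
    (hv : ∀ i : Fin d, v i = if (i : ℕ) = j then z else 0) :
    encVec v = List.replicate j .comma ++ encInt z ++ .comma :: List.replicate r .comma := by
  subst hd
  have e : v = Fin.append (Fin.append (0 : Fin j → ℤ) fun _ : Fin 1 => z) (0 : Fin r → ℤ) := by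
    funext i
    rw [hv]
    refine Fin.addCases (fun i => ?_) (fun i => ?_) i
    · rw [Fin.append_left]
      refine Fin.addCases (fun i => ?_) (fun i => ?_) i
      · rw [Fin.append_left, if_neg]
        · rfl
        · simpa using i.2.ne
      · rw [Fin.append_right, if_pos]
        simp
    · rw [Fin.append_right, if_neg]
      · rfl
      · simp only [Fin.val_natAdd]; omega
  rw [e, encVec_append, encVec_append, encVec_const_zero, encVec_const_zero]
  simp [encVec]

theorem length_encVec_ge {d : ℕ} (v : Fin d → ℤ) : d ≤ (encVec v).length := by
  rw [encVec, List.length_flatMap]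
  calc d = ((List.ofFn v).map fun _ => 1).sum := by
        rw [List.map_const', List.sum_replicate, List.length_ofFn, smul_eq_mul, mul_one]
    _ ≤ _ := List.sum_le_sum fun z _ => by simp

/-- The word of a data vector with two data values. -/
def segWord (u v : List Letter) : List Letter :=
  [.slash, .bit true, .colon] ++ u ++ [.semicolon, .bit true, .slash, .bit true, .colon] ++ v ++
    [.semicolon]

/-- Both values must be nonzero because the encoding lists the support only. -/
theorem encDataVector_seg {d : ℕ} {u v : Fin d → ℤ} (hu : u ≠ 0) (hv : v ≠ 0) :
    encDataVector (seg 0 1 u v) = segWord (encVec u) (encVec v) := by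
  have h0 : seg 0 1 u v 0 = u := by simp [seg]
  have h1 : seg 0 1 u v 1 = v := by simp [seg]
  have hs : (seg 0 1 u v).support = {0, 1} := by
    ext α
    simp only [Finsupp.mem_support_iff, Finset.mem_insert, Finset.mem_singleton]
    constructor
    · intro h
      by_contra hc
      push Not at hc
      exact h (by simp [seg, hc.1.symm, hc.2.symm])
    · rintro (rfl | rfl)
      · rwa [h0]
      · rwa [h1]
  have hsort : (seg 0 1 u v).support.sort (· ≤ ·) = [0, 1] := by
    rw [hs]
    exact (Finset.sort_insert (r := (· ≤ ·)) (a := (0 : ℚ)) (s := {1}) (by simp) (by simp)).trans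
      (congrArg _ (Finset.sort_singleton _ _))
  rw [encDataVector, hsort]
  simp [h0, h1, encRat_zero, encRat_one, segWord]

namespace VAS

theorem encVec_ext {d : ℕ} (a : Fin d → ℤ) (z : ℤ) :
    encVec (ext a z) = encVec a ++ encInt z ++ [.comma] := by
  rw [ext, encVec_append]
  simp [encVec]

theorem ext_ne_zero {d : ℕ} (a : Fin d → ℤ) {z : ℤ} (h : z ≠ 0 ∨ a ≠ 0) : ext a z ≠ 0 := by
  intro hc
  rcases h with h | h
  · exact h (by simpa using congrFun hc (Fin.natAdd d 0))
  · exact h (by funext i; simpa using congrFun hc (Fin.castAdd 1 i))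

/-- The word of an edge. -/
def edgeWord (d : ℕ) (w : List Letter) : List Letter :=
  segWord (w ++ [.minus, .bit true, .comma])
    (List.replicate d .comma ++ [.bit true, .comma]) ++ [.bar]

theorem encDataVector_edge {d : ℕ} (a : Fin d → ℤ) :
    encDataVector (edge 0 1 a) ++ [.bar] = edgeWord d (encVec a) := by
  rw [edge, encDataVector_seg (ext_ne_zero _ (by simp)) (ext_ne_zero _ (by simp)), encVec_ext,
    encVec_ext, encVec_const_zero]
  simp [edgeWord, encInt_neg_one, encInt_one]

/-- The word of a token. -/
def tokenWord (j r : ℕ) : List Letter :=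
  segWord (List.replicate j .comma ++ [.minus, .bit true, .comma] ++ List.replicate r .comma ++
    [.comma]) (List.replicate j .comma ++ [.bit true, .comma] ++ List.replicate r .comma ++
    [.comma]) ++ [.bar]

theorem encDataVector_token {d : ℕ} (k : Fin d) :
    encDataVector (token 0 1 k) ++ [.bar] = tokenWord k (d - 1 - k) := by
  have e : ∀ z : ℤ, encVec (Pi.single k z : Fin d → ℤ) =
      List.replicate k .comma ++ encInt z ++ .comma :: List.replicate (d - 1 - k) .comma :=
    fun z => encVec_eq_of_val _ _ (by omega) z _ fun i => by
      simp [Pi.single_apply, Fin.ext_iff]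
  rw [token, encDataVector_seg (ext_ne_zero _ (by simp)) (ext_ne_zero _ (by simp)), encVec_ext,
    encVec_ext, e, e]
  simp [tokenWord, encInt_neg_one, encInt_one, encInt_zero]

theorem encDataVector_run {d : ℕ} (c c' : Fin d → ℕ) :
    encDataVector (run 0 1 c c') = segWord
      (encVec (-fun i => (c i : ℤ)) ++ [.minus, .bit true, .comma])
      (encVec (fun i => (c' i : ℤ)) ++ [.bit true, .comma]) := by
  rw [run, encDataVector_seg (ext_ne_zero _ (by simp)) (ext_ne_zero _ (by simp)), encVec_ext,
    encVec_ext]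
  simp [encInt_neg_one, encInt_one]

/-- The words of the tokens, where `j` counters have been treated already. -/
def tokenWords (j : ℕ) : ℕ → List Letter
  | 0 => []
  | r + 1 => tokenWord j r ++ tokenWords (j + 1) r

theorem tokenWords_eq (d j r : ℕ) (h : j + r = d) : tokenWords j r =
    ((List.finRange d).drop j).flatMap fun k : Fin d => tokenWord k.val (d - 1 - k.val) := by
  induction r generalizing j with
  | zero =>
    rw [List.drop_eq_nil_of_le (by simp; omega)]
    rfl
  | succ r ih =>
    rw [List.drop_eq_getElem_cons (by simp; omega), List.flatMap_cons, tokenWords, ih _ (by omega)]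
    simp only [List.getElem_finRange, Fin.val_cast]
    congr 2
    omega

/-- The additional unit of the dimension and the control entries are split off, since everything
else is derived from parts of the input word. -/
theorem encode_toDataSystem (V : VAS) : V.toDataSystem.encode =
    List.replicate V.dim (.bit true) ++ [.bit true, .bar] ++
      segWord (encVec (-fun i => (V.initial i : ℤ)) ++ [.minus, .bit true, .comma])
        (encVec (fun i => (V.final i : ℤ)) ++ [.bit true, .comma]) ++ [.bar] ++
      (V.transitions.flatMap fun a => edgeWord V.dim (encVec a)) ++
      edgeWord V.dim (List.replicate V.dim .comma) ++ tokenWords 0 V.dim := by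
  have e : V.dataVectors.flatMap (fun v => encDataVector v ++ [.bar]) =
      (V.transitions.flatMap fun a => edgeWord V.dim (encVec a)) ++
      edgeWord V.dim (List.replicate V.dim .comma) ++ tokenWords 0 V.dim := by
    rw [dataVectors, List.flatMap_append, List.flatMap_map, List.flatMap_cons, List.flatMap_map]
    simp only [encDataVector_edge, encDataVector_token, encVec_const_zero]
    rw [tokenWords_eq V.dim 0 V.dim (by omega), List.drop_zero, List.append_assoc]
  unfold DataSystem.encode
  erw [e, encDataVector_run]
  simp [toDataSystem, List.replicate_succ', List.append_assoc]

end VAS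

/-! ### The machine for the reduction to data vectors -/

theorem flatten_replicate_singleton {α : Type} (n : ℕ) (a : α) :
    (List.replicate n [a]).flatten = List.replicate n a := by
  simp

theorem runs_emitPer_one {k : Stk} (hk : k ≠ .out) (hk' : k ≠ .tmp) (a : Letter) (s : Stacks)
    (hs : s.tmp = []) (n : ℕ) (hn : (s.get k).length = n) :
    Runs (emitPer k [a]) s (s.emit (List.replicate n a)) (6 * n + 2) := by
  have := runs_emitPer hk hk' [a] s hs
  rw [flatten_replicate_singleton, hn] at this
  exact this.mono (by simp; omega)

namespace VAS

/-- Outputs the word of an edge, where `p` outputs the vector. -/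
def edgeProg (p : StackProg Stk Letter) : StackProg Stk Letter := block [
  emitP [.slash, .bit true, .colon], p,
  emitP [.minus, .bit true, .comma, .semicolon, .bit true, .slash, .bit true, .colon],
  emitPer .dim [.comma], emitP [.bit true, .comma, .semicolon, .bar]]

/-- The program `p` may consume a transition from a stack, hence two states `s` and `s'`; for the
idle edge, which prints zeros, they agree. -/
theorem runs_edgeProg {p : StackProg Stk Letter} {s s' : Stacks} {w : List Letter} {t d : ℕ}
    (h : ∀ v, Runs p (s.emit v) ((s'.emit v).emit w) t) (hs : s'.tmp = [])
    (hd : s'.dim.length = d) :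
    Runs (edgeProg p) s (s'.emit (edgeWord d w)) (6 * d + t + 21) := by
  refine Runs.mono (.block_cons (runs_emitP _ _) (.block_cons (h _) (.block_cons (runs_emitP _ _)
    (.block_cons (runs_emitPer_one (k := .dim) (by decide) (by decide) _ _ (by exact hs) d (by exact hd))
      (.block_cons (runs_emitP _ _) (.block_nil_of_eq ?_)))))) ?_
  · simp [edgeWord, segWord]
  · simp; omega

/-- Outputs the words of the transitions. -/
def edgesProg : StackProg Stk Letter := .loop .buf2 never fun a => .seq (.push .buf2 a)
  (edgeProg (moveUntil .semicolon .buf2 .out))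

theorem semicolon_notMem_encVec {d : ℕ} (v : Fin d → ℤ) : Letter.semicolon ∉ encVec v := by
  intro h
  rcases mem_encVec h with ⟨_, h⟩ | h | h <;> cases h

theorem bar_notMem_encVec {d : ℕ} (v : Fin d → ℤ) : Letter.bar ∉ encVec v := by
  intro h
  rcases mem_encVec h with ⟨_, h⟩ | h | h <;> cases h

theorem runs_edgesProg {d N : ℕ} (l : List (Fin d → ℤ)) (s : Stacks) (hs : s.tmp = [])
    (hd : s.dim.length = d) (hb : s.buf2 = l.flatMap fun a => encVec a ++ [.semicolon])
    (hN : s.buf2.length + d ≤ N) :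
    Runs edgesProg s ((s.set .buf2 []).emit (l.flatMap fun a => edgeWord d (encVec a)))
      (l.length * (8 * N + 30) + 1) := by
  induction l generalizing s with
  | nil =>
    have e : s.set .buf2 [] = s := by
      rw [show ([] : List Letter) = s.get .buf2 from hb.symm, Stacks.set_get]
    rw [e]
    exact (Runs.loop_nil (k := .buf2) hb).mono (by omega)
  | cons a l ih =>
    obtain ⟨c, w, hw⟩ : ∃ c w, s.buf2 = c :: w := by
      rcases h : s.buf2 with _ | ⟨c, w⟩
      · rw [h] at hb; simp at hb
      · exact ⟨c, w, rfl⟩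
    have h1 : s.buf2 = encVec a ++ .semicolon :: l.flatMap fun a => encVec a ++ [.semicolon] := by
      rw [hb]; simp
    have h2 : Runs (edgeProg (moveUntil .semicolon .buf2 .out)) s
        ((s.set .buf2 (l.flatMap fun a => encVec a ++ [.semicolon])).emit (edgeWord d (encVec a)))
        (6 * d + (2 * (encVec a).length + 1) + 21) := by
      refine runs_edgeProg (fun v => ?_) hs hd
      have := runs_moveUntil (j := .buf2) (k := .out) (by decide) (semicolon_notMem_encVec a) _
        (s.emit v) h1
      exact this
    have h3 := ih ((s.set .buf2 (l.flatMap fun a => encVec a ++ [.semicolon])).emit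
      (edgeWord d (encVec a))) hs hd rfl (by
        have : ((s.set .buf2 (l.flatMap fun a => encVec a ++ [.semicolon])).emit
          (edgeWord d (encVec a))).buf2 = l.flatMap fun a => encVec a ++ [.semicolon] := rfl
        rw [this]
        rw [h1] at hN
        simp only [List.length_append, List.length_cons] at hN
        omega)
    -- The loop pops a letter only to see whether a transition is left; pushing it back restores the
    -- stack.
    have h4 := (Runs.push .buf2 c (s.set .buf2 w)).seq (p := .push .buf2 c)
      (q := edgeProg (moveUntil .semicolon .buf2 .out)) (s'' := _) (t' := _) (by
        have e : (s.set .buf2 w).set .buf2 (c :: (s.set .buf2 w).get .buf2) = s := by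
          rw [Stacks.set_set, Stacks.get_set_self, ← hw]; exact Stacks.set_get s .buf2
        rw [e]; exact h2)
    have h5 := Runs.loop_step (halt := never) (k := .buf2) (s := s) (body := fun a =>
      .seq (.push .buf2 a) (edgeProg (moveUntil .semicolon .buf2 .out))) hw rfl h4 h3
    rw [Stacks.set_emit _ (by decide), Stacks.emit_emit, Stacks.set_set] at h5
    rw [List.flatMap_cons]
    refine h5.mono ?_
    rw [h1] at hN
    simp only [List.length_append, List.length_cons] at hN ⊢
    nlinarith

/-- Outputs the words of the tokens. -/
def tokensProg : StackProg Stk Letter := .loop .dim never fun a => block [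
  emitP [.slash, .bit true, .colon], emitPer .left [.comma], emitP [.minus, .bit true, .comma],
  emitPer .dim [.comma], emitP [.comma, .semicolon, .bit true, .slash, .bit true, .colon],
  emitPer .left [.comma], emitP [.bit true, .comma], emitPer .dim [.comma],
  emitP [.comma, .semicolon, .bar], .push .left a]

/-- During a pass, `left` holds one letter for every earlier coordinate and `dim` one for every
later coordinate. Only the number of letters matters, so the final content of `left` is not
specified. -/
theorem runs_tokensProg {N : ℕ} (r j : ℕ) (s : Stacks) (hs : s.tmp = []) (hr : s.dim.length = r)
    (hj : s.left.length = j) (hN : j + r ≤ N) :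
    ∃ l, Runs tokensProg s (((s.set .dim []).set .left l).emit (tokenWords j r))
      (r * (12 * N + 40) + 1) ∧ l.length = j + r := by
  induction r generalizing s j with
  | zero =>
    refine ⟨s.left, ?_, hj⟩
    have hd : s.dim = [] := List.length_eq_zero_iff.1 hr
    have e : s.set .dim [] = s := by
      rw [show ([] : List Letter) = s.get .dim from hd.symm, Stacks.set_get]
    rw [e]
    exact (Runs.loop_nil (k := .dim) hd).mono (by omega)
  | succ r ih =>
    obtain ⟨a, w, hw⟩ := List.exists_cons_of_length_eq_add_one hr
    have hwl : w.length = r := by simpa [hw] using hr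
    obtain ⟨l, h, hl⟩ := ih (j + 1) (((s.set .dim w).emit (tokenWord j r)).set .left (a :: s.left)) hs
      hwl (by simp [Stacks.set, hj]) (by omega)
    refine ⟨l, ?_, by omega⟩
    have hb : Runs (block [
        emitP [.slash, .bit true, .colon], emitPer .left [.comma],
        emitP [.minus, .bit true, .comma], emitPer .dim [.comma],
        emitP [.comma, .semicolon, .bit true, .slash, .bit true, .colon],
        emitPer .left [.comma], emitP [.bit true, .comma], emitPer .dim [.comma],
        emitP [.comma, .semicolon, .bar], .push .left a]) (s.set .dim w)
        (((s.set .dim w).emit (tokenWord j r)).set .left (a :: s.left)) (12 * N + 39) := by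
      refine Runs.mono (.block_cons (runs_emitP _ _)
        (.block_cons (runs_emitPer_one (k := .left) (by decide) (by decide) _ _ (by exact hs) j (by exact hj))
        (.block_cons (runs_emitP _ _)
        (.block_cons (runs_emitPer_one (k := .dim) (by decide) (by decide) _ _ (by exact hs) r (by exact hwl))
        (.block_cons (runs_emitP _ _)
        (.block_cons (runs_emitPer_one (k := .left) (by decide) (by decide) _ _ (by exact hs) j (by exact hj))
        (.block_cons (runs_emitP _ _)
        (.block_cons (runs_emitPer_one (k := .dim) (by decide) (by decide) _ _ (by exact hs) r (by exact hwl))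
        (.block_cons (runs_emitP _ _)
        (.block_cons (Runs.push _ _ _) (.block_nil_of_eq ?_))))))))))) ?_
      · simp only [Stacks.emit_emit]
        rw [Stacks.get_emit _ (by decide)]
        simp [tokenWord, segWord]
        rfl
      · simp; omega
    have h5 := Runs.loop_step (halt := never) (k := .dim) (s := s) hw rfl hb h
    have e : ((((((s.set .dim w).emit (tokenWord j r)).set .left (a :: s.left)).set .dim []).set
        .left l).emit (tokenWords (j + 1) r)) =
        ((s.set .dim []).set .left l).emit (tokenWords j (r + 1)) := by
      rw [tokenWords, ← Stacks.emit_emit]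
      rfl
    rw [e] at h5
    refine h5.mono ?_
    ring_nf
    omega

/-- The program of the reduction from vector addition systems to data vectors. -/
def toDataSystemProg : StackProg Stk Letter := block [
  moveUntil .bar .inp .dim, emitPer .dim [.bit true], emitP [.bit true, .bar],
  -- The transitions precede the configurations in the input, but the target precedes the edges in
  -- the output. They are therefore set aside on `buf2`, moved twice to keep their order.
  moveUntil .bar .inp .buf, transfer .buf .buf2,
  emitP [.slash, .bit true, .colon], negate (· == .bar) .inp,
  emitP [.minus, .bit true, .comma, .semicolon, .bit true, .slash, .bit true, .colon],
  transfer .inp .out, emitP [.bit true, .comma, .semicolon, .bar],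
  edgesProg, edgeProg (emitPer .dim [.comma]), tokensProg,
  clear .left]

theorem length_transitions_le (V : VAS) : V.transitions.length ≤
    (V.transitions.flatMap fun a => encVec a ++ [.semicolon]).length := by
  rw [List.length_flatMap]
  calc V.transitions.length = (V.transitions.map fun _ => 1).sum := by
        rw [List.map_const', List.sum_replicate, smul_eq_mul, mul_one]
    _ ≤ _ := List.sum_le_sum fun z _ => by simp

theorem runs_toDataSystemProg (V : VAS) :
    Runs toDataSystemProg { inp := V.encode } (Stacks.emit {} V.toDataSystem.encode)
      (100 * (V.encode.length + 1) ^ 2) := by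
  have hA := length_transitions_le V
  have hlen : V.encode.length = V.dim + 1 + ((V.transitions.flatMap fun a =>
      encVec a ++ [.semicolon]).length + 1 + ((encVec fun i => (V.initial i : ℤ)).length + 1 +
      (encVec fun i => (V.final i : ℤ)).length)) := by
    simp [VAS.encode]; omega
  have hi := length_encVec_ge fun i => (V.initial i : ℤ)
  generalize hN : V.encode.length = N at *
  set A := V.transitions.flatMap fun a => encVec a ++ [.semicolon] with hAdef
  have hbA : Letter.bar ∉ A := by
    intro h
    obtain ⟨a, -, h⟩ := List.mem_flatMap.1 h
    rcases List.mem_append.1 h with h | h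
    · exact bar_notMem_encVec a h
    · simp at h
  set d := V.dim with hd
  have h1 : Runs (moveUntil .bar .inp .dim) { inp := V.encode }
      { inp := A ++ .bar :: (encVec (fun i => (V.initial i : ℤ)) ++ .bar ::
          encVec fun i => (V.final i : ℤ)), dim := List.replicate d (.bit true) } (2 * d + 1) := by
    have := runs_moveUntil (j := .inp) (k := .dim) (by decide) (c := .bar)
      (w := List.replicate d (.bit true)) (by simp) _ { inp := V.encode } rfl
    refine (this.congr ?_).mono (by simp)
    simp [Stacks.set, Stacks.get, ← hAdef, hd]
  have h2 : ∀ inp w, Runs (moveUntil .bar .inp .buf)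
      (Stacks.emit { inp := A ++ .bar :: inp, dim := List.replicate d (.bit true) } w)
      (Stacks.emit { inp := inp, buf := A.reverse, dim := List.replicate d (.bit true) } w)
      (2 * A.length + 1) := by
    intro inp w
    have := runs_moveUntil (j := .inp) (k := .buf) (by decide) (c := .bar) hbA inp
      (Stacks.emit { inp := A ++ .bar :: inp, dim := List.replicate d (.bit true) } w) rfl
    refine this.congr ?_
    simp [Stacks.set, Stacks.get, Stacks.emit]
  have h3 : ∀ inp w, Runs (transfer .buf .buf2)
      (Stacks.emit { inp := inp, buf := A.reverse, dim := List.replicate d (.bit true) } w)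
      (Stacks.emit { inp := inp, buf2 := A, dim := List.replicate d (.bit true) } w)
      (2 * A.length + 1) := by
    intro inp w
    have := runs_transfer (j := .buf) (k := .buf2) (by decide)
      (Stacks.emit { inp := inp, buf := A.reverse, dim := List.replicate d (.bit true) } w)
    refine (this.congr ?_).mono (by simp [Stacks.get, Stacks.emit])
    simp [Stacks.set, Stacks.get, Stacks.emit]
  have h4 : ∀ inp w, Runs (transfer .inp .out)
      (Stacks.emit { inp := inp, buf2 := A, dim := List.replicate d (.bit true) } w)
      (Stacks.emit { buf2 := A, dim := List.replicate d (.bit true) } (w ++ inp))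
      (2 * inp.length + 1) := by
    intro inp w
    have := runs_transfer (j := .inp) (k := .out) (by decide)
      (Stacks.emit { inp := inp, buf2 := A, dim := List.replicate d (.bit true) } w)
    refine (this.congr ?_).mono (by simp [Stacks.get, Stacks.emit])
    simp [Stacks.set, Stacks.get, Stacks.emit]
  have h5 : ∀ w, Runs edgesProg (Stacks.emit { buf2 := A, dim := List.replicate d (.bit true) } w)
      (Stacks.emit { dim := List.replicate d (.bit true) }
        (w ++ V.transitions.flatMap fun a => edgeWord d (encVec a)))
      (V.transitions.length * (8 * N + 30) + 1) := by
    intro w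
    have := runs_edgesProg (N := N) V.transitions
      (Stacks.emit { buf2 := A, dim := List.replicate d (.bit true) } w) rfl
      (by simp [Stacks.emit, hd]) rfl (by simp only [Stacks.emit]; omega)
    refine this.congr ?_
    simp [Stacks.set, Stacks.emit, hd]
  have h6 : ∀ w, Runs (edgeProg (emitPer .dim [.comma]))
      (Stacks.emit { dim := List.replicate d (.bit true) } w)
      (Stacks.emit { dim := List.replicate d (.bit true) }
        (w ++ edgeWord d (List.replicate d .comma))) (6 * d + (6 * d + 2) + 21) := by
    intro w
    have := runs_edgeProg (p := emitPer .dim [.comma])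
      (s := Stacks.emit { dim := List.replicate d (.bit true) } w)
      (s' := Stacks.emit { dim := List.replicate d (.bit true) } w) (d := d)
      (w := List.replicate d .comma)
      (fun v => runs_emitPer_one (k := .dim) (by decide) (by decide) _ _ rfl d
        (by simp [Stacks.emit, Stacks.get])) rfl (by simp [Stacks.emit])
    rwa [Stacks.emit_emit] at this
  have h7 : ∀ w, ∃ l, Runs tokensProg (Stacks.emit { dim := List.replicate d (.bit true) } w)
      (Stacks.emit { left := l } (w ++ tokenWords 0 d)) (d * (12 * d + 40) + 1) ∧
      l.length = d := by
    intro w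
    obtain ⟨l, h, hl⟩ := runs_tokensProg (N := d) d 0
      (Stacks.emit { dim := List.replicate d (.bit true) } w) rfl (by simp [Stacks.emit]) rfl
      (by omega)
    refine ⟨l, h.congr ?_, by omega⟩
    simp [Stacks.set, Stacks.emit]
  obtain ⟨l, h7, hl⟩ := h7 _
  refine Runs.mono (.block_cons h1 (.block_cons
    (runs_emitPer_one (k := .dim) (by decide) (by decide) _ _ rfl d (by simp [Stacks.get]))
    (.block_cons (runs_emitP _ _) (.block_cons (by rw [Stacks.emit_emit]; exact h2 _ _)
    (.block_cons (h3 _ _) (.block_cons (runs_emitP _ _)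
    (.block_cons (runs_negate_halt (k := .inp) (by decide) (fun i => (V.initial i : ℤ)) (c := .bar)
      (by simp) (encVec fun i => (V.final i : ℤ)) _ rfl)
    (.block_cons (runs_emitP _ _)
    (.block_cons (by
      simp only [Stacks.emit_emit, Stacks.set_emit _ (show Stk.inp ≠ .out by decide)]
      exact h4 _ _)
    (.block_cons (runs_emitP _ _) (.block_cons (by rw [Stacks.emit_emit]; exact h5 _)
    (.block_cons (h6 _) (.block_cons h7 (.block_cons (runs_clear .left _)
    (.block_nil_of_eq ?_)))))))))))))))  ?_
  · rw [encode_toDataSystem]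
    simp [Stacks.set, Stacks.emit, segWord, ← hd]
  · have e1 : V.transitions.length * (8 * N + 30) ≤ N * (8 * N + 30) :=
      Nat.mul_le_mul_right _ (by omega)
    have e2 : d * (12 * d + 40) ≤ N * (12 * N + 40) := Nat.mul_le_mul (by omega) (by omega)
    have e3 : (Stacks.get (Stacks.emit { left := l } []) .left).length = d := hl
    simp only [List.length_cons, List.length_nil]
    rw [Stacks.get_emit _ (by decide)] at e3 ⊢
    rw [e3]
    nlinarith

/-- The reduction from vector addition systems to data vectors is computable in exponential time. -/
theorem computableInExpTime_toDataSystem :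
    ComputableInExpTime VAS.encode DataSystem.encode toDataSystem := by
  -- The polynomial comes from `(n + 1) ^ 2 ≤ 2 ^ (2 * n)` and `3 * 100 + 2 ≤ 2 ^ 9`.
  refine computableInExpTime_of_runs toDataSystemProg (2 * Polynomial.X + 9) fun V =>
    ⟨_, ?_, runs_toDataSystemProg V⟩
  have h := Nat.lt_two_pow_self (n := V.encode.length)
  have h2 : (V.encode.length + 1) ^ 2 ≤ 2 ^ (2 * V.encode.length) := by
    rw [mul_comm, pow_mul]
    exact Nat.pow_le_pow_left h 2
  have h3 : 1 ≤ (V.encode.length + 1) ^ 2 := Nat.one_le_pow _ _ (by omega)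
  simp only [Polynomial.eval_add, Polynomial.eval_mul, Polynomial.eval_ofNat, Polynomial.eval_X]
  rw [pow_add]
  omega

end VAS

/-! ### Zero-sum families have orderings with bounded partial sums -/

section ZeroSum

variable {ι : Type}

/-- Integers with sum zero can be ordered so that the partial sums are small. -/
theorem exists_list_abs_partialSum_le (u : ι → ℤ) (K : ℕ) (n : ℕ) :
    ∀ (m : Multiset ι) (s : ℤ), m.card = n → (∀ a ∈ m, |u a| ≤ K) → |s| ≤ K →
      s + (m.map u).sum = 0 →
      ∃ l : List ι, (l : Multiset ι) = m ∧ ∀ p, p <+: l → |s + (p.map u).sum| ≤ K := by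
  classical
  induction n with
  | zero =>
    intro m s hm _ hs _
    rw [Multiset.card_eq_zero] at hm
    subst hm
    refine ⟨[], rfl, fun p hp => ?_⟩
    rw [List.prefix_nil.1 hp]
    simpa using hs
  | succ n ih =>
    intro m s hm hu hs h0
    -- Greedy choice: as the remaining terms have sum `-s`, one of them does not have the strict
    -- sign of `s`, and adding it cannot leave the interval from `-K` to `K`.
    obtain ⟨a, ha, hsa⟩ : ∃ a ∈ m, |s + u a| ≤ K := by
      rcases le_or_gt s 0 with h | h
      · obtain ⟨a, ha, hpos⟩ : ∃ a ∈ m, 0 ≤ u a := by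
          by_contra hc
          push Not at hc
          have h1 : (m.map u).sum ≤ (m.map fun _ => (-1 : ℤ)).sum :=
            Multiset.sum_map_le_sum_map _ _ fun a ha => by have := hc a ha; omega
          rw [Multiset.map_const', Multiset.sum_replicate, hm] at h1
          simp only [nsmul_eq_mul] at h1
          push_cast at h1
          linarith [Int.natCast_nonneg n]
        have := hu a ha
        rw [abs_le] at *
        exact ⟨a, ha, abs_le.2 (by constructor <;> linarith)⟩
      · obtain ⟨a, ha, hneg⟩ : ∃ a ∈ m, u a ≤ 0 := by
          by_contra hc
          push Not at hc
          have h1 : (0 : ℤ) ≤ (m.map u).sum :=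
            Multiset.sum_nonneg fun x hx => by
              obtain ⟨a, ha, rfl⟩ := Multiset.mem_map.1 hx
              exact (hc a ha).le
          linarith
        have := hu a ha
        rw [abs_le] at *
        exact ⟨a, ha, abs_le.2 (by constructor <;> linarith)⟩
    obtain ⟨m, rfl⟩ := Multiset.exists_cons_of_mem ha
    rw [Multiset.map_cons, Multiset.sum_cons] at h0
    obtain ⟨l, rfl, hl⟩ := ih m (s + u a) (by simpa using hm)
      (fun b hb => hu b (Multiset.mem_cons_of_mem hb)) hsa (by linarith)
    refine ⟨a :: l, rfl, fun p hp => ?_⟩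
    rcases List.prefix_cons_iff.1 hp with rfl | ⟨q, rfl, hq⟩
    · simpa using hs
    · rw [List.map_cons, List.sum_cons, ← add_assoc]
      exact hl q hq

/-- A nonempty family of integers with sum zero has a small nonempty subfamily with sum zero. -/
theorem exists_le_sum_eq_zero (u : ι → ℤ) (K : ℕ) (m : Multiset ι) (hm : m ≠ 0)
    (hu : ∀ a ∈ m, |u a| ≤ K) (h0 : (m.map u).sum = 0) :
    ∃ b ≤ m, b ≠ 0 ∧ b.card ≤ 2 * K + 1 ∧ (b.map u).sum = 0 := by
  classical
  by_cases hc : m.card ≤ 2 * K + 1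
  · exact ⟨m, le_rfl, hm, hc, h0⟩
  push Not at hc
  obtain ⟨l, rfl, hl⟩ := exists_list_abs_partialSum_le u K _ m 0 rfl hu (by simp) (by simpa using h0)
  simp only [zero_add] at hl
  rw [Multiset.coe_card] at hc
  -- The `2 * K + 2` prefixes of lengths up to `2 * K + 1` have sums among `2 * K + 1` integers. Two
  -- prefixes with equal sums enclose a zero-sum segment.
  obtain ⟨i, hi, j, hj, hij, he⟩ := Finset.exists_ne_map_eq_of_card_lt_of_maps_to
    (s := Finset.range (2 * K + 2)) (t := Finset.Icc (-(K : ℤ)) K)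
    (f := fun i => ((l.take i).map u).sum) (by simp; omega) (fun i _ => by
      have := hl _ (List.take_prefix i l)
      rw [abs_le] at this
      exact Finset.mem_coe.2 (Finset.mem_Icc.2 this))
  wlog hlt : i < j generalizing i j
  · exact this j hj i hi hij.symm he.symm (by omega)
  simp only [Finset.mem_range] at hi hj he
  refine ⟨((l.take j).drop i : List ι), ?_, ?_, ?_, ?_⟩
  · exact Multiset.coe_le.2 (((List.drop_sublist _ _).trans (List.take_sublist _ _)).subperm)
  · rw [ne_eq, Multiset.coe_eq_zero, List.drop_eq_nil_iff, List.length_take]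
    omega
  · simp only [Multiset.coe_card, List.length_drop, List.length_take]; omega
  · have h1 : l.take j = l.take i ++ (l.take j).drop i := by
      conv_lhs => rw [← List.take_append_drop i (l.take j), List.take_take, min_eq_left hlt.le]
    rw [Multiset.map_coe, Multiset.sum_coe]
    rw [h1, List.map_append, List.sum_append] at he
    linarith

/-- A family of integers with sum zero splits into small families with sum zero. -/
theorem exists_blocks (u : ι → ℤ) (K : ℕ) (n : ℕ) : ∀ m : Multiset ι, m.card = n →
    (∀ a ∈ m, |u a| ≤ K) → (m.map u).sum = 0 →
    ∃ P : Multiset (Multiset ι), P.sum = m ∧ ∀ b ∈ P, b.card ≤ 2 * K + 1 ∧ (b.map u).sum = 0 := by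
  classical
  induction n using Nat.strong_induction_on with
  | _ n ih =>
    intro m hm hu h0
    rcases eq_or_ne m 0 with rfl | hne
    · exact ⟨0, rfl, by simp⟩
    obtain ⟨b, hb, hb0, hcard, hsum⟩ := exists_le_sum_eq_zero u K m hne hu h0
    obtain ⟨m', rfl⟩ := Multiset.le_iff_exists_add.1 hb
    rw [Multiset.map_add, Multiset.sum_add, hsum, zero_add] at h0
    have hpos := Multiset.card_pos.2 hb0
    rw [Multiset.card_add] at hm
    obtain ⟨P, rfl, hP⟩ := ih m'.card (by omega) m' rfl
      (fun a ha => hu a (Multiset.mem_add.2 (.inr ha))) h0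
    refine ⟨b ::ₘ P, by simp, fun c hc => ?_⟩
    rcases Multiset.mem_cons.1 hc with rfl | hc
    exacts [⟨hcard, hsum⟩, hP c hc]

/-- The bound for the sizes of the parts of a zero-sum family of vectors. -/
def blockBound (M : ℕ) : ℕ → ℕ
  | 0 => 1
  | j + 1 => blockBound M j * (2 * (blockBound M j * M) + 1)

/-- With `Y j = blockBound M j * 2 ^ (n + 1)` the recursion gives `Y (j + 1) ≤ Y j * (Y j + 1)`, and
`X * (X + 1) ≤ X ^ 4` for `X ≥ 2`. So the exponent at most quadruples with every coordinate. -/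
theorem blockBound_le {M n : ℕ} (hM : M ≤ 2 ^ n) (j : ℕ) :
    blockBound M j * 2 ^ (n + 1) ≤ 2 ^ ((n + 1) * 4 ^ j) := by
  induction j with
  | zero => simp [blockBound]
  | succ j ih =>
    set X := 2 ^ ((n + 1) * 4 ^ j)
    have hX : 1 ≤ X := Nat.one_le_two_pow
    have hX2 : 2 ≤ X := by
      calc 2 = 2 ^ 1 := rfl
        _ ≤ X := Nat.pow_le_pow_right (by norm_num) (Nat.mul_pos (by omega) (by positivity))
    have h1 : 2 * (blockBound M j * M) + 1 ≤ X + 1 := by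
      calc 2 * (blockBound M j * M) + 1 ≤ 2 * (blockBound M j * 2 ^ n) + 1 := by gcongr
        _ = blockBound M j * 2 ^ (n + 1) + 1 := by ring
        _ ≤ X + 1 := by omega
    calc blockBound M (j + 1) * 2 ^ (n + 1)
        = (blockBound M j * 2 ^ (n + 1)) * (2 * (blockBound M j * M) + 1) := by
          rw [blockBound]; ring
      _ ≤ X * (X + 1) := Nat.mul_le_mul ih h1
      _ ≤ X * (X * X * X) := by
          apply Nat.mul_le_mul_left
          nlinarith [Nat.mul_le_mul hX2 hX2]
      _ = 2 ^ ((n + 1) * 4 ^ (j + 1)) := by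
          rw [show (n + 1) * 4 ^ (j + 1) = ((n + 1) * 4 ^ j) * 4 by ring, pow_mul]
          ring

/-- Here `n` will be the length of the input, which bounds the dimension and the number of digits of
every entry. -/
theorem blockBound_mul_le {M n d : ℕ} (hM : M ≤ 2 ^ n) (hd : d ≤ n) :
    blockBound M d * M ≤ 2 ^ 8 ^ n := by
  have hn := Nat.lt_two_pow_self (n := n)
  calc blockBound M d * M ≤ blockBound M d * 2 ^ (n + 1) := by
        gcongr
        exact hM.trans (Nat.pow_le_pow_right (by norm_num) (by omega))
    _ ≤ 2 ^ ((n + 1) * 4 ^ d) := blockBound_le hM d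
    _ ≤ 2 ^ (2 ^ n * 4 ^ n) := by
        apply Nat.pow_le_pow_right (by norm_num)
        apply Nat.mul_le_mul (by omega)
        exact Nat.pow_le_pow_right (by norm_num) hd
    _ = 2 ^ 8 ^ n := by rw [← mul_pow]; norm_num

theorem abs_sum_le_card_mul (u : ι → ℤ) (K : ℕ) (m : Multiset ι) (hu : ∀ a ∈ m, |u a| ≤ K) :
    |(m.map u).sum| ≤ m.card * K := by
  induction m using Multiset.induction_on with
  | empty => simp
  | cons a m ih =>
    rw [Multiset.map_cons, Multiset.sum_cons, Multiset.card_cons]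
    have h1 := hu a (Multiset.mem_cons_self _ _)
    have h2 := ih fun b hb => hu b (Multiset.mem_cons_of_mem hb)
    push_cast
    linarith [abs_add_le (u a) (m.map u).sum]

/-- The coordinates are treated one at a time. The blocks that have sum zero in the first `j`
coordinates become the items for the next one, where their sums are at most `K = blockBound M j *
M`; grouping at most `2 * K + 1` of them keeps the earlier sums zero. -/
theorem exists_vector_blocks {d : ℕ} (w : ι → Fin d → ℤ) (M : ℕ) (m : Multiset ι)
    (hw : ∀ a ∈ m, ∀ k, |w a k| ≤ M) (j : ℕ) (h0 : ∀ k : Fin d, k < j → (m.map (w · k)).sum = 0) :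
    ∃ P : Multiset (Multiset ι), P.sum = m ∧ ∀ b ∈ P, b.card ≤ blockBound M j ∧
      ∀ k : Fin d, k < j → (b.map (w · k)).sum = 0 := by
  induction j with
  | zero =>
    refine ⟨m.map fun a => {a}, by simp, fun b hb => ?_⟩
    obtain ⟨a, -, rfl⟩ := Multiset.mem_map.1 hb
    exact ⟨by simp [blockBound], fun k hk => absurd hk (by omega)⟩
  | succ j ih =>
    obtain ⟨P, hPm, hP⟩ := ih fun k hk => h0 k (by omega)
    have hsub : ∀ b ∈ P, ∀ a ∈ b, a ∈ m := fun b hb a ha => by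
      rw [← hPm, ← Multiset.join, Multiset.mem_join]
      exact ⟨b, hb, ha⟩
    by_cases hj : j < d
    · obtain ⟨Q, hQP, hQ⟩ := exists_blocks (fun b : Multiset ι => (b.map (w · ⟨j, hj⟩)).sum)
        (blockBound M j * M) _ P rfl (fun b hb => by
          refine (abs_sum_le_card_mul _ M b fun a ha => hw a (hsub b hb a ha) _).trans ?_
          push_cast
          have := (hP b hb).1
          gcongr) (by
          rw [← h0 ⟨j, hj⟩ (by simp), ← hPm, ← Multiset.join, Multiset.map_join, Multiset.sum_join,
            Multiset.map_map]
          rfl)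
      have hQsub : ∀ q ∈ Q, ∀ b ∈ q, b ∈ P := fun q hq b hb => by
        rw [← hQP, ← Multiset.join, Multiset.mem_join]
        exact ⟨q, hq, hb⟩
      refine ⟨Q.map Multiset.sum, ?_, fun b hb => ?_⟩
      · rw [← hPm, ← hQP]
        exact (Multiset.sum_join (S := Q)).symm
      · obtain ⟨q, hq, rfl⟩ := Multiset.mem_map.1 hb
        constructor
        · have h1 := (hQ q hq).1
          have h2 : Multiset.card q.sum ≤ Multiset.card q * blockBound M j := by
            rw [← Multiset.join, Multiset.card_join]
            have := Multiset.sum_map_le_sum_map Multiset.card (fun _ => blockBound M j)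
              fun b hb => (hP b (hQsub q hq b hb)).1
            simpa using this
          rw [blockBound, mul_comm]
          exact h2.trans (Nat.mul_le_mul_right _ h1)
        · intro k hk
          rw [← Multiset.join, Multiset.map_join, Multiset.sum_join, Multiset.map_map]
          rcases Nat.lt_succ_iff_lt_or_eq.1 hk with h | h
          · refine Multiset.sum_eq_zero fun x hx => ?_
            obtain ⟨b, hb, rfl⟩ := Multiset.mem_map.1 hx
            exact (hP b (hQsub q hq b hb)).2 k h
          · have hk' : k = ⟨j, hj⟩ := Fin.ext h
            rw [hk']
            exact (hQ q hq).2
    · have hd := fun k : Fin d => k.2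
      refine ⟨P, hPm, fun b hb => ⟨((hP b hb).1).trans ?_, fun k hk =>
        (hP b hb).2 k (by have := k.2; omega)⟩⟩
      rw [blockBound]
      exact Nat.le_mul_of_pos_right _ (by omega)

/-- A zero-sum family of vectors can be ordered so that the partial sums are bounded. -/
theorem exists_list_partialSum_le {d : ℕ} (w : ι → Fin d → ℤ) (M : ℕ) (m : Multiset ι)
    (hw : ∀ a ∈ m, ∀ k, |w a k| ≤ M) (h0 : (m.map w).sum = 0) :
    ∃ l : List ι, (l : Multiset ι) = m ∧
      ∀ p, p <+: l → ∀ k, |(p.map w).sum k| ≤ blockBound M d * M := by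
  have happ : ∀ (m : Multiset ι) (k : Fin d), (m.map w).sum k = (m.map (w · k)).sum := fun m k => by
    have := map_multiset_sum (Pi.evalAddMonoidHom (fun _ : Fin d => ℤ) k) (m.map w)
    rw [Multiset.map_map] at this
    exact this
  obtain ⟨P, rfl, hP⟩ := exists_vector_blocks w M m hw d fun k _ => by rw [← happ, h0]; rfl
  clear h0
  induction P using Multiset.induction_on with
  | empty =>
    refine ⟨[], rfl, fun p hp k => ?_⟩
    rw [List.prefix_nil.1 hp]
    simp
    positivity
  | cons b P ih =>
    rw [Multiset.sum_cons] at hw ⊢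
    obtain ⟨l, hl, hlp⟩ := ih (fun b hb => hP b (Multiset.mem_cons_of_mem hb))
      fun a ha => hw a (Multiset.mem_add.2 (.inr ha))
    obtain ⟨hcard, hsum⟩ := hP b (Multiset.mem_cons_self _ _)
    -- Blocks are listed one after another. A prefix consists of complete blocks, which contribute
    -- zero, and of a part of one block, whose size is bounded.
    refine ⟨b.toList ++ l, by rw [← hl, ← Multiset.coe_add, Multiset.coe_toList], fun p hp k => ?_⟩
    rcases List.prefix_or_prefix_of_prefix hp (List.prefix_append b.toList l) with h | ⟨q, rfl⟩
    · have hle : (p : Multiset ι) ≤ b := by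
        rw [← Multiset.coe_toList b]
        exact Multiset.coe_le.2 h.sublist.subperm
      have h1 := abs_sum_le_card_mul (w · k) M p fun a ha =>
        hw a (Multiset.mem_add.2 (.inl (Multiset.mem_of_le hle ha))) k
      rw [← happ, Multiset.map_coe, Multiset.sum_coe] at h1
      refine h1.trans ?_
      have h2 := (Multiset.card_le_card hle).trans hcard
      gcongr
    · have h1 : (b.toList.map w).sum k = 0 := by
        have := hsum k k.2
        rwa [← happ, ← Multiset.coe_toList b, Multiset.map_coe, Multiset.sum_coe] at this
      rw [List.map_append, List.sum_append, Pi.add_apply, h1, zero_add]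
      exact hlp q ((List.prefix_append_right_inj _).1 hp) k

end ZeroSum

/-! ### Placements of sequences of vectors on the rational line -/

namespace DataVector

variable {d : ℕ}

/-- The order automorphism of `ℚ` that is the identity above `c` and scales by `a` below `c`. -/
noncomputable def scaleBelow (c a : ℚ) (ha : 0 < a) : ℚ ≃o ℚ :=
  StrictMono.orderIsoOfSurjective (fun x => if x < c then c + a * (x - c) else x)
    (by
      intro x y hxy
      dsimp only
      split_ifs with h1 h2 h2
      · nlinarith
      · nlinarith [mul_pos ha (sub_pos.2 h1)]
      · linarith
      · exact hxy)
    (by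
      intro y
      by_cases h : y < c
      · refine ⟨c + (y - c) / a, ?_⟩
        have : (y - c) / a < 0 := div_neg_of_neg_of_pos (by linarith) ha
        dsimp only
        rw [if_pos (by linarith)]
        field_simp
        ring
      · exact ⟨y, if_neg h⟩)

theorem scaleBelow_of_lt {c a x : ℚ} (ha : 0 < a) (hx : x < c) :
    scaleBelow c a ha x = c + a * (x - c) := if_pos hx

theorem scaleBelow_of_le {c a x : ℚ} (ha : 0 < a) (hx : c ≤ x) : scaleBelow c a ha x = x :=
  if_neg (not_lt.2 hx)

/-- A finite increasing partial map extends to an order automorphism of `ℚ`. -/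
theorem exists_orderIso_map (a b : List ℚ) (ha : a.Pairwise (· < ·)) (hb : b.Pairwise (· < ·))
    (h : a.length = b.length) : ∃ ρ : ℚ ≃o ℚ, b.map ρ = a := by
  induction a generalizing b with
  | nil => exact ⟨OrderIso.refl ℚ, by simpa using List.length_eq_zero_iff.1 h.symm⟩
  | cons x a ih =>
    obtain ⟨y, b, rfl⟩ := List.exists_cons_of_length_eq_add_one h.symm
    rw [List.pairwise_cons] at ha hb
    obtain ⟨ρ, hρ⟩ := ih b ha.2 hb.2 (by simpa using h)
    have hlt : ∀ z ∈ a, ρ y < z := by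
      rw [← hρ]
      intro z hz
      obtain ⟨t, ht, rfl⟩ := List.mem_map.1 hz
      exact ρ.strictMono (hb.1 t ht)
    -- The points are added from large to small. Below a level `c` that separates `x` and `ρ y` from
    -- the images already fixed, `ρ` can be rescaled so that `y` goes to `x`.
    obtain ⟨c, hc1, hc2, hc3⟩ : ∃ c, x < c ∧ ρ y < c ∧ ∀ z ∈ a, c ≤ z := by
      rcases a with _ | ⟨z, a⟩
      · exact ⟨max x (ρ y) + 1, by linarith [le_max_left x (ρ y)],
          by linarith [le_max_right x (ρ y)], by simp⟩
      · refine ⟨z, ha.1 z (by simp), hlt z (by simp), fun t ht => ?_⟩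
        rcases List.mem_cons.1 ht with rfl | ht
        · exact le_rfl
        · exact ((List.pairwise_cons.1 ha.2).1 t ht).le
    have hpos : 0 < (c - x) / (c - ρ y) := div_pos (by linarith) (by linarith)
    refine ⟨ρ.trans (scaleBelow c _ hpos), ?_⟩
    rw [List.map_cons]
    congr 1
    · rw [OrderIso.trans_apply, scaleBelow_of_lt hpos hc2]
      have : c - ρ y ≠ 0 := by linarith
      field_simp
      ring
    · conv_rhs => rw [← hρ]
      refine List.map_congr_left fun t ht => ?_
      rw [OrderIso.trans_apply, scaleBelow_of_le hpos]
      exact hc3 _ (by rw [← hρ]; exact List.mem_map_of_mem ht)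

/-- The data vector with given values at given data values. -/
noncomputable def place (ts : List ℚ) (ws : List (Fin d → ℤ)) : DataVector d :=
  (List.zipWith Finsupp.single ts ws).sum

@[simp] theorem place_nil (ts : List ℚ) : place ts ([] : List (Fin d → ℤ)) = 0 := by
  simp [place]

@[simp] theorem place_cons (t : ℚ) (ts : List ℚ) (w : Fin d → ℤ) (ws : List (Fin d → ℤ)) :
    place (t :: ts) (w :: ws) = Finsupp.single t w + place ts ws := by
  simp [place]

theorem comp_zero (ρ : ℚ ≃o ℚ) : comp (0 : DataVector d) ρ = 0 := by
  ext1 α; rfl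

theorem comp_place (ρ : ℚ ≃o ℚ) (ts : List ℚ) (ws : List (Fin d → ℤ)) :
    comp (place (ts.map ρ) ws) ρ = place ts ws := by
  induction ts generalizing ws with
  | nil => simp [place, comp_zero]
  | cons t ts ih =>
    cases ws with
    | nil => simp [comp_zero]
    | cons w ws => rw [List.map_cons, place_cons, place_cons, comp_add, comp_single, ih]; simp

/-- The values of a data vector in the order of the data values. -/
noncomputable def values (v : DataVector d) : List (Fin d → ℤ) := (v.support.sort (· ≤ ·)).map v

theorem sum_single_eq (l : List ℚ) (v : DataVector d) :
    place l (l.map v) = (l.map fun α => Finsupp.single α (v α)).sum := by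
  induction l with
  | nil => simp
  | cons a l ih => rw [List.map_cons, place_cons, ih, List.map_cons, List.sum_cons]

theorem place_values (v : DataVector d) : place (v.support.sort (· ≤ ·)) v.values = v := by
  rw [values, sum_single_eq, ← List.sum_toFinset _ (Finset.sort_nodup _ _), Finset.sort_toFinset]
  exact Finsupp.sum_single v

/-- Together with `comp_eq_place` this identifies permuted copies with placements of the values at
increasing data values; only the number of data values matters. -/
theorem exists_comp_eq_place (v : DataVector d) (ts : List ℚ) (hts : ts.Pairwise (· < ·))
    (hl : ts.length = v.values.length) : ∃ ρ : ℚ ≃o ℚ, place ts v.values = v.comp ρ := by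
  obtain ⟨ρ, hρ⟩ := exists_orderIso_map (v.support.sort (· ≤ ·)) ts
    (Finset.sortedLT_sort _).pairwise hts (by rw [hl, values, List.length_map])
  refine ⟨ρ, ?_⟩
  conv_rhs => rw [← place_values v, ← hρ]
  rw [comp_place]

theorem comp_eq_place (v : DataVector d) (ρ : ℚ ≃o ℚ) :
    v.comp ρ = place ((v.support.sort (· ≤ ·)).map ρ.symm) v.values := by
  have h := comp_place ρ ((v.support.sort (· ≤ ·)).map ρ.symm) v.values
  have e : ((v.support.sort (· ≤ ·)).map ρ.symm).map ρ = v.support.sort (· ≤ ·) := by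
    rw [List.map_map]
    exact (List.map_congr_left fun x _ => ρ.apply_symm_apply x).trans (List.map_id _)
  rwa [e, place_values] at h

end DataVector

/-! ### From data vectors to vector addition systems -/

/-- The vectors of the track that copies of data vectors follow: a cell is a vector that is placed
at a data value, or the end of a data vector. -/
abbrev Track (d : ℕ) : Type := List (Option (Fin d → ℤ))

namespace Track

variable {d : ℕ}

/-- `Fits L S v`: the vectors of `L` up to the first end can be placed at data values from `S`, in
the order of `S`, so that `v` arises. -/
inductive Fits : Track d → List ℚ → DataVector d → Prop
  | halt (L S) : Fits (none :: L) S 0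
  | skip {L S v} (τ : ℚ) : Fits L S v → Fits L (τ :: S) v
  | take {L S v} (w : Fin d → ℤ) (τ : ℚ) : Fits L S v →
      Fits (some w :: L) (τ :: S) (Finsupp.single τ w + v)

/-- The data values that are taken, and not skipped, form the sublist; cells behind the first end
play no role. -/
theorem Fits.exists_sublist {S : List ℚ} {v : DataVector d} (ws : List (Fin d → ℤ)) (L : Track d)
    {L' : Track d} (h : Fits L' S v) (hL : L' = ws.map some ++ none :: L) :
    ∃ ts, ts.Sublist S ∧ ts.length = ws.length ∧ v = place ts ws := by
  induction h generalizing ws with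
  | halt L' S =>
    cases ws with
    | nil => exact ⟨[], List.nil_sublist _, rfl, by simp⟩
    | cons w ws => simp at hL
  | skip τ _ ih =>
    obtain ⟨ts, h1, h2, h3⟩ := ih ws hL
    exact ⟨ts, h1.cons _, h2, h3⟩
  | take w τ _ ih =>
    cases ws with
    | nil => simp at hL
    | cons w' ws =>
      simp only [List.map_cons, List.cons_append, List.cons.injEq, Option.some.injEq] at hL
      obtain ⟨rfl, hL⟩ := hL
      obtain ⟨ts, h1, h2, rfl⟩ := ih ws hL
      exact ⟨τ :: ts, h1.cons_cons _, by simp [h2], by simp⟩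

theorem fits_place {ts S : List ℚ} (h : ts.Sublist S) (ws : List (Fin d → ℤ)) (L : Track d)
    (hl : ts.length = ws.length) : Fits (ws.map some ++ none :: L) S (place ts ws) := by
  induction h generalizing ws with
  | slnil =>
    rw [List.length_eq_zero_iff.1 hl.symm, place_nil]
    exact .halt _ _
  | cons a _ ih => exact .skip a (ih ws hl)
  | cons_cons a _ ih =>
    obtain ⟨w, ws, rfl⟩ := List.exists_cons_of_length_eq_add_one hl.symm
    rw [place_cons]
    exact .take w a (ih ws (by simpa using hl))

/-- The part of the track that belongs to a data vector. -/
noncomputable def cells (v : DataVector d) : Track d := v.values.map some ++ [none]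

/-- The increasing data values of `v.comp ρ` all lie in the increasing list `S`, so they form a
sublist of it. -/
theorem fits_cells {S : List ℚ} (v : DataVector d) (ρ : ℚ ≃o ℚ) (L : Track d)
    (hS : S.Pairwise (· < ·)) (h : ∀ α, v.comp ρ α ≠ 0 → α ∈ S) :
    Fits (cells v ++ L) S (v.comp ρ) := by
  rw [comp_eq_place, cells, List.append_assoc]
  refine fits_place ?_ _ _ (by simp [values])
  have hp : ((v.support.sort (· ≤ ·)).map ρ.symm).Pairwise (· < ·) :=
    (Finset.sortedLT_sort _).pairwise.map _ fun a b hab => ρ.symm.strictMono hab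
  refine List.sublist_of_subperm_of_pairwise (r := (· < ·)) ?_ hp hS
  have hn : List.Nodup ((v.support.sort (· ≤ ·)).map ρ.symm) := hp.imp fun h => h.ne
  refine List.subperm_of_subset hn fun x hx => ?_
  obtain ⟨α, hα, rfl⟩ := List.mem_map.1 hx
  refine h _ ?_
  rw [comp_apply, OrderIso.apply_symm_apply]
  simpa using hα

theorem Fits.exists_comp {S : List ℚ} {v u : DataVector d} {L : Track d}
    (h : Fits (cells u ++ L) S v) (hS : S.Pairwise (· < ·)) : ∃ ρ : ℚ ≃o ℚ, v = u.comp ρ := by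
  rw [cells, List.append_assoc] at h
  obtain ⟨ts, h1, h2, rfl⟩ := h.exists_sublist _ _ rfl
  exact exists_comp_eq_place u ts (hS.sublist h1) h2

theorem Fits.apply_eq_zero {L : Track d} {S : List ℚ} {v : DataVector d} (h : Fits L S v) {α : ℚ}
    (hα : α ∉ S) : v α = 0 := by
  induction h with
  | halt => rfl
  | skip τ _ ih => exact ih fun h => hα (List.mem_cons_of_mem _ h)
  | take w τ _ ih =>
    rw [Finsupp.add_apply, ih fun h => hα (List.mem_cons_of_mem _ h), Finsupp.single_apply,
      if_neg (fun h : τ = α => hα (h ▸ List.mem_cons_self)), add_zero]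

/-- A copy behind the last end of the track can never be completed. -/
theorem Fits.ne_nil {L : Track d} {S : List ℚ} {v : DataVector d} (h : Fits L S v) : L ≠ [] := by
  induction h with
  | skip _ _ ih => exact ih
  | _ => simp

/-- The track of a list of data vectors. -/
noncomputable def ofList (l : List (DataVector d)) : Track d := l.flatMap cells

theorem mem_ofList {l : List (DataVector d)} {w : Fin d → ℤ} (h : some w ∈ ofList l) :
    ∃ v ∈ l, ∃ α, v α = w ∧ w ≠ 0 := by
  obtain ⟨v, hv, h⟩ := List.mem_flatMap.1 h
  refine ⟨v, hv, ?_⟩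
  simp only [cells, values, List.map_map, List.mem_append, List.mem_map, Finset.mem_sort,
    Function.comp_apply, Option.some.injEq, List.mem_singleton, reduceCtorEq, or_false] at h
  obtain ⟨α, hα, rfl⟩ := h
  exact ⟨α, rfl, by simpa using hα⟩

theorem eq_or_suffix {α : Type} (ws : List α) (L R : List (Option α))
    (h : none :: L <:+ ws.map some ++ none :: R) : L = R ∨ none :: L <:+ R := by
  induction ws with
  | nil =>
    rcases List.suffix_cons_iff.1 h with h | h
    · exact .inl (List.cons.inj h).2
    · exact .inr h
  | cons w ws ih =>
    rcases List.suffix_cons_iff.1 h with h | h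
    · simp at h
    · exact ih h

/-- What follows an end on the track is the beginning of a data vector. -/
theorem exists_cells_of_suffix (v : DataVector d) (l : List (DataVector d)) {L : Track d}
    (h : none :: L <:+ ofList (v :: l)) (hL : L ≠ []) : ∃ u ∈ l, ∃ L', L = cells u ++ L' := by
  induction l generalizing v with
  | nil =>
    exfalso
    rw [ofList, List.flatMap_cons, cells, List.append_assoc] at h
    rcases eq_or_suffix _ _ _ h with h | h
    · exact hL h
    · simp at h
  | cons u l ih =>
    rw [ofList, List.flatMap_cons, cells, List.append_assoc] at h
    rcases eq_or_suffix _ _ _ h with h | h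
    · exact ⟨u, List.mem_cons_self, ofList l, h⟩
    · obtain ⟨u', hu', h'⟩ := ih u h
      exact ⟨u', List.mem_cons_of_mem _ hu', h'⟩

/-- Every data vector but the first begins on the track after an end. -/
theorem exists_drop_eq (v : DataVector d) (l : List (DataVector d)) {u : DataVector d}
    (hu : u ∈ l) : ∃ t L', (ofList (v :: l))[t]? = some none ∧
      (ofList (v :: l)).drop (t + 1) = cells u ++ L' := by
  obtain ⟨l1, l2, rfl⟩ := List.append_of_mem hu
  have e : ∃ p, ofList (v :: l1) = p ++ [none] := by
    induction l1 generalizing v with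
    | nil => exact ⟨v.values.map some, by simp [ofList, cells]⟩
    | cons x l1 ih =>
      obtain ⟨p, hp⟩ := ih x (by simp)
      exact ⟨cells v ++ p, by rw [ofList, List.flatMap_cons, ← ofList, hp, List.append_assoc]⟩
  obtain ⟨p, hp⟩ := e
  have h2 : ofList (v :: (l1 ++ u :: l2)) = p ++ none :: (cells u ++ ofList l2) := by
    have : ofList (v :: (l1 ++ u :: l2)) = ofList (v :: l1) ++ (cells u ++ ofList l2) := by
      simp [ofList]
    rw [this, hp]
    simp
  refine ⟨p.length, ofList l2, ?_, ?_⟩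
  · rw [h2]; simp
  · rw [h2, List.drop_append]; simp

end Track

/-! ### The vector addition system that sweeps over the data values -/

namespace Track

variable {d : ℕ}

/-- A vector with a part for the control states, a pair of parts for a vector of bounded counters
and their complements, and a pair of parts for the positions on a track of length `T`. -/
def vec {α : Type} {T : ℕ} (q : Fin 3 → α) (s s' : Fin d → α) (c c' : Fin (T + 1) → α) :
    Fin (3 + d + d + (T + 1) + (T + 1)) → α :=
  Fin.append (Fin.append (Fin.append (Fin.append q s) s') c) c'

/-- The vector with the entry `z` at index `t` and zeros elsewhere. -/
def unit {α : Type} [Zero α] {T : ℕ} (t : ℕ) (z : α) : Fin (T + 1) → α :=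
  fun i => if (i : ℕ) = t then z else 0

/-- The transitions for cell number `t`. The first one allows a copy that has been moved in the
previous round to move again. -/
def cellTransitions (T t : ℕ) :
    Option (Fin d → ℤ) → List (Fin (3 + d + d + (T + 1) + (T + 1)) → ℤ)
  -- The control unit moves from place `0` to place `1`, from which the first vector of
  -- `transitions` returns it. Taking it checks that no round is open.
  | some w => [vec ![-1, 1, 0] 0 0 (unit t 1) (unit t (-1)),
      -- No control is needed: outside of rounds both bounded counters are zero, and a nonzero `w`
      -- would make one of them negative. A moved copy is counted in the second group of positions,
      -- so it moves at most once per round.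
      vec 0 w (-w) (unit t (-1)) (unit (t + 1) 1)]
  -- At an end a copy may disappear, and behind an end, where the next data vector begins, a copy
  -- may be created at any time.
  | none => [vec ![-1, 1, 0] 0 0 (unit t 1) (unit t (-1)),
      vec 0 0 0 (unit t (-1)) 0, vec 0 0 0 (unit (t + 1) 1) 0]

/-- The transitions for a track. The second and the third one begin and end a round. -/
def transitions (L : Track d) (B : ℕ) :
    List (Fin (3 + d + d + (L.length + 1) + (L.length + 1)) → ℤ) :=
  [vec ![1, -1, 0] 0 0 0 0,
    -- In a round the two counters have sum `2 * B`. So `B` can be taken from both at the end only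
    -- if both equal `B`, that is, if the vectors passed in the round have sum zero.
    vec ![-1, 0, 1] (fun _ => (B : ℤ)) (fun _ => (B : ℤ)) 0 0,
    vec ![1, 0, -1] (fun _ => -(B : ℤ)) (fun _ => -(B : ℤ)) 0 0] ++
  L.zipIdx.flatMap fun x => cellTransitions L.length x.2 x.1

/-- The vector addition system for a track. -/
def toVAS (L : Track d) (B : ℕ) : VAS where
  dim := 3 + d + d + (L.length + 1) + (L.length + 1)
  transitions := transitions L B
  -- There is one copy of the first data vector. Position `0` is behind no end, so no further copy
  -- can be created there.
  initial := vec ![1, 0, 0] 0 0 (unit 0 1) 0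
  final := vec ![1, 0, 0] 0 0 0 0

/-- One transition between configurations. -/
def Moves {n : ℕ} (A : List (Fin n → ℤ)) (c c' : Fin n → ℕ) : Prop :=
  ∃ a ∈ A, ∀ i, (c' i : ℤ) = (c i : ℤ) + a i

theorem reachable_toVAS_iff (L : Track d) (B : ℕ) : (toVAS L B).Reachable ↔
    Relation.ReflTransGen (Moves (transitions L B)) (vec ![1, 0, 0] 0 0 (unit 0 1) 0)
      (vec ![1, 0, 0] 0 0 0 0) :=
  Iff.rfl

theorem forall_fin_add {m n : ℕ} {p : Fin (m + n) → Prop} :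
    (∀ i, p i) ↔ (∀ i, p (Fin.castAdd n i)) ∧ ∀ i, p (Fin.natAdd m i) :=
  ⟨fun h => ⟨fun _ => h _, fun _ => h _⟩, fun h => Fin.addCases h.1 h.2⟩

theorem vec_step_iff {T : ℕ} {q q₂ : Fin 3 → ℕ} {s s' s₂ s₂' : Fin d → ℕ}
    {c c' c₂ c₂' : Fin (T + 1) → ℕ} {qa : Fin 3 → ℤ} {sa sa' : Fin d → ℤ}
    {ca ca' : Fin (T + 1) → ℤ} :
    (∀ i, ((vec q₂ s₂ s₂' c₂ c₂' i : ℕ) : ℤ) =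
      ((vec q s s' c c' i : ℕ) : ℤ) + vec qa sa sa' ca ca' i) ↔
      (∀ i, (q₂ i : ℤ) = q i + qa i) ∧ (∀ i, (s₂ i : ℤ) = s i + sa i) ∧
      (∀ i, (s₂' i : ℤ) = s' i + sa' i) ∧ (∀ i, (c₂ i : ℤ) = c i + ca i) ∧
      ∀ i, (c₂' i : ℤ) = c' i + ca' i := by
  simp only [forall_fin_add (m := 3 + d + d + (T + 1)), forall_fin_add (m := 3 + d + d),
    forall_fin_add (m := 3 + d), forall_fin_add (m := 3) (n := d), vec, Fin.append_left,
    Fin.append_right, and_assoc]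

theorem exists_vec {α : Type} {T : ℕ} (x : Fin (3 + d + d + (T + 1) + (T + 1)) → α) :
    ∃ q s s' c c', x = vec (d := d) q s s' c c' := by
  refine ⟨fun i => x (.castAdd _ (.castAdd _ (.castAdd _ (.castAdd _ i)))),
    fun i => x (.castAdd _ (.castAdd _ (.castAdd _ (.natAdd _ i)))),
    fun i => x (.castAdd _ (.castAdd _ (.natAdd _ i))), fun i => x (.castAdd _ (.natAdd _ i)),
    fun i => x (.natAdd _ i), ?_⟩
  funext i
  revert i
  simp only [forall_fin_add (m := 3 + d + d + (T + 1)), forall_fin_add (m := 3 + d + d),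
    forall_fin_add (m := 3 + d), forall_fin_add (m := 3) (n := d), vec, Fin.append_left,
    Fin.append_right, implies_true, and_self]

theorem mem_transitions {L : Track d} {B : ℕ}
    {a : Fin (3 + d + d + (L.length + 1) + (L.length + 1)) → ℤ} :
    a ∈ transitions L B ↔ a = vec ![1, -1, 0] 0 0 0 0 ∨
      a = vec ![-1, 0, 1] (fun _ => (B : ℤ)) (fun _ => (B : ℤ)) 0 0 ∨
      a = vec ![1, 0, -1] (fun _ => -(B : ℤ)) (fun _ => -(B : ℤ)) 0 0 ∨
      ∃ t o, L[t]? = some o ∧ a ∈ cellTransitions L.length t o := by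
  simp only [transitions, List.mem_append, List.mem_cons, List.not_mem_nil, or_false,
    List.mem_flatMap, Prod.exists, List.mem_zipIdx_iff_getElem?, or_assoc]
  refine or_congr_right (or_congr_right (or_congr_right ?_))
  exact ⟨fun ⟨o, t, h⟩ => ⟨t, o, h⟩, fun ⟨t, o, h⟩ => ⟨o, t, h⟩⟩

/-! ### Soundness -/

/-- The data vectors that are sums of placements of the tracks in `m`. -/
def FitsSum (S : List ℚ) (m : Multiset (Track d)) (u : DataVector d) : Prop :=
  ∃ l : Multiset (DataVector d), Multiset.Rel (fun L v => Fits L S v) m l ∧ l.sum = u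

theorem fitsSum_zero (S : List ℚ) : FitsSum S (0 : Multiset (Track d)) 0 :=
  ⟨0, .zero, rfl⟩

theorem fitsSum_cons {S : List ℚ} {L : Track d} {m : Multiset (Track d)} {u : DataVector d} :
    FitsSum S (L ::ₘ m) u ↔ ∃ v u', Fits L S v ∧ FitsSum S m u' ∧ u = v + u' := by
  constructor
  · rintro ⟨l, h, rfl⟩
    obtain ⟨v, l', h1, h2, rfl⟩ := Multiset.rel_cons_left.1 h
    exact ⟨v, l'.sum, h1, ⟨l', h2, rfl⟩, Multiset.sum_cons _ _⟩
  · rintro ⟨v, _, h1, ⟨l, h2, rfl⟩, rfl⟩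
    exact ⟨v ::ₘ l, .cons h1 h2, Multiset.sum_cons _ _⟩

theorem fitsSum_add {S : List ℚ} {m m' : Multiset (Track d)} {u : DataVector d} :
    FitsSum S (m + m') u ↔ ∃ v v', FitsSum S m v ∧ FitsSum S m' v' ∧ u = v + v' := by
  constructor
  · rintro ⟨l, h, rfl⟩
    obtain ⟨l1, l2, h1, h2, rfl⟩ := Multiset.rel_add_left.1 h
    exact ⟨l1.sum, l2.sum, ⟨l1, h1, rfl⟩, ⟨l2, h2, rfl⟩, Multiset.sum_add _ _⟩
  · rintro ⟨_, _, ⟨l1, h1, rfl⟩, ⟨l2, h2, rfl⟩, rfl⟩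
    exact ⟨l1 + l2, h1.add h2, Multiset.sum_add _ _⟩

theorem FitsSum.skip {S : List ℚ} {m : Multiset (Track d)} {u : DataVector d} (h : FitsSum S m u)
    (τ : ℚ) : FitsSum (τ :: S) m u :=
  let ⟨l, h, hl⟩ := h
  ⟨l, h.mono fun _ _ _ _ h => h.skip τ, hl⟩

/-- The tracks that the copies at the given positions still have to follow. -/
def rest (L : Track d) (c : Fin (L.length + 1) → ℕ) : Multiset (Track d) :=
  ∑ i, c i • ({L.drop i} : Multiset (Track d))

theorem rest_zero (L : Track d) : rest L 0 = 0 := by simp [rest]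

theorem rest_unit (L : Track d) {c c₂ : Fin (L.length + 1) → ℕ} {t : ℕ} (ht : t ≤ L.length)
    (h : ∀ i, (c₂ i : ℤ) = c i + unit t 1 i) : rest L c₂ = L.drop t ::ₘ rest L c := by
  have e : ∀ i, c₂ i = c i + if i = (⟨t, by omega⟩ : Fin (L.length + 1)) then 1 else 0 := by
    intro i
    have h1 := h i
    simp only [unit] at h1
    by_cases hi : (i : ℕ) = t
    · rw [if_pos hi] at h1
      rw [if_pos (Fin.ext hi)]; omega
    · rw [if_neg hi] at h1
      rw [if_neg fun hc => hi (by rw [hc])]; omega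
  simp only [rest, e, add_smul, Finset.sum_add_distrib, ite_smul, zero_smul, one_smul,
    Finset.sum_ite_eq', Finset.mem_univ, if_true]
  rw [add_comm, Multiset.singleton_add]

theorem rest_unit' (L : Track d) {c c₂ : Fin (L.length + 1) → ℕ} {t : ℕ} (ht : t ≤ L.length)
    (h : ∀ i, (c₂ i : ℤ) = c i + unit t (-1) i) : rest L c = L.drop t ::ₘ rest L c₂ := by
  refine rest_unit L ht fun i => ?_
  have := h i
  simp only [unit] at this ⊢
  split_ifs at this ⊢ <;> omega

theorem eq_of_add_zero {n : ℕ} {c c₂ : Fin n → ℕ} (h : ∀ i, (c₂ i : ℤ) = c i + (0 : Fin n → ℤ) i) :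
    c₂ = c := by
  funext i
  simpa using h i

/-- Outside of rounds the remaining parts of the copies can be placed with sum zero. -/
def Closed (L : Track d) (X : Set (DataVector d)) (q : Fin 3 → ℕ) (s s' : Fin d → ℕ)
    (c c' : Fin (L.length + 1) → ℕ) : Prop :=
  q 0 + q 1 = 1 ∧ q 2 = 0 ∧ s = 0 ∧ s' = 0 ∧ ∃ S u z, S.Pairwise (· < ·) ∧
    FitsSum S (rest L c + rest L c') u ∧ IsPermSum z X ∧ u + z = 0

/-- In a round, at the data value `τ`, the remaining parts of the copies can be placed such that the
sum completes the value of the bounded counters. -/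
def Open (L : Track d) (B : ℕ) (X : Set (DataVector d)) (q : Fin 3 → ℕ) (s s' : Fin d → ℕ)
    (c c' : Fin (L.length + 1) → ℕ) : Prop :=
  q 0 = 0 ∧ q 1 = 0 ∧ q 2 = 1 ∧ (∀ k, s k + s' k = 2 * B) ∧ ∃ τ S u u' z,
    (τ :: S).Pairwise (· < ·) ∧ FitsSum (τ :: S) (rest L c) u ∧ FitsSum S (rest L c') u' ∧
    IsPermSum z X ∧ u + u' + z = Finsupp.single τ fun k => (B : ℤ) - s k

theorem exists_lt_forall (S : List ℚ) (hS : S.Pairwise (· < ·)) :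
    ∃ τ : ℚ, (τ :: S).Pairwise (· < ·) := by
  rcases S with _ | ⟨a, S⟩
  · exact ⟨0, List.pairwise_singleton _ _⟩
  · refine ⟨a - 1, List.pairwise_cons.2 ⟨fun b hb => ?_, hS⟩⟩
    rcases List.mem_cons.1 hb with rfl | hb
    · linarith
    · linarith [(List.pairwise_cons.1 hS).1 b hb]

theorem drop_eq_cons {L : Track d} {t : ℕ} {o : Option (Fin d → ℤ)} (h : L[t]? = some o) :
    t < L.length ∧ L.drop t = o :: L.drop (t + 1) := by
  obtain ⟨h1, h2⟩ := List.getElem?_eq_some_iff.1 h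
  exact ⟨h1, by rw [List.drop_eq_getElem_cons h1, h2]⟩

section Soundness

variable {L : Track d} {B : ℕ} {X : Set (DataVector d)} {q q₂ : Fin 3 → ℕ} {s s' s₂ s₂' : Fin d → ℕ}
  {c c' c₂ c₂' : Fin (L.length + 1) → ℕ}

/-- The run is read backward: the invariant passes from the configuration after a transition to the
one before it, and data values are put in front of `S` from large to small. -/
theorem closed_or_open_of_moves (hne : ∀ w, some w ∈ L → w ≠ 0)
    (hrow : ∀ M S v, none :: M <:+ L → S.Pairwise (· < ·) → Fits M S v → v ∈ perm X)
    (h : Moves (transitions L B) (vec q s s' c c') (vec q₂ s₂ s₂' c₂ c₂'))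
    (hP : Closed L X q₂ s₂ s₂' c₂ c₂' ∨ Open L B X q₂ s₂ s₂' c₂ c₂') :
    Closed L X q s s' c c' ∨ Open L B X q s s' c c' := by
  obtain ⟨a, ha, h⟩ := h
  rcases mem_transitions.1 ha with rfl | rfl | rfl | ⟨t, o, ho, ha⟩
  · rw [vec_step_iff] at h
    obtain ⟨hq, hs, hs', hc, hc'⟩ := h
    obtain rfl := eq_of_add_zero hs
    obtain rfl := eq_of_add_zero hs'
    obtain rfl := eq_of_add_zero hc
    obtain rfl := eq_of_add_zero hc'
    simp only [Fin.forall_fin_succ, Matrix.cons_val_zero, Matrix.cons_val_succ] at hq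
    simp at hq
    rcases hP with ⟨h1, h2, h3⟩ | ⟨h1, h2, h3, h4⟩
    · exact .inl ⟨by omega, by omega, h3⟩
    · omega
  · rw [vec_step_iff] at h
    obtain ⟨hq, hs, hs', hc, hc'⟩ := h
    obtain rfl := eq_of_add_zero hc
    obtain rfl := eq_of_add_zero hc'
    simp only [Fin.forall_fin_succ, Matrix.cons_val_zero, Matrix.cons_val_succ] at hq
    simp at hq
    rcases hP with ⟨h1, h2, h3⟩ | ⟨h1, h2, h3, h4, τ, S, u, u', z, hS, hu, hu', hz, he⟩
    · omega
    -- Just after the beginning of the round both counters are at least `B` and have sum `2 * B`; so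
    -- both equal `B`, and the required sum at `τ` is zero. Copies still counted as moved skip `τ`.
    · refine .inl ⟨by omega, by omega, ?_, ?_, τ :: S, u + u', z, hS,
        fitsSum_add.2 ⟨u, u', hu, hu'.skip τ, rfl⟩, hz, ?_⟩
      · funext k; have := h4 k; have := hs k; have := hs' k; simp; omega
      · funext k; have := h4 k; have := hs k; have := hs' k; simp; omega
      · rw [he, Finsupp.single_eq_zero]
        funext k; have := h4 k; have := hs k; have := hs' k; simp; omega
  · rw [vec_step_iff] at h
    obtain ⟨hq, hs, hs', hc, hc'⟩ := h
    obtain rfl := eq_of_add_zero hc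
    obtain rfl := eq_of_add_zero hc'
    simp only [Fin.forall_fin_succ, Matrix.cons_val_zero, Matrix.cons_val_succ] at hq
    simp at hq
    rcases hP with ⟨h1, h2, rfl, rfl, S, u, z, hS, hu, hz, he⟩ | ⟨h1, h2, h3⟩
    -- Read backward, the end of a round introduces its data value, which lies below all later ones
    -- and which no remaining placement uses yet.
    · obtain ⟨τ, hτ⟩ := exists_lt_forall S hS
      obtain ⟨v, v', hv, hv', rfl⟩ := fitsSum_add.1 hu
      have hsB : ∀ k, s k = B := fun k => by have := hs k; simp at this; omega
      refine .inr ⟨by omega, by omega, by omega, ?_, τ, S, v, v', z, hτ, hv.skip τ, hv', hz, ?_⟩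
      · intro k; have := hs k; have := hs' k; simp at *; omega
      · rw [he]; simp only [hsB, sub_self]; exact (Finsupp.single_zero τ).symm
    · omega
  · obtain ⟨ht, hdrop⟩ := drop_eq_cons ho
    have hflush : ∀ h : ∀ i, ((vec q₂ s₂ s₂' c₂ c₂' i : ℕ) : ℤ) = ((vec q s s' c c' i : ℕ) : ℤ) +
        vec ![-1, 1, 0] 0 0 (unit t 1) (unit t (-1)) i,
        Closed L X q s s' c c' ∨ Open L B X q s s' c c' := by
      intro h
      rw [vec_step_iff] at h
      obtain ⟨hq, hs, hs', hc, hc'⟩ := h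
      obtain rfl := eq_of_add_zero hs
      obtain rfl := eq_of_add_zero hs'
      simp only [Fin.forall_fin_succ, Matrix.cons_val_zero, Matrix.cons_val_succ] at hq
      simp at hq
      rcases hP with ⟨h1, h2, h3, h4, S, u, z, hS, hu, hz, he⟩ | ⟨h1, h2, h3, h4⟩
      · refine .inl ⟨by omega, by omega, h3, h4, S, u, z, hS, ?_, hz, he⟩
        rw [rest_unit' L ht.le hc', Multiset.add_cons]
        rwa [rest_unit L ht.le hc, Multiset.cons_add] at hu
      · omega
    rcases o with _ | w
    · simp only [cellTransitions, List.mem_cons, List.not_mem_nil, or_false] at ha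
      rcases ha with rfl | rfl | rfl
      · exact hflush h
      · rw [vec_step_iff] at h
        obtain ⟨hq, hs, hs', hc, hc'⟩ := h
        obtain rfl := eq_of_add_zero hq
        obtain rfl := eq_of_add_zero hs
        obtain rfl := eq_of_add_zero hs'
        obtain rfl := eq_of_add_zero hc'
        have hr := rest_unit' L ht.le hc
        rw [hdrop] at hr
        rcases hP with ⟨h1, h2, h3, h4, S, u, z, hS, hu, hz, he⟩ |
          ⟨h1, h2, h3, h4, τ, S, u, u', z, hS, hu, hu', hz, he⟩
        · refine .inl ⟨h1, h2, h3, h4, S, u, z, hS, ?_, hz, he⟩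
          rw [hr, Multiset.cons_add]
          exact fitsSum_cons.2 ⟨0, u, .halt _ _, hu, (zero_add u).symm⟩
        · refine .inr ⟨h1, h2, h3, h4, τ, S, u, u', z, hS, ?_, hu', hz, he⟩
          rw [hr]
          exact fitsSum_cons.2 ⟨0, u, .halt _ _, hu, (zero_add u).symm⟩
      · rw [vec_step_iff] at h
        obtain ⟨hq, hs, hs', hc, hc'⟩ := h
        obtain rfl := eq_of_add_zero hq
        obtain rfl := eq_of_add_zero hs
        obtain rfl := eq_of_add_zero hs'
        obtain rfl := eq_of_add_zero hc'
        have hr := rest_unit L ht hc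
        have hsuf : none :: L.drop (t + 1) <:+ L := hdrop ▸ List.drop_suffix t L
        rcases hP with ⟨h1, h2, h3, h4, S, u, z, hS, hu, hz, he⟩ |
          ⟨h1, h2, h3, h4, τ, S, u, u', z, hS, hu, hu', hz, he⟩
        -- Before its creation the copy is absent: its placement, a permuted data vector, is shifted
        -- to the sum `z`.
        · rw [hr, Multiset.cons_add] at hu
          obtain ⟨v, u₂, hv, hu₂, rfl⟩ := fitsSum_cons.1 hu
          refine .inl ⟨h1, h2, h3, h4, S, u₂, v + z, hS, hu₂,
            (IsPermSum.of_mem (hrow _ _ _ hsuf hS hv)).add hz, ?_⟩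
          rw [← he]; abel
        · rw [hr] at hu
          obtain ⟨v, u₂, hv, hu₂, rfl⟩ := fitsSum_cons.1 hu
          refine .inr ⟨h1, h2, h3, h4, τ, S, u₂, u', v + z, hS, hu₂, hu',
            (IsPermSum.of_mem (hrow _ _ _ hsuf hS hv)).add hz, ?_⟩
          rw [← he]; abel
    · simp only [cellTransitions, List.mem_cons, List.not_mem_nil, or_false] at ha
      rcases ha with rfl | rfl
      · exact hflush h
      · rw [vec_step_iff] at h
        obtain ⟨hq, hs, hs', hc, hc'⟩ := h
        obtain rfl := eq_of_add_zero hq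
        simp only [Pi.neg_apply] at hs'
        rcases hP with ⟨h1, h2, rfl, rfl, -⟩ |
          ⟨h1, h2, h3, h4, τ, S, u, u', z, hS, hu, hu', hz, he⟩
        -- Both counters vanish after the move, so they were `-w` and `w` before it; as both are
        -- nonnegative, `w` would be zero.
        · refine absurd ?_ (hne w (List.mem_of_getElem? ho))
          funext k
          have := hs k
          have := hs' k
          simp at *
          omega
        · have hr := rest_unit' L ht.le hc
          rw [rest_unit L ht hc'] at hu'
          obtain ⟨v, u₂, hv, hu₂, rfl⟩ := fitsSum_cons.1 hu'
          -- The copy takes `w` at `τ` and continues on `S`; the additional `w` matches the change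
          -- of the bounded counter.
          refine .inr ⟨h1, h2, h3, fun k => ?_, τ, S, (Finsupp.single τ w + v) + u, u₂, z, hS, ?_,
            hu₂, hz, ?_⟩
          · have := hs k; have := hs' k; have := h4 k; omega
          · rw [hr, hdrop]
            exact fitsSum_cons.2 ⟨_, u, .take w τ hv, hu, rfl⟩
          · have e : (Finsupp.single τ fun k => (B : ℤ) - s k : DataVector d) =
                Finsupp.single τ w + Finsupp.single τ fun k => (B : ℤ) - s₂ k := by
              rw [← Finsupp.single_add]
              congr 1
              funext k
              have := hs k
              simp only [Pi.add_apply]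
              omega
            rw [e, ← he]
            abel

/-- A run gives a placement of the whole track. -/
theorem exists_fits_of_reachable (hne : ∀ w, some w ∈ L → w ≠ 0)
    (hrow : ∀ M S v, none :: M <:+ L → S.Pairwise (· < ·) → Fits M S v → v ∈ perm X)
    (h : (toVAS L B).Reachable) :
    ∃ S u z, S.Pairwise (· < ·) ∧ Fits L S u ∧ IsPermSum z X ∧ u + z = 0 := by
  rw [reachable_toVAS_iff] at h
  have key : ∃ q s s' c c', (vec ![1, 0, 0] 0 0 (unit 0 1) 0 :
      Fin (3 + d + d + (L.length + 1) + (L.length + 1)) → ℕ) = vec q s s' c c' ∧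
      (Closed L X q s s' c c' ∨ Open L B X q s s' c c') := by
    refine Relation.ReflTransGen.head_induction_on h (motive := fun x _ => ∃ q s s' c c',
      x = vec q s s' c c' ∧ (Closed L X q s s' c c' ∨ Open L B X q s s' c c')) ?_ ?_
    · refine ⟨_, _, _, _, _, rfl, .inl ⟨rfl, rfl, rfl, rfl, [], 0, 0, List.Pairwise.nil, ?_, .zero,
        add_zero 0⟩⟩
      rw [rest_zero, add_zero]
      exact fitsSum_zero _
    · rintro x y hxy - ⟨q₂, s₂, s₂', c₂, c₂', rfl, hP⟩
      obtain ⟨q, s, s', c, c', rfl⟩ := exists_vec x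
      exact ⟨q, s, s', c, c', rfl, closed_or_open_of_moves hne hrow hxy hP⟩
  obtain ⟨q, s, s', c, c', he, hP⟩ := key
  -- The equality is written as a step by the zero vector so that `vec_step_iff` compares the
  -- components.
  have he' : ∀ i, ((vec q s s' c c' i : ℕ) : ℤ) = ((vec ![1, 0, 0] 0 0 (unit 0 1) 0 i : ℕ) : ℤ) +
      (vec 0 0 0 0 0 : Fin (3 + d + d + (L.length + 1) + (L.length + 1)) → ℤ) i := by
    intro i
    rw [← he]
    simp [vec, Fin.append, Fin.addCases]
  rw [vec_step_iff] at he'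
  obtain ⟨hq, hs, hs', hc, hc'⟩ := he'
  obtain rfl := eq_of_add_zero hq
  obtain rfl := eq_of_add_zero hc
  obtain rfl := eq_of_add_zero hc'
  rcases hP with ⟨-, -, -, -, S, u, z, hS, hu, hz, he⟩ | ⟨h1, -⟩
  · rw [rest_zero, add_zero, rest_unit L (c := 0) (t := 0) (by omega) (by
      intro i; simp [unit]), rest_zero] at hu
    obtain ⟨v, u', hv, ⟨l, hl, rfl⟩, rfl⟩ := fitsSum_cons.1 hu
    rw [Multiset.rel_zero_left.1 hl] at he
    exact ⟨S, v, z, hS, hv, hz, by simpa using he⟩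
  · simp at h1

end Soundness

end Track

namespace Track

variable {d : ℕ}

/-! ### Completeness -/

/-- The numbers of copies at the positions on a track. -/
def cnt (T : ℕ) (m : Multiset ℕ) : Fin (T + 1) → ℕ := fun i => m.count (i : ℕ)

theorem cnt_zero (T : ℕ) : cnt T 0 = 0 := by
  funext i; simp [cnt]

theorem cnt_cons (T : ℕ) (m : Multiset ℕ) (t : ℕ) (i : Fin (T + 1)) :
    (cnt T (t ::ₘ m) i : ℤ) = cnt T m i + unit t 1 i := by
  simp only [cnt, Multiset.count_cons, unit]
  split_ifs <;> simp

theorem cnt_cons' (T : ℕ) (m : Multiset ℕ) (t : ℕ) (i : Fin (T + 1)) :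
    (cnt T m i : ℤ) = cnt T (t ::ₘ m) i + unit t (-1) i := by
  rw [cnt_cons]
  simp only [unit]
  split_ifs <;> simp

section Completeness

variable {L : Track d} {B : ℕ}

local notation:50 x " ⟶* " y => Relation.ReflTransGen (Moves (transitions L B)) x y

theorem moves_of_mem {q q₂ : Fin 3 → ℕ} {s s' s₂ s₂' : Fin d → ℕ}
    {c c' c₂ c₂' : Fin (L.length + 1) → ℕ} {qa : Fin 3 → ℤ} {sa sa' : Fin d → ℤ}
    {ca ca' : Fin (L.length + 1) → ℤ} (ha : vec qa sa sa' ca ca' ∈ transitions L B)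
    (hq : ∀ i, (q₂ i : ℤ) = q i + qa i) (hs : ∀ i, (s₂ i : ℤ) = s i + sa i)
    (hs' : ∀ i, (s₂' i : ℤ) = s' i + sa' i) (hc : ∀ i, (c₂ i : ℤ) = c i + ca i)
    (hc' : ∀ i, (c₂' i : ℤ) = c' i + ca' i) :
    Moves (transitions L B) (vec q s s' c c') (vec q₂ s₂ s₂' c₂ c₂') :=
  ⟨_, ha, vec_step_iff.2 ⟨hq, hs, hs', hc, hc'⟩⟩

theorem forall_control {q q₂ : Fin 3 → ℕ} {qa : Fin 3 → ℤ} (h0 : (q₂ 0 : ℤ) = q 0 + qa 0)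
    (h1 : (q₂ 1 : ℤ) = q 1 + qa 1) (h2 : (q₂ 2 : ℤ) = q 2 + qa 2) :
    ∀ i, (q₂ i : ℤ) = q i + qa i := by
  intro i
  fin_cases i
  exacts [h0, h1, h2]

theorem destroy {t : ℕ} (ht : L[t]? = some none) (m : Multiset ℕ) :
    Moves (transitions L B) (vec ![1, 0, 0] 0 0 (cnt _ (t ::ₘ m)) 0)
      (vec ![1, 0, 0] 0 0 (cnt _ m) 0) :=
  moves_of_mem (mem_transitions.2 (.inr (.inr (.inr ⟨t, none, ht, .tail _ (.head _)⟩))))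
    (fun _ => (add_zero _).symm) (fun _ => (add_zero _).symm) (fun _ => (add_zero _).symm)
    (cnt_cons' _ m t) fun _ => (add_zero _).symm

theorem create {t : ℕ} (ht : L[t]? = some none) (m : Multiset ℕ) :
    Moves (transitions L B) (vec ![1, 0, 0] 0 0 (cnt _ m) 0)
      (vec ![1, 0, 0] 0 0 (cnt _ ((t + 1) ::ₘ m)) 0) :=
  moves_of_mem (mem_transitions.2 (.inr (.inr (.inr ⟨t, none, ht, .tail _ (.tail _ (.head _))⟩))))
    (fun _ => (add_zero _).symm) (fun _ => (add_zero _).symm) (fun _ => (add_zero _).symm)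
    (cnt_cons _ m (t + 1)) fun _ => (add_zero _).symm

theorem flush {t : ℕ} (ht : t < L.length) (m m' : Multiset ℕ) :
    vec ![1, 0, 0] (0 : Fin d → ℕ) 0 (cnt _ m) (cnt _ (t ::ₘ m')) ⟶*
      vec ![1, 0, 0] 0 0 (cnt _ (t ::ₘ m)) (cnt _ m') := by
  have h1 : Moves (transitions L B) (vec ![1, 0, 0] 0 0 (cnt _ m) (cnt _ (t ::ₘ m')))
      (vec ![0, 1, 0] 0 0 (cnt _ (t ::ₘ m)) (cnt _ m')) := by
    refine moves_of_mem (qa := ![-1, 1, 0]) (sa := 0) (sa' := 0) (mem_transitions.2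
      (.inr (.inr (.inr ⟨t, L[t], List.getElem?_eq_getElem ht, ?_⟩))))
      (forall_control rfl rfl rfl) (fun _ => (add_zero _).symm) (fun _ => (add_zero _).symm)
      (cnt_cons _ m t) (cnt_cons' _ m' t)
    cases L[t] <;> exact List.mem_cons_self
  have h2 : Moves (transitions L B) (vec ![0, 1, 0] 0 0 (cnt _ (t ::ₘ m)) (cnt _ m'))
      (vec ![1, 0, 0] 0 0 (cnt _ (t ::ₘ m)) (cnt _ m')) :=
    moves_of_mem (mem_transitions.2 (.inl rfl))
      (forall_control rfl rfl rfl) (fun _ => (add_zero _).symm) (fun _ => (add_zero _).symm)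
      (fun _ => (add_zero _).symm) (fun _ => (add_zero _).symm)
  exact .head h1 (.single h2)

theorem flush_all (m' m : Multiset ℕ) (ht : ∀ t ∈ m', t < L.length) :
    vec ![1, 0, 0] (0 : Fin d → ℕ) 0 (cnt _ m) (cnt _ m') ⟶*
      vec ![1, 0, 0] 0 0 (cnt _ (m + m')) 0 := by
  induction m' using Multiset.induction generalizing m with
  | empty => rw [cnt_zero, add_zero]
  | cons t m' ih =>
    have h := ih (t ::ₘ m) fun x hx => ht x (Multiset.mem_cons_of_mem hx)
    rw [Multiset.cons_add, ← Multiset.add_cons] at h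
    exact (flush (ht t (Multiset.mem_cons_self _ _)) m m').trans h

theorem begin_round (m : Multiset ℕ) :
    Moves (transitions L B) (vec ![1, 0, 0] 0 0 (cnt _ m) 0)
      (vec ![0, 0, 1] (fun _ => B) (fun _ => B) (cnt _ m) (cnt _ 0)) :=
  moves_of_mem (mem_transitions.2 (.inr (.inl rfl))) (forall_control rfl rfl rfl) (by simp)
    (by simp) (fun _ => (add_zero _).symm) fun _ => by simp [cnt]

theorem end_round (m m' : Multiset ℕ) :
    Moves (transitions L B) (vec ![0, 0, 1] (fun _ => B) (fun _ => B) (cnt _ m) (cnt _ m'))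
      (vec ![1, 0, 0] 0 0 (cnt _ m) (cnt _ m')) :=
  moves_of_mem (mem_transitions.2 (.inr (.inr (.inl rfl)))) (forall_control rfl rfl rfl) (by simp)
    (by simp) (fun _ => (add_zero _).symm) (fun _ => (add_zero _).symm)

/-- The bounded counters hold `B + x` and `B - x` for the running sum `x`, and the bound on all
prefixes keeps both nonnegative. -/
theorem advance (l : List (ℕ × (Fin d → ℤ))) (m m' : Multiset ℕ) (x : Fin d → ℤ)
    (hl : ∀ y ∈ l, L[y.1]? = some (some y.2))
    (hx : ∀ p, p <+: l → ∀ k, |(x + (p.map Prod.snd).sum) k| ≤ B) :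
    vec ![0, 0, 1] (fun k => (B + x k).toNat) (fun k => (B - x k).toNat)
      (cnt _ (m + (l.map Prod.fst : List ℕ))) (cnt _ m') ⟶*
    vec ![0, 0, 1] (fun k => (B + (x + (l.map Prod.snd).sum) k).toNat)
      (fun k => (B - (x + (l.map Prod.snd).sum) k).toNat) (cnt _ m)
      (cnt _ (m' + (l.map fun y => y.1 + 1 : List ℕ))) := by
  induction l generalizing x m' with
  | nil => simp only [List.map_nil, Multiset.coe_nil, add_zero, List.sum_nil]; exact .refl
  | cons y l ih =>
    obtain ⟨t, w⟩ := y
    have h0 := fun k => abs_le.1 (hx [] (List.nil_prefix) k)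
    have h1 := fun k => abs_le.1 (hx [(t, w)] (by simp) k)
    simp only [List.map_nil, List.sum_nil, add_zero, List.map_cons, List.sum_cons,
      Pi.add_apply, Pi.zero_apply] at h0 h1
    have h := ih ((t + 1) ::ₘ m') (x + w) (fun y hy => hl y (List.mem_cons_of_mem _ hy))
      fun p hp k => by
        have := hx ((t, w) :: p) (by simpa using hp) k
        simpa [add_assoc] using this
    rw [Multiset.cons_add, ← Multiset.add_cons, Multiset.cons_coe] at h
    simp only [List.map_cons, List.sum_cons, ← add_assoc]
    refine .head ?_ h
    rw [← Multiset.cons_coe, Multiset.add_cons]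
    refine moves_of_mem (mem_transitions.2 (.inr (.inr (.inr ⟨t, some w,
      hl _ List.mem_cons_self, .tail _ (.head _)⟩)))) (fun _ => (add_zero _).symm) (fun k => ?_)
      (fun k => ?_) (cnt_cons' _ _ t) (cnt_cons _ _ _)
    · have := h0 k; have := h1 k; simp only [Pi.add_apply]; omega
    · have := h0 k; have := h1 k; simp only [Pi.add_apply, Pi.neg_apply]; omega

theorem Fits.cons_cases {L : Track d} {S : List ℚ} {τ : ℚ} {v : DataVector d}
    (h : Fits L (τ :: S) v) : Fits L S v ∨
      ∃ w L' v', L = some w :: L' ∧ v = Finsupp.single τ w + v' ∧ Fits L' S v' := by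
  cases h with
  | halt L => exact .inl (.halt _ _)
  | skip _ h => exact .inl h
  | take w _ h => exact .inr ⟨w, _, _, rfl, rfl, h⟩

theorem Fits.nil_cases {L : Track d} {v : DataVector d} (h : Fits L [] v) :
    ∃ L', L = none :: L' := by
  cases h with
  | halt L => exact ⟨_, rfl⟩

theorem getElem?_of_drop_eq {t : ℕ} {o : Option (Fin d → ℤ)} {L' : Track d}
    (h : L.drop t = o :: L') : L[t]? = some o ∧ L' = L.drop (t + 1) := by
  constructor
  · have := congrArg (·[0]?) h
    simpa using this
  · rw [← List.tail_drop, h, List.tail_cons]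

/-- The copies are sorted by what they do in the round of `τ`: those in `m₁` skip it, and those in
`m₂` place the vector of their cell there. -/
theorem exists_stay_take (τ : ℚ) (S : List ℚ) (m : Multiset (ℕ × DataVector d))
    (hm : ∀ x ∈ m, Fits (L.drop x.1) (τ :: S) x.2) :
    ∃ (m₁ : Multiset (ℕ × DataVector d)) (m₂ : Multiset ((ℕ × (Fin d → ℤ)) × DataVector d)),
      (∀ x ∈ m₁, Fits (L.drop x.1) S x.2) ∧
      (∀ x ∈ m₂, L[x.1.1]? = some (some x.1.2) ∧ Fits (L.drop (x.1.1 + 1)) S x.2) ∧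
      m.map Prod.fst = m₁.map Prod.fst + m₂.map (fun x => x.1.1) ∧
      (m.map Prod.snd).sum = Finsupp.single τ (m₂.map fun x => x.1.2).sum +
        ((m₁.map Prod.snd).sum + (m₂.map Prod.snd).sum) := by
  induction m using Multiset.induction with
  | empty => exact ⟨0, 0, by simp⟩
  | cons x m ih =>
    obtain ⟨m₁, m₂, h1, h2, h3, h4⟩ := ih fun x hx => hm x (Multiset.mem_cons_of_mem hx)
    obtain ⟨t, v⟩ := x
    rcases (hm _ (Multiset.mem_cons_self _ _)).cons_cases with h | ⟨w, L', v', hL, hv, h⟩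
    · refine ⟨(t, v) ::ₘ m₁, m₂, ?_, h2, ?_, ?_⟩
      · intro x hx
        rcases Multiset.mem_cons.1 hx with rfl | hx
        exacts [h, h1 x hx]
      · simp [h3]
      · simp only [Multiset.map_cons, Multiset.sum_cons, h4]; abel
    · obtain ⟨ht, rfl⟩ := getElem?_of_drop_eq hL
      refine ⟨m₁, ((t, w), v') ::ₘ m₂, h1, ?_, ?_, ?_⟩
      · intro x hx
        rcases Multiset.mem_cons.1 hx with rfl | hx
        exacts [⟨ht, h⟩, h2 x hx]
      · simp [h3]
      · simp only at hv
        simp only [Multiset.map_cons, Multiset.sum_cons, h4, hv, Finsupp.single_add]; abel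

theorem sum_apply_eq_zero {α : Type} (m : Multiset α) (f : α → DataVector d) (τ : ℚ)
    (h : ∀ x ∈ m, f x τ = 0) : (m.map f).sum τ = 0 := by
  induction m using Multiset.induction with
  | empty => rfl
  | cons x m ih =>
    rw [Multiset.map_cons, Multiset.sum_cons, Finsupp.add_apply, h x (Multiset.mem_cons_self _ _),
      ih fun x hx => h x (Multiset.mem_cons_of_mem hx), add_zero]

variable {M : ℕ} (hw : ∀ w, some w ∈ L → ∀ k, |w k| ≤ M) (hB : blockBound M d * M ≤ B)

include hw hB

/-- One round is performed for each data value of `S`. When none is left, all copies stand at ends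
and can be destroyed. -/
theorem reachable_of_sum_eq_zero (S : List ℚ) (hS : S.Pairwise (· < ·))
    (m : Multiset (ℕ × DataVector d)) (hm : ∀ x ∈ m, Fits (L.drop x.1) S x.2)
    (h0 : (m.map Prod.snd).sum = 0) :
    vec ![1, 0, 0] (0 : Fin d → ℕ) 0 (cnt _ (m.map Prod.fst)) 0 ⟶* vec ![1, 0, 0] 0 0 0 0 := by
  induction S generalizing m with
  | nil =>
    clear h0
    induction m using Multiset.induction with
    | empty => rw [Multiset.map_zero, cnt_zero]
    | cons x m ih =>
      obtain ⟨L', hL⟩ := (hm x (Multiset.mem_cons_self _ _)).nil_cases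
      rw [Multiset.map_cons]
      exact .head (destroy (getElem?_of_drop_eq hL).1 _)
        (ih fun x hx => hm x (Multiset.mem_cons_of_mem hx))
  | cons τ S ih =>
    obtain ⟨m₁, m₂, h1, h2, h3, h4⟩ := exists_stay_take τ S m hm
    have hτ : τ ∉ S := fun h => lt_irrefl _ ((List.pairwise_cons.1 hS).1 τ h)
    -- After `τ` has been treated, the remaining placements live on `S`, which does not contain `τ`;
    -- so the vectors taken now make up the whole value at `τ`.
    have e0 : (m₂.map fun x => x.1.2).sum = 0 := by
      have := congrArg (fun f : DataVector d => f τ) (h4.symm.trans h0)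
      simpa [sum_apply_eq_zero m₁ _ τ fun x hx => (h1 x hx).apply_eq_zero hτ,
        sum_apply_eq_zero m₂ _ τ fun x hx => (h2 x hx).2.apply_eq_zero hτ] using this
    have e1 : (m₁.map Prod.snd).sum + (m₂.map Prod.snd).sum = 0 := by
      rw [h0, e0, Finsupp.single_zero, zero_add] at h4
      exact h4.symm
    obtain ⟨l, hl, hp⟩ := exists_list_partialSum_le Prod.snd M (m₂.map Prod.fst) (by
      intro a ha k
      obtain ⟨x, hx, rfl⟩ := Multiset.mem_map.1 ha
      exact hw _ (List.mem_of_getElem? (h2 x hx).1) k) (by rw [Multiset.map_map]; exact e0)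
    have hl' : ∀ y ∈ l, L[y.1]? = some (some y.2) := by
      intro y hy
      have : y ∈ m₂.map Prod.fst := hl ▸ hy
      obtain ⟨x, hx, rfl⟩ := Multiset.mem_map.1 this
      exact (h2 x hx).1
    have hadv := advance (B := B) l (m₁.map Prod.fst) 0 0 hl' fun p hpl k => by
      rw [zero_add]
      exact (hp p hpl k).trans (by exact_mod_cast hB)
    have hsum : (l.map Prod.snd).sum = 0 := by
      rw [← e0, ← Multiset.sum_coe, ← Multiset.map_coe, hl, Multiset.map_map]
      rfl
    have hfst : ((l.map Prod.fst : List ℕ) : Multiset ℕ) = m₂.map fun x => x.1.1 := by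
      rw [← Multiset.map_coe, hl, Multiset.map_map]
      rfl
    have hsucc : ((l.map fun y => y.1 + 1 : List ℕ) : Multiset ℕ) = m₂.map fun x => x.1.1 + 1 := by
      rw [← Multiset.map_coe, hl, Multiset.map_map]
      rfl
    have hz : ∀ k, ((B : ℤ) + (0 : Fin d → ℤ) k).toNat = B ∧
        ((B : ℤ) - (0 : Fin d → ℤ) k).toNat = B := fun k => by simp
    simp only [hsum, hfst, hsucc, add_zero, zero_add, (hz _).1, (hz _).2] at hadv
    have hfl := flush_all (L := L) (B := B) (m₂.map fun x => x.1.1 + 1) (m₁.map Prod.fst) (by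
      intro t ht
      obtain ⟨x, hx, rfl⟩ := Multiset.mem_map.1 ht
      have := (h2 x hx).2.ne_nil
      rwa [Ne, List.drop_eq_nil_iff, not_le] at this)
    have hih := ih (List.pairwise_cons.1 hS).2 (m₁ + m₂.map fun x => (x.1.1 + 1, x.2)) (by
      intro x hx
      rcases Multiset.mem_add.1 hx with hx | hx
      · exact h1 x hx
      · obtain ⟨y, hy, rfl⟩ := Multiset.mem_map.1 hx
        exact (h2 y hy).2) (by
      rw [Multiset.map_add, Multiset.map_map, Multiset.sum_add]
      exact e1)
    rw [Multiset.map_add, Multiset.map_map] at hih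
    rw [h3]
    exact .head (begin_round _) (hadv.trans (.head (end_round _ _) (hfl.trans hih)))

/-- A placement of the whole track and of tracks that begin after an end gives a run. -/
theorem reachable_of_fits {S : List ℚ} (hS : S.Pairwise (· < ·)) {u : DataVector d}
    (l : List (DataVector d)) (hu : Fits L S u)
    (hl : ∀ v ∈ l, ∃ t, L[t]? = some none ∧ Fits (L.drop (t + 1)) S v) (h0 : u + l.sum = 0) :
    (toVAS L B).Reachable := by
  have hcr : ∃ m : Multiset (ℕ × DataVector d), (∀ x ∈ m, Fits (L.drop x.1) S x.2) ∧
      (m.map Prod.snd).sum = u + l.sum ∧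
      (vec ![1, 0, 0] (0 : Fin d → ℕ) 0 (cnt _ {0}) 0 ⟶*
        vec ![1, 0, 0] 0 0 (cnt _ (m.map Prod.fst)) 0) := by
    clear h0
    induction l with
    | nil => exact ⟨{(0, u)}, by simpa using hu, by simp, .refl⟩
    | cons v l ih =>
      obtain ⟨m, h1, h2, h3⟩ := ih fun v hv => hl v (List.mem_cons_of_mem _ hv)
      obtain ⟨t, ht, hv⟩ := hl v List.mem_cons_self
      refine ⟨(t + 1, v) ::ₘ m, ?_, ?_, ?_⟩
      · intro x hx
        rcases Multiset.mem_cons.1 hx with rfl | hx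
        exacts [hv, h1 x hx]
      · rw [Multiset.map_cons, Multiset.sum_cons, h2, List.sum_cons]; abel
      · rw [Multiset.map_cons]
        exact h3.tail (create ht _)
  obtain ⟨m, h1, h2, h3⟩ := hcr
  rw [reachable_toVAS_iff]
  have e : (unit 0 1 : Fin (L.length + 1) → ℕ) = cnt L.length {0} := by
    funext i
    simp [unit, cnt, Multiset.count_singleton]
  rw [e]
  exact h3.trans (reachable_of_sum_eq_zero hw hB S hS m h1 (h2.trans h0))

end Completeness

end Track

/-! ### Invariance of permutation sums -/

namespace DataVector

variable {d : ℕ}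

theorem comp_comp_symm (v : DataVector d) (ρ : ℚ ≃o ℚ) : (v.comp ρ).comp ρ.symm = v := by
  ext1 α
  simp [comp_apply]

theorem comp_list_sum (l : List (DataVector d)) (ρ : ℚ ≃o ℚ) :
    comp l.sum ρ = (l.map (comp · ρ)).sum := by
  induction l with
  | nil => exact comp_zero ρ
  | cons v l ih => rw [List.sum_cons, comp_add, ih, List.map_cons, List.sum_cons]

/-- This undoes the permutation that a run applies to the target. -/
theorem IsPermSum.comp {x : DataVector d} {X : Set (DataVector d)} (h : x.IsPermSum X)
    (ρ : ℚ ≃o ℚ) : (x.comp ρ).IsPermSum X := by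
  obtain ⟨l, hl, rfl⟩ := h
  refine ⟨l.map (DataVector.comp · ρ), ?_, comp_list_sum l ρ⟩
  intro w hw
  obtain ⟨y, hy, rfl⟩ := List.mem_map.1 hw
  obtain ⟨v, hv, σ, rfl⟩ := hl y hy
  exact ⟨v, hv, ρ.trans σ, by ext1 α; rfl⟩

theorem exists_sorted_of_list (l : List (DataVector d)) :
    ∃ S : List ℚ, S.Pairwise (· < ·) ∧ ∀ v ∈ l, ∀ α, v α ≠ 0 → α ∈ S := by
  have h : ∃ F : Finset ℚ, ∀ v ∈ l, ∀ α, v α ≠ 0 → α ∈ F := by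
    induction l with
    | nil => exact ⟨∅, by simp⟩
    | cons v l ih =>
      obtain ⟨F, hF⟩ := ih
      refine ⟨v.support ∪ F, fun w hw α hα => Finset.mem_union.2 ?_⟩
      rcases List.mem_cons.1 hw with rfl | hw
      · exact .inl (by simpa using hα)
      · exact .inr (hF w hw α hα)
  obtain ⟨F, hF⟩ := h
  exact ⟨F.sort (· ≤ ·), (Finset.sortedLT_sort _).pairwise, fun v hv α hα => by
    simpa using hF v hv α hα⟩

end DataVector

/-! ### Correctness of the reduction to vector addition systems -/

namespace DataSystem

/-- The track of a system: the negated target, then the given data vectors. -/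
noncomputable def track (E : DataSystem) : Track E.dim := Track.ofList (-E.target :: E.vectors)

/-- The vector addition system for a system, with a bound for the counters that is doubly
exponential in the size of the system. -/
noncomputable def toVAS (E : DataSystem) : VAS :=
  Track.toVAS E.track (2 ^ 8 ^ E.encode.length)

/-- The run yields `z = E.target.comp ρ` for a permutation sum `z`; composing with `ρ.symm` gives
the target itself. The size of `B` does not matter here. -/
theorem solvable_of_reachable {E : DataSystem} {B : ℕ} (h : (Track.toVAS E.track B).Reachable) :
    E.Solvable := by
  obtain ⟨S, u, z, hS, hu, hz, he⟩ := Track.exists_fits_of_reachable (X := {v | v ∈ E.vectors})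
    (fun w hw => (Track.mem_ofList hw).elim fun v hv => hv.2.elim fun α hα => hα.2)
    (fun M S v hM hS hv => by
      obtain ⟨u, hu, L', rfl⟩ := Track.exists_cells_of_suffix _ _ hM hv.ne_nil
      obtain ⟨ρ, rfl⟩ := hv.exists_comp hS
      exact ⟨u, hu, ρ, rfl⟩) h
  have hu' : Track.Fits (Track.cells (-E.target) ++ Track.ofList E.vectors) S u := hu
  obtain ⟨ρ, rfl⟩ := hu'.exists_comp hS
  have hn : (-E.target).comp ρ = -(E.target.comp ρ) := by
    ext1 α
    rfl
  rw [hn, neg_add_eq_zero] at he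
  have := hz.comp ρ.symm
  rwa [← he, comp_comp_symm] at this

/-- A common list `S` of all data values in use lets every summand, and the negated target, be
placed along its part of the track. -/
theorem reachable_of_solvable {E : DataSystem} {B M : ℕ}
    (hw : ∀ v ∈ E.target :: E.vectors, ∀ α k, |v α k| ≤ M) (hB : blockBound M E.dim * M ≤ B)
    (h : E.Solvable) : (Track.toVAS E.track B).Reachable := by
  obtain ⟨l, hl, he⟩ := h
  obtain ⟨S, hS, hS'⟩ := exists_sorted_of_list (-E.target :: l)
  refine Track.reachable_of_fits (M := M) (fun w hwL k => ?_) hB hS l (u := -E.target) ?_ ?_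
    (by rw [← he, neg_add_cancel])
  · obtain ⟨v, hv, α, rfl, -⟩ := Track.mem_ofList hwL
    rcases List.mem_cons.1 hv with rfl | hv
    · rw [Finsupp.neg_apply, Pi.neg_apply, abs_neg]
      exact hw _ List.mem_cons_self α k
    · exact hw _ (List.mem_cons_of_mem _ hv) α k
  · have e : (-E.target).comp (OrderIso.refl ℚ) = -E.target := by
      ext1 α
      rfl
    have := Track.fits_cells (-E.target) (OrderIso.refl ℚ) (Track.ofList E.vectors) hS fun α h =>
      hS' _ List.mem_cons_self α (e ▸ h)
    rwa [e] at this
  · intro v hv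
    obtain ⟨y, hy, ρ, rfl⟩ := hl v hv
    obtain ⟨t, L', ht, hd⟩ := Track.exists_drop_eq (-E.target) E.vectors hy
    refine ⟨t, ht, ?_⟩
    rw [track, hd]
    exact Track.fits_cells y ρ _ hS fun α => hS' _ (List.mem_cons_of_mem _ hv) α

/-! ### Bounds by the length of the encoding -/

theorem lt_two_pow_length_encodePosNum (p : PosNum) :
    (p : ℕ) < 2 ^ (Computability.encodePosNum p).length := by
  induction p with
  | one => simp [Computability.encodePosNum]
  | bit0 p ih =>
    simp only [Computability.encodePosNum, List.length_cons, PosNum.cast_bit0, pow_succ]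
    omega
  | bit1 p ih =>
    simp only [Computability.encodePosNum, List.length_cons, PosNum.cast_bit1, pow_succ]
    omega

theorem lt_two_pow_length_encNat (n : ℕ) : n < 2 ^ (encNat n).length := by
  rw [encNat, List.length_map, Computability.encodeNat]
  conv_lhs => rw [← Num.to_of_nat n]
  cases (n : Num) with
  | zero => simp [Computability.encodeNum]
  | pos p => exact lt_two_pow_length_encodePosNum p

theorem length_encNat_le_encVec {d : ℕ} (v : Fin d → ℤ) (k : Fin d) :
    (encNat (v k).natAbs).length ≤ (encVec v).length := by
  have h : encInt (v k) ++ [Letter.comma] <:+: encVec v := by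
    rw [encVec, List.flatMap]
    exact List.infix_of_mem_flatten (List.mem_map.2 ⟨v k, List.mem_ofFn.2 ⟨k, rfl⟩, rfl⟩)
  have := h.length_le
  simp only [encInt, List.length_append] at this
  omega

theorem length_encVec_le_encDataVector {d : ℕ} (v : DataVector d) {α : ℚ} (hα : v α ≠ 0) :
    (encVec (v α)).length ≤ (encDataVector v).length := by
  have h : encRat α ++ Letter.colon :: (encVec (v α) ++ [Letter.semicolon]) <:+:
      encDataVector v := by
    rw [encDataVector, List.flatMap]
    exact List.infix_of_mem_flatten (List.mem_map.2 ⟨α, by simpa using hα, rfl⟩)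
  have := h.length_le
  simp only [List.length_append, List.length_cons] at this
  omega

theorem length_encDataVector_le {E : DataSystem} {v : DataVector E.dim}
    (hv : v ∈ E.target :: E.vectors) : (encDataVector v).length ≤ E.encode.length := by
  simp only [encode, List.length_append, List.length_cons]
  rcases List.mem_cons.1 hv with rfl | hv
  · omega
  · have h : encDataVector v ++ [Letter.bar] <:+:
        E.vectors.flatMap fun v => encDataVector v ++ [Letter.bar] := by
      rw [List.flatMap]
      exact List.infix_of_mem_flatten (List.mem_map.2 ⟨v, hv, rfl⟩)
    have := h.length_le
    simp only [List.length_append] at this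
    omega

theorem abs_le_two_pow {E : DataSystem} {v : DataVector E.dim} (hv : v ∈ E.target :: E.vectors)
    (α : ℚ) (k : Fin E.dim) : |v α k| ≤ (2 ^ E.encode.length : ℕ) := by
  by_cases hα : v α = 0
  · rw [hα, Pi.zero_apply, abs_zero]
    positivity
  · rw [Int.abs_eq_natAbs]
    have h := (length_encNat_le_encVec (v α) k).trans
      ((length_encVec_le_encDataVector v hα).trans (length_encDataVector_le hv))
    exact_mod_cast (lt_two_pow_length_encNat _).le.trans (Nat.pow_le_pow_right (by norm_num) h)

theorem dim_le_length_encode (E : DataSystem) : E.dim ≤ E.encode.length := by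
  simp [encode]

theorem solvable_iff_reachable (E : DataSystem) : E.Solvable ↔ E.toVAS.Reachable :=
  ⟨reachable_of_solvable (fun _ hv => abs_le_two_pow hv)
    (blockBound_mul_le le_rfl E.dim_le_length_encode), solvable_of_reachable⟩

end DataSystem

/-! ### The machine for the reduction to vector addition systems -/

/-- The least significant bit comes first, so doubling puts a zero in front. -/
theorem encodePosNum_two_pow (m : ℕ) : ∃ p : PosNum, ((2 ^ m : ℕ) : Num) = .pos p ∧
    Computability.encodePosNum p = List.replicate m false ++ [true] := by
  induction m with
  | zero => exact ⟨.one, rfl, rfl⟩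
  | succ m ih =>
    obtain ⟨p, h1, h2⟩ := ih
    have e2 : Computability.encodePosNum p.bit0 = List.replicate (m + 1) false ++ [true] := by
      rw [Computability.encodePosNum, h2, List.replicate_succ, List.cons_append]
    suffices e1 : ((2 ^ (m + 1) : ℕ) : Num) = .pos p.bit0 from ⟨p.bit0, e1, e2⟩
    have e : (2 ^ (m + 1) : ℕ) = ((Num.pos p.bit0 : Num) : ℕ) := by
      have h : ((Num.pos p : Num) : ℕ) = 2 ^ m := by rw [← h1, Num.to_of_nat]
      rw [Num.cast_pos] at h
      rw [Num.cast_pos, PosNum.cast_bit0, h, pow_succ]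
      ring
    rw [e, Num.of_to_nat]

theorem encNat_two_pow (m : ℕ) : encNat (2 ^ m) = List.replicate m (.bit false) ++ [.bit true] := by
  obtain ⟨p, h1, h2⟩ := encodePosNum_two_pow m
  rw [encNat, Computability.encodeNat, h1]
  change (Computability.encodePosNum p).map _ = _
  rw [h2]
  simp

theorem encInt_two_pow (m : ℕ) : encInt ((2 ^ m : ℕ) : ℤ) =
    List.replicate m (.bit false) ++ [.bit true] := by
  rw [encInt, if_neg (by simp), Int.natAbs_natCast, encNat_two_pow]
  rfl

theorem encInt_neg_two_pow (m : ℕ) : encInt (-((2 ^ m : ℕ) : ℤ)) =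
    .minus :: (List.replicate m (.bit false) ++ [.bit true]) := by
  rw [encInt, if_pos (by simp), Int.natAbs_neg, Int.natAbs_natCast, encNat_two_pow]
  rfl

theorem encVec_const (d : ℕ) (z : ℤ) :
    encVec (fun _ : Fin d => z) = (List.replicate d (encInt z ++ [.comma])).flatten := by
  rw [encVec, List.ofFn_const, List.flatMap, List.map_replicate]

namespace Track

variable {d T : ℕ}

/-! #### Words -/

/-- The word of a vector with the entry `z` at index `t` that is followed by `r` zeros. -/
def unitWord (t r : ℕ) (z : List Letter) : List Letter :=
  List.replicate t .comma ++ z ++ .comma :: List.replicate r .comma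

/-- The word of the zero vector of dimension `2 * d`. -/
def zeroWord (d : ℕ) : List Letter := List.replicate d .comma ++ List.replicate d .comma

/-- The word of a vector that is composed of the parts with the given words. -/
def vecWord (q s c c' : List Letter) : List Letter := q ++ s ++ c ++ c'

/-- The word of a transition. -/
def stepWord (q s c c' : List Letter) : List Letter := vecWord q s c c' ++ [.semicolon]

/-- The words of the transitions for a cell that follows `t` cells and is followed by `r` cells. -/
def cellWord (t r : ℕ) (o : Option (Fin d → ℤ)) : List Letter :=
  stepWord [.minus, .bit true, .comma, .bit true, .comma, .comma] (zeroWord d)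
      (unitWord t (r + 1) [.bit true]) (unitWord t (r + 1) [.minus, .bit true]) ++
    match o with
    | some w => stepWord [.comma, .comma, .comma] (encVec w ++ encVec (-w))
        (unitWord t (r + 1) [.minus, .bit true]) (unitWord (t + 1) r [.bit true])
    | none => stepWord [.comma, .comma, .comma] (zeroWord d)
          (unitWord t (r + 1) [.minus, .bit true]) (unitWord t (r + 1) []) ++
        stepWord [.comma, .comma, .comma] (zeroWord d) (unitWord (t + 1) r [.bit true])
          (unitWord (t + 1) r [])

/-- The words of the transitions for a part of a track that follows `t` cells and is followed by `r`
cells. -/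
def trackWord (t r : ℕ) : Track d → List Letter
  | [] => []
  | o :: L => cellWord t (L.length + r) o ++ trackWord (t + 1) r L

theorem trackWord_append (t r : ℕ) (L L' : Track d) : trackWord t r (L ++ L') =
    trackWord t (L'.length + r) L ++ trackWord (t + L.length) r L' := by
  induction L generalizing t with
  | nil => rfl
  | cons o L ih =>
    rw [List.cons_append, trackWord, trackWord, ih, List.length_append, List.length_cons,
      List.append_assoc, add_assoc, add_right_comm t, ← add_assoc t]

theorem encVec_vec (q : Fin 3 → ℤ) (s s' : Fin d → ℤ) (c c' : Fin (T + 1) → ℤ) :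
    encVec (vec q s s' c c') =
      vecWord (encVec q) (encVec s ++ encVec s') (encVec c) (encVec c') := by
  simp [vec, vecWord]

theorem encVec_unit {t r : ℕ} (h : t + r = T) (z : ℤ) :
    encVec (unit t z : Fin (T + 1) → ℤ) = unitWord t r (encInt z) :=
  encVec_eq_of_val t r (by omega) z _ fun _ => rfl

/-- The zero vector has such a word for every split, so the program for unit vectors prints it
whatever the current position is. -/
theorem encVec_zero_eq_unitWord {t r : ℕ} (h : t + r = T) :
    encVec (0 : Fin (T + 1) → ℤ) = unitWord t r [] := by
  rw [encVec_const_zero, unitWord, ← h, List.append_nil, ← List.replicate_succ,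
    List.replicate_append_replicate]
  congr 1

theorem encVec_control (x y z : ℤ) :
    encVec ![x, y, z] = encInt x ++ .comma :: (encInt y ++ .comma :: (encInt z ++ [.comma])) := by
  simp [encVec]

theorem encVec_zero_zero : encVec (0 : Fin d → ℤ) ++ encVec (0 : Fin d → ℤ) = zeroWord d := by
  rw [encVec_const_zero, zeroWord]

theorem flatMap_cellTransitions {t r : ℕ} (h : t + r + 1 = T) (o : Option (Fin d → ℤ)) :
    ((cellTransitions T t o).flatMap fun a => encVec a ++ [.semicolon]) = cellWord t r o := by
  have e0 : encVec (0 : Fin 3 → ℤ) = [.comma, .comma, .comma] := encVec_const_zero 3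
  have e1 := fun z => encVec_unit (T := T) (t := t) (r := r + 1) (by omega) z
  have e2 := fun z => encVec_unit (T := T) (t := t + 1) (r := r) (by omega) z
  have e3 := encVec_zero_eq_unitWord (T := T) (t := t) (r := r + 1) (by omega)
  have e4 := encVec_zero_eq_unitWord (T := T) (t := t + 1) (r := r) (by omega)
  rcases o with _ | w
  · simp only [cellTransitions, List.flatMap_cons, List.flatMap_nil, encVec_vec, encVec_zero_zero,
      e1, e2, encVec_control, e0, encInt_neg_one, encInt_one, encInt_zero, List.append_nil, cellWord,
      stepWord]
    -- The zero vector is needed in two splits, before and after the move to the next cell, so the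
    -- occurrences are rewritten separately.
    conv_lhs => enter [2, 1, 1, 4]; rw [e3]
    conv_lhs => enter [2, 2, 1, 4]; rw [e4]
    rfl
  · simp only [cellTransitions, List.flatMap_cons, List.flatMap_nil, encVec_vec, encVec_zero_zero,
      e1, e2, encVec_control, e0, encInt_neg_one, encInt_one, encInt_zero, List.append_nil, cellWord,
      stepWord]
    rfl

theorem flatMap_zipIdx (L : Track d) (t : ℕ) (h : t + L.length = T) :
    (((L.zipIdx t).flatMap fun x => cellTransitions T x.2 x.1).flatMap
      fun a => encVec a ++ [.semicolon]) = trackWord t 0 L := by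
  induction L generalizing t with
  | nil => rfl
  | cons o L ih =>
    rw [List.length_cons] at h
    rw [List.zipIdx_cons, List.flatMap_cons, List.flatMap_append, ih _ (by omega),
      flatMap_cellTransitions (r := L.length) (by omega)]
    rfl

/-- The words of the counter bounds. -/
def boundWord (d m : ℕ) (sign : List Letter) : List Letter :=
  (List.replicate d (sign ++ List.replicate m (.bit false) ++ [.bit true, .comma])).flatten

theorem natCast_vec (q : Fin 3 → ℕ) (s s' : Fin d → ℕ) (c c' : Fin (T + 1) → ℕ) :
    (fun i => ((vec q s s' c c' i : ℕ) : ℤ)) = vec (fun i => (q i : ℤ)) (fun i => (s i : ℤ))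
      (fun i => (s' i : ℤ)) (fun i => (c i : ℤ)) (fun i => (c' i : ℤ)) := by
  funext i
  revert i
  simp only [forall_fin_add (m := 3 + d + d + (T + 1)), forall_fin_add (m := 3 + d + d),
    forall_fin_add (m := 3 + d), forall_fin_add (m := 3) (n := d), vec, Fin.append_left,
    Fin.append_right, implies_true, and_self]

/-- The words of the transitions that begin and end a round and that prepare the next one. -/
def roundWord (d T m : ℕ) : List Letter :=
  stepWord [.bit true, .comma, .minus, .bit true, .comma, .comma] (zeroWord d)
      (unitWord 0 T []) (unitWord 0 T []) ++
    (stepWord [.minus, .bit true, .comma, .comma, .bit true, .comma]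
      (boundWord d m [] ++ boundWord d m []) (unitWord 0 T []) (unitWord 0 T []) ++
    stepWord [.bit true, .comma, .comma, .minus, .bit true, .comma]
      (boundWord d m [.minus] ++ boundWord d m [.minus]) (unitWord 0 T []) (unitWord 0 T []))

/-- The word of a configuration. -/
def configWord (d : ℕ) (c c' : List Letter) : List Letter :=
  .bar :: vecWord [.bit true, .comma, .comma, .comma] (zeroWord d) c c'

theorem flatMap_transitions (L : Track d) (m : ℕ) (h : L.length = T) :
    ((transitions L (2 ^ m)).flatMap fun a => encVec a ++ [.semicolon]) =
      roundWord d T m ++ trackWord 0 0 L := by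
  subst h
  have e0 : encVec (0 : Fin (L.length + 1) → ℤ) = unitWord 0 L.length [] :=
    encVec_zero_eq_unitWord (by omega)
  have eb : encVec (fun _ : Fin d => ((2 ^ m : ℕ) : ℤ)) = boundWord d m [] := by
    rw [encVec_const, encInt_two_pow, boundWord]
    simp
  have eb' : encVec (fun _ : Fin d => -((2 ^ m : ℕ) : ℤ)) = boundWord d m [.minus] := by
    rw [encVec_const, encInt_neg_two_pow, boundWord]
    simp
  rw [transitions, List.flatMap_append, flatMap_zipIdx L 0 (by omega)]
  simp only [List.flatMap_cons, List.flatMap_nil, encVec_vec, encVec_zero_zero, e0,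
    encVec_control, eb, eb', encInt_neg_one, encInt_one, encInt_zero, List.append_nil]
  rfl

theorem encode_toVAS (L : Track d) (m : ℕ) (h : L.length = T) : (toVAS L (2 ^ m)).encode =
    List.replicate (3 + d + d + (T + 1) + (T + 1)) (.bit true) ++ .bar ::
      ((roundWord d T m ++ trackWord 0 0 L) ++ (configWord d (unitWord 0 T [.bit true])
        (unitWord T 0 []) ++ configWord d (unitWord T 0 []) (unitWord T 0 []))) := by
  rw [← flatMap_transitions L m h]
  subst h
  have e1 : encVec (0 : Fin (L.length + 1) → ℤ) = unitWord L.length 0 [] :=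
    encVec_zero_eq_unitWord (by omega)
  have e2 : encVec (unit 0 1 : Fin (L.length + 1) → ℤ) = unitWord 0 L.length [.bit true] :=
    encVec_unit (by omega) 1
  have c0 : ∀ n, (fun i => (((0 : Fin n → ℕ) i : ℕ) : ℤ)) = 0 := fun n => rfl
  have cq : (fun i => ((![1, 0, 0] : Fin 3 → ℕ) i : ℤ)) = ![1, 0, 0] := by
    funext i; fin_cases i <;> rfl
  have cu : (fun i => ((unit 0 1 : Fin (L.length + 1) → ℕ) i : ℤ)) = unit 0 1 := by
    funext i; simp only [unit]; split_ifs <;> rfl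
  have hi : Letter.bar :: encVec (fun i => (((vec ![1, 0, 0] 0 0 (unit 0 1) 0 :
      Fin (3 + d + d + (L.length + 1) + (L.length + 1)) → ℕ) i : ℕ) : ℤ)) =
      configWord d (unitWord 0 L.length [.bit true]) (unitWord L.length 0 []) := by
    rw [natCast_vec, cq, c0, c0, cu, encVec_vec, encVec_zero_zero, e2, e1, encVec_control,
      encInt_one, encInt_zero]
    rfl
  have hf : Letter.bar :: encVec (fun i => (((vec ![1, 0, 0] 0 0 0 0 :
      Fin (3 + d + d + (L.length + 1) + (L.length + 1)) → ℕ) i : ℕ) : ℤ)) =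
      configWord d (unitWord L.length 0 []) (unitWord L.length 0 []) := by
    rw [natCast_vec, cq, c0, c0, encVec_vec, encVec_zero_zero, e1, encVec_control,
      encInt_one, encInt_zero]
    rfl
  rw [← hi, ← hf]
  rfl

end Track

/-! #### Programs -/

/-- Between programs for the parts of the output, the input is stored together with the unary
numbers `d`, `t`, `r` and `m`. -/
def conf (I : List Letter) (d t r m : ℕ) : Stacks :=
  { inp := I, dim := List.replicate d (.bit true), left := List.replicate t (.bit true)
    right := List.replicate r (.bit true), big := List.replicate m (.bit true) }

/-- The program outputs the word `w` and changes nothing else. -/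
def Emits (p : StackProg Stk Letter) (s : Stacks) (w : List Letter) (c : ℕ) : Prop :=
  ∀ v, Runs p (s.emit v) (s.emit (v ++ w)) c

namespace Emits

variable {p : StackProg Stk Letter} {l : List (StackProg Stk Letter)} {s : Stacks}
  {w w' : List Letter} {c c' : ℕ}

theorem mono (h : Emits p s w c) (hc : c ≤ c') : Emits p s w c' :=
  fun v => (h v).mono hc

theorem congr (h : Emits p s w c) (hw : w = w') : Emits p s w' c :=
  hw ▸ h

theorem nil : Emits (block []) s [] 1 := fun v => by
  rw [List.append_nil]
  exact .block_nil _

theorem cons (h : Emits p s w c) (h' : Emits (block l) s w' c') :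
    Emits (block (p :: l)) s (w ++ w') (c + c') := fun v => by
  rw [← List.append_assoc]
  exact .block_cons (h v) (h' _)

theorem emitP (w : List Letter) : Emits (emitP w) s w (w.length + 1) := fun v => by
  rw [← Stacks.emit_emit]
  exact runs_emitP w _

theorem emitPer {k : Stk} (hk : k ≠ .out) (hk' : k ≠ .tmp) (a : Letter) (hs : s.tmp = []) {n : ℕ}
    (hn : s.get k = List.replicate n (.bit true)) :
    Emits (emitPer k [a]) s (List.replicate n a) (6 * n + 2) := fun v => by
  rw [← Stacks.emit_emit]
  exact runs_emitPer_one hk hk' a (s.emit v) hs n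
    (by rw [Stacks.get_emit _ hk, hn, List.length_replicate])

end Emits

section Emits

variable {I : List Letter} {d t r m : ℕ}

theorem emits_dim (a : Letter) :
    Emits (emitPer .dim [a]) (conf I d t r m) (List.replicate d a) (6 * d + 2) :=
  .emitPer (by decide) (by decide) a rfl rfl

theorem emits_left (a : Letter) :
    Emits (emitPer .left [a]) (conf I d t r m) (List.replicate t a) (6 * t + 2) :=
  .emitPer (by decide) (by decide) a rfl rfl

theorem emits_right (a : Letter) :
    Emits (emitPer .right [a]) (conf I d t r m) (List.replicate r a) (6 * r + 2) :=
  .emitPer (by decide) (by decide) a rfl rfl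

namespace Track

/-- Outputs the word of a unit vector. -/
def unitP (z : List Letter) : StackProg Stk Letter :=
  block [emitPer .left [.comma], emitP z, emitP [.comma], emitPer .right [.comma]]

theorem emits_unitP (z : List Letter) (hz : z.length ≤ 2) :
    Emits (unitP z) (conf I d t r m) (unitWord t r z) (6 * (t + r) + 10) :=
  (((emits_left _).cons ((Emits.emitP _).cons ((Emits.emitP _).cons ((emits_right _).cons
    .nil)))).congr (by simp [unitWord])).mono (by simp; omega)

/-- Outputs the word of the zero vector of dimension `2 * d`. -/
def zeroP : StackProg Stk Letter := block [emitPer .dim [.comma], emitPer .dim [.comma]]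

theorem emits_zeroP : Emits zeroP (conf I d t r m) (zeroWord d) (12 * d + 5) :=
  (((emits_dim _).cons ((emits_dim _).cons .nil)).congr (by simp [zeroWord])).mono (by omega)

/-- Outputs the word of a vector. -/
def vecP (q : List Letter) (s c c' : StackProg Stk Letter) : StackProg Stk Letter :=
  block [emitP q, s, c, c']

theorem emits_vecP {q s c c' : List Letter} {S : Stacks} {ps pc pc' : StackProg Stk Letter}
    {x y z : ℕ} (hq : q.length ≤ 6) (hs : Emits ps S s x) (hc : Emits pc S c y)
    (hc' : Emits pc' S c' z) : Emits (vecP q ps pc pc') S (vecWord q s c c') (x + y + z + 8) :=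
  (((Emits.emitP q).cons (hs.cons (hc.cons (hc'.cons .nil)))).congr (by simp [vecWord])).mono
    (by omega)

/-- Outputs the word of a transition. -/
def stepP (q : List Letter) (s c c' : StackProg Stk Letter) : StackProg Stk Letter :=
  block [vecP q s c c', emitP [.semicolon]]

theorem emits_stepP {q s c c' : List Letter} {S : Stacks} {ps pc pc' : StackProg Stk Letter}
    {x y z : ℕ} (hq : q.length ≤ 6) (hs : Emits ps S s x) (hc : Emits pc S c y)
    (hc' : Emits pc' S c' z) : Emits (stepP q ps pc pc') S (stepWord q s c c') (x + y + z + 12) :=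
  (((emits_vecP hq hs hc hc').cons ((Emits.emitP _).cons .nil)).congr (by simp [stepWord])).mono
    (by simp)

/-- Outputs the words of the counter bounds. -/
def boundP (sign : List Letter) : StackProg Stk Letter :=
  .seq (.loop .dim never fun a => block
    [.push .buf a, emitP sign, emitPer .big [.bit false], emitP [.bit true, .comma]])
    (transfer .buf .dim)

/-- One bound is printed for each letter of `dim`; the letters are parked on `buf` and brought back
at the end. The auxiliary claim allows for `k` letters that have been parked already. -/
theorem emits_boundP (sign : List Letter) (hs : sign.length ≤ 2) :
    Emits (boundP sign) (conf I d t r m) (boundWord d m sign) (d * (6 * m + 20) + 4) := by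
  intro v
  have key : ∀ j k v, Runs (.loop .dim never fun a => block
      [.push .buf a, emitP sign, emitPer .big [.bit false], emitP [.bit true, .comma]])
      (Stacks.emit { conf I j t r m with buf := List.replicate k (.bit true) } v)
      (Stacks.emit { conf I 0 t r m with buf := List.replicate (j + k) (.bit true) }
        (v ++ boundWord j m sign)) (j * (6 * m + 12) + 1) := by
    intro j
    induction j with
    | zero =>
      intro k v
      refine ((Runs.loop_nil rfl).congr ?_).mono (by omega)
      simp [boundWord]
    | succ j ih =>
      intro k v
      have h1 : Runs (block
          [.push .buf (.bit true), emitP sign, emitPer .big [.bit false], emitP [.bit true, .comma]])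
          (Stacks.emit { conf I j t r m with buf := List.replicate k (.bit true) } v)
          (Stacks.emit { conf I j t r m with buf := List.replicate (k + 1) (.bit true) }
            (v ++ (sign ++ List.replicate m (.bit false) ++ [.bit true, .comma])))
          (6 * m + 11) := by
        refine Runs.mono (.block_cons ((Runs.push .buf _ _).congr (s'' := Stacks.emit
          { conf I j t r m with buf := List.replicate (k + 1) (.bit true) } v) rfl)
          ((Emits.cons (Emits.emitP _) (Emits.cons (Emits.emitPer (k := .big) (n := m) (by decide)
            (by decide) _ (by exact rfl) (by exact rfl)) (Emits.cons (Emits.emitP _) .nil))).congr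
            (by simp) _)) ?_
        simp; omega
      have h2 := Runs.loop_step (k := .dim) (halt := never) (body := fun a => block
        [.push .buf a, emitP sign, emitPer .big [.bit false], emitP [.bit true, .comma]])
        (s := Stacks.emit { conf I (j + 1) t r m with buf := List.replicate k (.bit true) } v)
        (a := .bit true) (l := List.replicate j (.bit true)) rfl rfl h1 (ih _ _)
      refine (h2.congr ?_).mono ?_
      · rw [List.append_assoc, boundWord, boundWord, List.replicate_succ (n := j),
          List.flatten_cons, add_right_comm j 1 k, add_assoc]
      · ring_nf; omega
  have h1 := key d 0 v
  have h2 := runs_transfer (j := .buf) (k := .dim) (by decide)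
    (Stacks.emit { conf I 0 t r m with buf := List.replicate (d + 0) (.bit true) }
        (v ++ boundWord d m sign))
  refine ((h1.seq h2).congr ?_).mono ?_
  · simp [conf, Stacks.emit, Stacks.set, Stacks.get]
  · simp [conf, Stacks.emit, Stacks.get]; ring_nf; omega

/-- Outputs the words of the transitions that begin and end a round and that prepare the next one. -/
def roundP : StackProg Stk Letter := block [
  stepP [.bit true, .comma, .minus, .bit true, .comma, .comma] zeroP (unitP []) (unitP []),
  stepP [.minus, .bit true, .comma, .comma, .bit true, .comma]
    (block [boundP [], boundP []]) (unitP []) (unitP []),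
  stepP [.bit true, .comma, .comma, .minus, .bit true, .comma]
    (block [boundP [.minus], boundP [.minus]]) (unitP []) (unitP [])]

theorem emits_roundP : Emits roundP (conf I d 0 r m) (roundWord d r m)
    (4 * (d * (6 * m + 20)) + 12 * d + 36 * r + 150) := by
  have hu := emits_unitP (I := I) (d := d) (t := 0) (r := r) (m := m) [] (by simp)
  have h0 := emits_boundP (I := I) (d := d) (t := 0) (r := r) (m := m) [] (by simp)
  have h1 := emits_boundP (I := I) (d := d) (t := 0) (r := r) (m := m) [.minus] (by simp)
  refine (((emits_stepP (by simp) emits_zeroP hu hu).cons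
    ((emits_stepP (by simp) ((h0.cons (h0.cons .nil)).congr (by rw [List.append_nil])) hu hu).cons
    ((emits_stepP (by simp) ((h1.cons (h1.cons .nil)).congr (by rw [List.append_nil])) hu hu).cons
      .nil))).congr ?_).mono ?_
  · rw [List.append_nil]; rfl
  · omega

/-- Outputs the word of a configuration. -/
def configP (z : List Letter) : StackProg Stk Letter := block [emitP [.bar],
  vecP [.bit true, .comma, .comma, .comma] zeroP
    (block [emitP z, emitP [.comma], emitPer .left [.comma]]) (unitP [])]

theorem emits_configP (z : List Letter) (hz : z.length ≤ 1) : Emits (configP z) (conf I d t 0 m)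
    (configWord d (unitWord 0 t z) (unitWord t 0 [])) (12 * d + 12 * t + 40) := by
  have hc : Emits (block [emitP z, emitP [.comma], emitPer .left [.comma]]) (conf I d t 0 m)
      (unitWord 0 t z) (6 * t + 7) :=
    (((Emits.emitP _).cons ((Emits.emitP _).cons ((emits_left _).cons .nil))).congr
      (by simp [unitWord])).mono (by simp; omega)
  exact (((Emits.emitP _).cons ((emits_vecP (by simp) emits_zeroP hc
    (emits_unitP _ (by simp))).cons .nil)).congr (by simp [configWord])).mono (by simp; omega)

/-- Outputs the dimension. -/
def dimP : StackProg Stk Letter := block [emitP [.bit true, .bit true, .bit true],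
  emitPer .dim [.bit true], emitPer .dim [.bit true], emitPer .right [.bit true],
  emitPer .right [.bit true], emitP [.bit true, .bit true, .bar]]

theorem emits_dimP : Emits dimP (conf I d t r m)
    (List.replicate (3 + d + d + (r + 1) + (r + 1)) (.bit true) ++ [.bar])
    (12 * d + 12 * r + 17) := by
  refine (((Emits.emitP _).cons ((emits_dim _).cons ((emits_dim _).cons ((emits_right _).cons
    ((emits_right _).cons ((Emits.emitP _).cons .nil)))))).congr ?_).mono (by simp; omega)
  have e : 3 + d + d + (r + 1) + (r + 1) = 3 + (d + (d + (r + (r + 2)))) := by omega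
  rw [e]
  simp only [List.replicate_add]
  simp

/-- Moves to the next cell. -/
def advanceP : StackProg Stk Letter := block [drop .right, .push .left (.bit true)]

theorem runs_advanceP (v : List Letter) : Runs advanceP ((conf I d t (r + 1) m).emit v)
    ((conf I d (t + 1) r m).emit v) 3 :=
  .block_cons (runs_drop (k := .right) (a := .bit true) (l := List.replicate r (.bit true)) rfl)
    (.block_cons (Runs.push _ _ _) (.block_nil_of_eq rfl))

/-- Outputs the word of a transition that lets a copy move again. -/
def flushP : StackProg Stk Letter :=
  stepP [.minus, .bit true, .comma, .bit true, .comma, .comma] zeroP (unitP [.bit true])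
    (unitP [.minus, .bit true])

theorem emits_flushP : Emits flushP (conf I d t r m)
    (stepWord [.minus, .bit true, .comma, .bit true, .comma, .comma] (zeroWord d)
      (unitWord t r [.bit true]) (unitWord t r [.minus, .bit true])) (12 * d + 12 * (t + r) + 37) :=
  (emits_stepP (by simp) emits_zeroP (emits_unitP _ (by simp)) (emits_unitP _ (by simp))).mono
    (by omega)

/-- Outputs the words of the transitions for the end of a data vector. -/
def endP : StackProg Stk Letter := block [flushP,
  stepP [.comma, .comma, .comma] zeroP (unitP [.minus, .bit true]) (unitP []), advanceP,
  stepP [.comma, .comma, .comma] zeroP (unitP [.bit true]) (unitP [])]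

theorem runs_endP (v : List Letter) : Runs endP ((conf I d t (r + 1) m).emit v)
    ((conf I d (t + 1) r m).emit (v ++ cellWord t r (none : Option (Fin d → ℤ))))
    (36 * d + 36 * (t + r) + 160) := by
  have h2 := emits_stepP (S := conf I d t (r + 1) m) (q := [.comma, .comma, .comma]) (by simp)
    emits_zeroP (emits_unitP [.minus, .bit true] (by simp)) (emits_unitP [] (by simp))
  have h3 := emits_stepP (S := conf I d (t + 1) r m) (q := [.comma, .comma, .comma]) (by simp)
    emits_zeroP (emits_unitP [.bit true] (by simp)) (emits_unitP [] (by simp))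
  refine Runs.mono (.block_cons (emits_flushP v) (.block_cons (h2 _) (.block_cons (runs_advanceP _)
    (.block_cons (h3 _) (.block_nil_of_eq ?_))))) (by omega)
  simp [cellWord]

/-- Reads a vector and outputs it together with its negation. -/
def pairP (neg : Bool) : StackProg Stk Letter := block [moveUntil .semicolon .inp .buf2,
  .loop .buf2 never fun a => block [.push .buf a, .push .buf3 a],
  if neg then block [negate never .buf, transfer .buf3 .out]
  else block [transfer .buf .out, negate never .buf3]]

theorem runs_copy (S : Stacks) (l x : List Letter) : Runs
    (.loop .buf2 never fun a => block [.push .buf a, .push .buf3 a])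
    { S with buf2 := l, buf := x, buf3 := x }
    { S with buf2 := [], buf := l.reverse ++ x, buf3 := l.reverse ++ x } (4 * l.length + 1) := by
  induction l generalizing x with
  | nil => exact .loop_nil rfl
  | cons a l ih =>
    have h := Runs.loop_step (k := .buf2) (halt := never) (body := fun a =>
      block [.push .buf a, .push .buf3 a]) (s := { S with buf2 := a :: l, buf := x, buf3 := x })
      (a := a) (l := l) rfl rfl (.block_cons (Runs.push _ _ _) (.block_cons (Runs.push _ _ _)
        (.block_nil _))) (ih (a :: x))
    refine (h.congr ?_).mono ?_
    · simp
    · simp; omega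

/-- Changes the sign, or not. -/
def sgn {G : Type} [Neg G] (neg : Bool) (v : G) : G := if neg then -v else v

/-- A move changes the two complementary counters by opposite vectors, so each vector is duplicated
and printed with both signs. For the negated target only the order of the two is exchanged. -/
theorem runs_pairP (neg : Bool) {n : ℕ} (w : Fin n → ℤ) (v : List Letter) : Runs (pairP neg)
    ((conf (encVec w ++ .semicolon :: I) d t r m).emit v)
    ((conf I d t r m).emit (v ++ (encVec (sgn neg w) ++ encVec (-sgn neg w))))
    (20 * (encVec w).length + 10) := by
  have h1 := runs_moveUntil (j := .inp) (k := .buf2) (by decide) (VAS.semicolon_notMem_encVec w) I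
    ((conf (encVec w ++ .semicolon :: I) d t r m).emit v) rfl
  have h2 := runs_copy ((conf I d t r m).emit v) (encVec w).reverse []
  simp only [List.reverse_reverse, List.append_nil, List.length_reverse] at h2
  have h3 : Runs (if neg then block [negate never .buf, transfer .buf3 .out]
      else block [transfer .buf .out, negate never .buf3])
      { (conf I d t r m).emit v with buf2 := [], buf := encVec w, buf3 := encVec w }
      ((conf I d t r m).emit (v ++ (encVec (sgn neg w) ++ encVec (-sgn neg w))))
      (12 * (encVec w).length + 3) := by
    cases neg with
    | true =>
      refine (Runs.block_cons (runs_negate_all (k := .buf) (by decide) w _ rfl) (.block_cons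
        (runs_transfer (j := .buf3) (k := .out) (by decide) _) (.block_nil_of_eq ?_))).mono ?_
      · simp [sgn, Stacks.emit, Stacks.set, Stacks.get, conf]
      · simp [Stacks.emit, Stacks.set, Stacks.get]; omega
    | false =>
      refine (Runs.block_cons (runs_transfer (j := .buf) (k := .out) (by decide) _) (.block_cons
        (runs_negate_all (k := .buf3) (by decide) w _ rfl) (.block_nil_of_eq ?_))).mono ?_
      · simp [sgn, Stacks.emit, Stacks.set, Stacks.get, conf]
      · simp [Stacks.get]; omega
  refine Runs.mono (.block_cons (h1.congr ?_) (.block_cons h2 (.block_cons h3 (.block_nil _)))) ?_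
  · simp [Stacks.emit, Stacks.set, Stacks.get, conf]
  · omega

/-- Reads a data value and a vector and outputs the words of the transitions for the vector. -/
def someP (neg : Bool) : StackProg Stk Letter := block [skipUntil .colon, flushP,
  emitP [.comma, .comma, .comma], pairP neg, unitP [.minus, .bit true], advanceP, unitP [.bit true],
  emitP [.semicolon]]

/-- The data value is thrown away: up to permutation only the order of the values matters, and the
encoding lists them in increasing order. -/
theorem runs_someP (neg : Bool) (w : Fin d → ℤ) {x : List Letter} (hx : .colon ∉ x)
    (v : List Letter) : Runs (someP neg)
    ((conf (x ++ .colon :: (encVec w ++ .semicolon :: I)) d t (r + 1) m).emit v)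
    ((conf I d (t + 1) r m).emit (v ++ cellWord t r (some (sgn neg w))))
    (2 * x.length + 20 * (encVec w).length + 12 * d + 24 * (t + r) + 120) := by
  refine Runs.mono (.block_cons ((runs_skipUntil hx (encVec w ++ .semicolon :: I) _ rfl).congr
    (s'' := (conf (encVec w ++ .semicolon :: I) d t (r + 1) m).emit v) rfl)
    (.block_cons (emits_flushP _) (.block_cons (Emits.emitP _ _) (.block_cons (runs_pairP _ _ _)
    (.block_cons (emits_unitP _ (by simp) _) (.block_cons (runs_advanceP _)
    (.block_cons (emits_unitP _ (by simp) _) (.block_cons (Emits.emitP _ _)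
    (.block_nil_of_eq ?_))))))))) ?_
  · simp [cellWord, stepWord, vecWord]
  · simp; omega

end Track

end Emits

theorem mem_encRat {q : ℚ} {a : Letter} (h : a ∈ encRat q) :
    (∃ b, a = .bit b) ∨ a = .minus ∨ a = .slash := by
  rcases List.mem_append.1 h with h | h
  · rcases mem_encInt h with h | h
    exacts [.inl h, .inr (.inl h)]
  · rcases List.mem_cons.1 h with h | h
    exacts [.inr (.inr h), .inl (mem_encNat h)]

/-! ### Reading the data vectors of the input -/

namespace Track

variable {I : List Letter} {d t r m N : ℕ}

/-- Reads a data vector and outputs the words of the transitions for its vectors. -/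
def valuesP (neg : Bool) : StackProg Stk Letter := .loop .inp (· == .bar) fun _ => someP neg

theorem runs_valuesP (neg : Bool) (f : ℚ → Fin d → ℤ) (ts : List ℚ) (v : List Letter)
    (hI : (ts.flatMap fun α => encRat α ++ .colon :: (encVec (f α) ++ [.semicolon])).length ≤ N)
    (hd : d ≤ N) (hN : t + ts.length + r ≤ N) : Runs (valuesP neg)
    ((conf ((ts.flatMap fun α => encRat α ++ .colon :: (encVec (f α) ++ [.semicolon])) ++
      .bar :: I) d t (ts.length + r) m).emit v)
    ((conf I d (t + ts.length) r m).emit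
      (v ++ trackWord t r (ts.map fun α => some (sgn neg (f α)))))
    (ts.length * (60 * N + 121) + 1) := by
  induction ts generalizing t v with
  | nil =>
    refine ((Runs.loop_halt (k := .inp) (a := .bar) (l := I) rfl rfl).congr ?_).mono (by omega)
    simp [trackWord, conf, Stacks.emit, Stacks.set]
  | cons α ts ih =>
    -- The loop consumes the first letter of the data value, which exists because of the slash, and
    -- leaves the rest `x` to be skipped.
    obtain ⟨a, x, hx⟩ : ∃ a x, encRat α = a :: x := by
      rcases h : encRat α with _ | ⟨a, x⟩
      · simp [encRat] at h
      · exact ⟨a, x, rfl⟩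
    have hmem : ∀ b ∈ a :: x, b ≠ .colon ∧ b ≠ .bar := by
      intro b hb
      rw [← hx] at hb
      rcases mem_encRat hb with ⟨_, rfl⟩ | rfl | rfl <;> simp
    simp only [List.flatMap_cons, List.length_append, List.length_cons, hx] at hI hN
    have h1 := runs_someP (I := (ts.flatMap fun α => encRat α ++ .colon :: (encVec (f α) ++
      [.semicolon])) ++ .bar :: I) (t := t) (r := ts.length + r) (m := m) neg (f α) (x := x)
      (fun h => (hmem _ (List.mem_cons_of_mem _ h)).1 rfl) v
    have h2 := ih (t := t + 1) (v ++ cellWord t (ts.length + r) (some (sgn neg (f α)))) (by omega)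
      (by omega)
    have h3 := Runs.loop_step (k := .inp) (halt := (· == .bar)) (body := fun _ => someP neg)
      (s := (conf (((α :: ts).flatMap fun α => encRat α ++ .colon :: (encVec (f α) ++
        [.semicolon])) ++ .bar :: I) d t ((α :: ts).length + r) m).emit v) (a := a)
      (l := x ++ .colon :: (encVec (f α) ++ .semicolon :: ((ts.flatMap fun α => encRat α ++
        .colon :: (encVec (f α) ++ [.semicolon])) ++ .bar :: I)))
      (by simp [Stacks.get, Stacks.emit, conf, hx])
      (by simpa using (hmem a List.mem_cons_self).2)
      (by
        have e : (α :: ts).length + r = ts.length + r + 1 := by simp; omega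
        rw [e]
        exact h1) h2
    refine (h3.congr ?_).mono ?_
    · rw [List.map_cons, trackWord, List.length_map, List.length_cons, List.append_assoc]
      congr 2
      omega
    · simp only [List.length_cons]
      ring_nf
      ring_nf at hI
      omega

theorem cells_sgn (neg : Bool) (v : DataVector d) : cells (sgn neg v) =
    ((v.support.sort (· ≤ ·)).map fun α => some (sgn neg (v α))) ++ [none] := by
  cases neg
  · simp [cells, values, sgn, Function.comp_def]
  · simp [cells, values, sgn, Function.comp_def]

theorem length_cells (v : DataVector d) :
    (cells v).length = (v.support.sort (· ≤ ·)).length + 1 := by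
  simp [cells, values]

/-- Reads a data vector and outputs the words of its transitions. -/
def dataVectorP (neg : Bool) : StackProg Stk Letter := .seq (valuesP neg) endP

/-- The loop over the values stops at the bar and removes it; the cell for the end is then printed
without further input. -/
theorem runs_dataVectorP (neg : Bool) (u : DataVector d) (v : List Letter)
    (hI : (encDataVector u).length ≤ N) (hd : d ≤ N) (hN : t + (cells u).length + r ≤ N) :
    Runs (dataVectorP neg)
      ((conf (encDataVector u ++ .bar :: I) d t ((cells u).length + r) m).emit v)
      ((conf I d (t + (cells u).length) r m).emit (v ++ trackWord t r (cells (sgn neg u))))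
      ((cells u).length * (72 * N + 161)) := by
  rw [length_cells] at *
  have h1 := runs_valuesP (I := I) (m := m) neg u (u.support.sort (· ≤ ·)) (r := r + 1) (t := t) v
    hI hd (by omega)
  have h2 := runs_endP (I := I) (d := d) (t := t + (u.support.sort (· ≤ ·)).length) (r := r)
    (m := m) (v ++ trackWord t (r + 1)
      ((u.support.sort (· ≤ ·)).map fun α => some (sgn neg (u α))))
  have e : (u.support.sort (· ≤ ·)).length + 1 + r = (u.support.sort (· ≤ ·)).length + (r + 1) := by
    omega
  rw [e]
  refine ((h1.seq h2).congr ?_).mono ?_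
  · rw [cells_sgn, trackWord_append, List.append_assoc]
    simp [trackWord, add_assoc, add_comm]
  · generalize (u.support.sort (· ≤ ·)).length = n at *
    have : n * (60 * N + 121) ≤ n * (72 * N + 161) := Nat.mul_le_mul_left _ (by omega)
    rw [add_one_mul]
    omega

/-- Reads the data vectors and outputs the words of their transitions. -/
def dataVectorsP : StackProg Stk Letter := .loop .inp never fun a =>
  .seq (.push .inp a) (dataVectorP false)

theorem runs_dataVectorsP (l : List (DataVector d)) (v : List Letter)
    (hI : (l.flatMap fun u => encDataVector u ++ [.bar]).length ≤ N) (hd : d ≤ N)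
    (hN : t + (ofList l).length ≤ N) : Runs dataVectorsP
      ((conf (l.flatMap fun u => encDataVector u ++ [.bar]) d t (ofList l).length m).emit v)
      ((conf [] d (t + (ofList l).length) 0 m).emit (v ++ trackWord t 0 (ofList l)))
      ((ofList l).length * (72 * N + 163) + 1) := by
  induction l generalizing t v with
  | nil =>
    refine ((Runs.loop_nil rfl).congr ?_).mono (by omega)
    simp [ofList, trackWord]
  | cons u l ih =>
    have hl : (ofList (u :: l)).length = (cells u).length + (ofList l).length := by
      simp [ofList]
    rw [hl] at hN ⊢
    simp only [List.flatMap_cons, List.length_append] at hI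
    obtain ⟨a, x, hx⟩ := List.exists_cons_of_ne_nil
      (show (u :: l).flatMap (fun u => encDataVector u ++ [.bar]) ≠ [] by simp)
    have h1 := runs_dataVectorP (I := l.flatMap fun u => encDataVector u ++ [.bar]) (m := m)
      (r := (ofList l).length) (t := t) (N := N) false u v (by omega) hd (by omega)
    have h2 := ih (t := t + (cells u).length) (v ++ trackWord t (ofList l).length
      (cells (sgn false u))) (by omega) (by omega)
    have e : encDataVector u ++ .bar :: (l.flatMap fun u => encDataVector u ++ [.bar]) = a :: x := by
      rw [← hx, List.flatMap_cons, List.append_assoc]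
      rfl
    rw [e] at h1
    rw [hx]
    have h3 := Runs.loop_step (k := .inp) (halt := never) (body := fun a =>
      .seq (.push .inp a) (dataVectorP false))
      (s := (conf (a :: x) d t ((cells u).length + (ofList l).length) m).emit v) (a := a) (l := x)
      rfl rfl ((Runs.push .inp a _).seq (h1 : Runs _ _ _ _)) h2
    refine (h3.congr ?_).mono ?_
    · rw [show ofList (u :: l) = cells u ++ ofList l from rfl, trackWord_append, List.append_assoc,
        add_assoc]
      rfl
    · have h : 1 ≤ (cells u).length := by rw [length_cells]; omega
      ring_nf
      omega

end Track

/-! ### Unary counters for the exponent of the bound and for the cells -/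

namespace Track

/-- Puts `n` marks on the stack `buf`. -/
def pushMarks : ℕ → StackProg Stk Letter
  | 0 => .skip
  | n + 1 => .seq (.push .buf (.bit true)) (pushMarks n)

theorem runs_pushMarks (s : Stacks) (n k : ℕ) : Runs (pushMarks n)
    { s with buf := List.replicate k (.bit true) }
    { s with buf := List.replicate (k + n) (.bit true) } (n + 1) := by
  induction n generalizing k with
  | zero => exact .skip _
  | succ n ih =>
    have h := ih (k + 1)
    rw [add_assoc, add_comm 1 n] at h
    exact ((Runs.push .buf _ _).seq h).mono (by omega)

/-- Multiplies the number of marks on the stack `big` by eight. -/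
def octupleP : StackProg Stk Letter :=
  .seq (.loop .big never fun _ => pushMarks 8) (transfer .buf .big)

theorem runs_octupleP (s : Stacks) (hs : s.buf = []) (m : ℕ) :
    Runs octupleP { s with big := List.replicate m (.bit true) }
      { s with big := List.replicate (8 * m) (.bit true) } (26 * m + 2) := by
  have key : ∀ j k, Runs (.loop .big never fun _ => pushMarks 8)
      { s with big := List.replicate j (.bit true), buf := List.replicate k (.bit true) }
      { s with big := [], buf := List.replicate (8 * j + k) (.bit true) } (10 * j + 1) := by
    intro j
    induction j with
    | zero =>
      intro k
      refine (Runs.loop_nil rfl).congr ?_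
      simp
    | succ j ih =>
      intro k
      refine ((Runs.loop_step (k := .big) (halt := never) (a := .bit true)
        (l := List.replicate j (.bit true)) rfl rfl
        (runs_pushMarks { s with big := List.replicate j (.bit true) } 8 k)
        (ih (k + 8))).congr ?_).mono (by omega)
      rw [show 8 * (j + 1) + k = 8 * j + (k + 8) by omega]
  cases s
  simp only at hs
  subst hs
  refine (((key m 0).seq (runs_transfer (j := .buf) (k := .big) (by decide) _)).congr ?_).mono ?_
  · simp [Stacks.set, Stacks.get]
  · simp [Stacks.get]; omega

/-- Puts `8 ^ n` marks on the stack `big`, where `n` is the length of the input. -/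
def powP : StackProg Stk Letter := block [.push .big (.bit true),
  .loop .inp never fun a => .seq (.push .tmp a) octupleP, transfer .tmp .inp]

theorem runs_powP (I : List Letter) : Runs powP { inp := I } (conf I 0 0 0 (8 ^ I.length))
    (8 ^ I.length * (2 * I.length + 10)) := by
  -- The costs form a geometric sum: one letter costs at most `26 * m + 4 ≤ 5 * (8 * m) - 5 * m`
  -- steps, where `m ≥ 1` is used, and these differences telescope.
  have key : ∀ l x m, 1 ≤ m → Runs (.loop .inp never fun a => .seq (.push .tmp a) octupleP)
      { conf l 0 0 0 m with tmp := x }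
      { conf [] 0 0 0 (m * 8 ^ l.length) with tmp := l.reverse ++ x }
      (5 * (m * 8 ^ l.length) + 1 - 5 * m) := by
    intro l
    induction l with
    | nil =>
      intro x m _
      refine ((Runs.loop_nil rfl).congr ?_).mono (by simp)
      simp
    | cons a l ih =>
      intro x m hm
      have h := Runs.loop_step (k := .inp) (halt := never)
        (body := fun a => .seq (.push .tmp a) octupleP)
        (s := { conf (a :: l) 0 0 0 m with tmp := x }) (a := a) (l := l) rfl rfl
        ((Runs.push _ _ _).seq (runs_octupleP { conf l 0 0 0 m with tmp := a :: x } rfl m))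
        (ih (a :: x) (8 * m) (by omega))
      have e : 8 * m * 8 ^ l.length = m * 8 ^ (a :: l).length := by
        rw [List.length_cons, pow_succ]; ring
      rw [e] at h
      refine (h.congr ?_).mono ?_
      · simp
      · have : 8 * m ≤ m * 8 ^ (a :: l).length := by
          rw [← e]
          exact Nat.le_mul_of_pos_right _ (by positivity)
        omega
  have h1 := key I [] 1 le_rfl
  rw [one_mul] at h1
  refine (Runs.block_cons ((Runs.push _ _ _).congr (s'' := { conf I 0 0 0 1 with tmp := [] }) rfl)
    (.block_cons h1 (.block_cons (runs_transfer (j := .tmp) (k := .inp) (by decide) _)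
      (.block_nil_of_eq ?_)))).mono ?_
  · simp [conf, Stacks.set, Stacks.get]
  · have : 1 ≤ 8 ^ I.length := Nat.one_le_pow _ _ (by norm_num)
    simp only [Stacks.get, List.append_nil, List.length_reverse]
    have : 8 ^ I.length * (2 * I.length + 10) = 8 ^ I.length * (2 * I.length) + 10 * 8 ^ I.length := by
      ring
    have : 1 * (2 * I.length) ≤ 8 ^ I.length * (2 * I.length) := Nat.mul_le_mul_right _ (by omega)
    omega

/-- The letters that occur once for every cell. -/
def isEnd (a : Letter) : Bool := a == .semicolon || a == .bar

/-- Puts one mark on the stack `right` for every cell of the track. -/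
def countP : StackProg Stk Letter := .seq (.loop .inp never fun a => .seq (.push .tmp a)
  (if isEnd a then .push .right (.bit true) else .skip)) (transfer .tmp .inp)

/-- The number of cells enters the dimension and the length of every vector, so it is determined in
a pass of its own that restores the input. -/
theorem runs_countP (I : List Letter) (d m : ℕ) : Runs countP (conf I d 0 0 m)
    (conf I d 0 (I.countP isEnd) m) (5 * I.length + 2) := by
  have key : ∀ l x r, Runs (.loop .inp never fun a => .seq (.push .tmp a)
      (if isEnd a then .push .right (.bit true) else .skip))
      { conf l d 0 r m with tmp := x }
      { conf [] d 0 (r + l.countP isEnd) m with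
        tmp := l.reverse ++ x } (3 * l.length + 1) := by
    intro l
    induction l with
    | nil =>
      intro x r
      exact Runs.loop_nil rfl
    | cons a l ih =>
      intro x r
      by_cases ha : isEnd a = true
      · have h := Runs.loop_step (k := .inp) (halt := never) (body := fun a => .seq (.push .tmp a)
          (if isEnd a then .push .right (.bit true) else .skip))
          (s := { conf (a :: l) d 0 r m with tmp := x }) (a := a) (l := l) rfl rfl
          ((Runs.push _ _ _).seq (by rw [if_pos ha]; exact Runs.push _ _ _)) (ih (a :: x) (r + 1))
        refine (h.congr ?_).mono (by simp; omega)
        rw [List.countP_cons_of_pos ha]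
        simp only [List.reverse_cons, List.append_assoc, List.singleton_append, add_assoc, add_comm 1]
      · have h := Runs.loop_step (k := .inp) (halt := never) (body := fun a => .seq (.push .tmp a)
          (if isEnd a then .push .right (.bit true) else .skip))
          (s := { conf (a :: l) d 0 r m with tmp := x }) (a := a) (l := l) rfl rfl
          ((Runs.push _ _ _).seq (by rw [if_neg ha]; exact Runs.skip _)) (ih (a :: x) r)
        refine (h.congr ?_).mono (by simp; omega)
        rw [List.countP_cons_of_neg ha]
        simp
  have h1 := (key I [] 0).seq (runs_transfer (j := .tmp) (k := .inp) (by decide) _)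
  refine (h1.congr ?_).mono ?_
  · simp [conf, Stacks.set, Stacks.get]
  · simp [Stacks.get]; omega

theorem countP_encDataVector {d : ℕ} (v : DataVector d) :
    (encDataVector v ++ [Letter.bar]).countP isEnd = (cells v).length := by
  have h : ∀ α, (encRat α ++ Letter.colon :: (encVec (v α) ++ [Letter.semicolon])).countP
      isEnd = 1 := by
    intro α
    have h1 : (encRat α).countP isEnd = 0 := by
      rw [List.countP_eq_zero]
      intro a ha
      rcases mem_encRat ha with ⟨_, rfl⟩ | rfl | rfl <;> simp [isEnd]
    have h2 : (encVec (v α)).countP isEnd = 0 := by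
      rw [List.countP_eq_zero]
      intro a ha
      rcases mem_encVec ha with ⟨_, rfl⟩ | rfl | rfl <;> simp [isEnd]
    rw [List.countP_append, List.countP_cons, List.countP_append, h1, h2]
    rfl
  rw [length_cells, List.countP_append, encDataVector, List.countP_flatMap]
  simp only [Function.comp_def, h]
  simp [isEnd]

theorem countP_encDataVectors {d : ℕ} (l : List (DataVector d)) :
    (l.flatMap fun v => encDataVector v ++ [.bar]).countP isEnd =
      (ofList l).length := by
  rw [List.countP_flatMap, ofList, List.length_flatMap]
  congr 1
  exact List.map_congr_left fun v _ => countP_encDataVector v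

end Track

/-! ### The complete program and its running time -/

namespace DataSystem

open Track

/-- The program of the reduction from data vectors to vector addition systems. -/
def toVASProg : StackProg Stk Letter := block [powP, moveUntil .bar .inp .dim, countP, dimP, roundP,
  dataVectorP true, dataVectorsP, configP [.bit true], configP [], clear .dim, clear .left,
  clear .big]

theorem runs_toVASProg (E : DataSystem) : Runs toVASProg { inp := E.encode }
    (Stacks.emit {} E.toVAS.encode) (1000 * ((E.encode.length + 1) ^ 2 * 8 ^ E.encode.length)) := by
  set J := E.vectors.flatMap fun v => encDataVector v ++ [.bar] with hJ
  set T := E.track.length with hT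
  have hT' : T = (cells E.target).length + (ofList E.vectors).length := by
    rw [hT, track, ofList, List.flatMap_cons, List.length_append, ← ofList, length_cells,
      length_cells, Finsupp.support_neg]
  have hI : E.encode = List.replicate E.dim (.bit true) ++ .bar :: (encDataVector E.target ++ .bar :: J) :=
    rfl
  have hcount : (encDataVector E.target ++ Letter.bar :: J).countP
      isEnd = T := by
    have e : encDataVector E.target ++ Letter.bar :: J = (encDataVector E.target ++ [.bar]) ++ J := by simp
    rw [e, List.countP_append, countP_encDataVector, countP_encDataVectors, hT']
  have hTI := hcount ▸ List.countP_le_length (l := encDataVector E.target ++ Letter.bar :: J)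
    (p := isEnd)
  have hlen : E.encode.length = E.dim + (1 + (encDataVector E.target).length + (1 + J.length)) := by
    rw [hI]; simp; omega
  have hout : E.toVAS.encode = _ := encode_toVAS E.track (8 ^ E.encode.length) rfl
  rw [hout, ← hT]
  generalize hn : E.encode.length = n at *
  have hTn : T ≤ n := by
    simp only [List.length_append, List.length_cons] at hTI
    omega
  -- The exponent depends on the length of the whole input word, so it is computed before any letter
  -- is removed.
  have h1 := runs_powP E.encode
  rw [hn] at h1
  generalize hm : 8 ^ n = m at *
  have h2 : Runs (moveUntil .bar .inp .dim) (conf E.encode 0 0 0 m)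
      (conf (encDataVector E.target ++ .bar :: J) E.dim 0 0 m) (2 * E.dim + 1) := by
    have := runs_moveUntil (j := .inp) (k := .dim) (by decide) (c := .bar)
      (w := List.replicate E.dim (.bit true)) (by simp) _ (conf E.encode 0 0 0 m) hI
    refine (this.congr ?_).mono (by simp)
    simp [Stacks.set, Stacks.get, conf]
  have h3 := runs_countP (encDataVector E.target ++ .bar :: J) E.dim m
  rw [hcount] at h3
  have h6 := fun v => runs_dataVectorP (I := J) (m := m) (t := 0) (r := (ofList E.vectors).length)
    (N := n) true E.target v (by omega) (by omega) (by omega)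
  rw [← hT', zero_add] at h6
  have h7 := fun v => runs_dataVectorsP (m := m) (t := (cells E.target).length) (N := n)
    E.vectors v (by rw [← hJ]; omega) (by omega) (by omega)
  rw [← hT'] at h7
  have h8 : ∀ v, Runs (block [clear .dim, clear .left, clear .big])
      ((conf [] E.dim T 0 m).emit v) (Stacks.emit {} v) (2 * E.dim + 2 * T + 2 * m + 4) := by
    intro v
    refine (Runs.block_cons (runs_clear _ _) (.block_cons (runs_clear _ _)
      (.block_cons (runs_clear _ _) (.block_nil_of_eq ?_)))).mono ?_
    · simp [conf, Stacks.set, Stacks.emit]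
    · simp [conf, Stacks.set, Stacks.get, Stacks.emit]; omega
  refine Runs.mono (.block_cons h1 (.block_cons h2 (.block_cons (h3.congr (Stacks.emit_nil _).symm)
    (.block_cons (emits_dimP _) (.block_cons (emits_roundP _) (.block_cons (h6 _)
    (.block_cons (h7 _) (.block_cons (emits_configP _ (by simp) _) (.block_cons
    (emits_configP _ (by simp) _) ((h8 _).congr ?_)))))))))) ?_
  · congr 1
    have e : E.track = cells (sgn true E.target) ++ ofList E.vectors := rfl
    rw [e, trackWord_append]
    have e0 : unitWord 0 T [] = unitWord T 0 [] :=
      (encVec_zero_eq_unitWord (zero_add T)).symm.trans (encVec_zero_eq_unitWord (add_zero T))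
    simp [sgn, length_cells, e0]
  · have hm1 : 1 ≤ m := by rw [← hm]; exact Nat.one_le_pow _ _ (by norm_num)
    have e1 : E.dim * (6 * m + 20) ≤ n * (6 * m + 20) := Nat.mul_le_mul_right _ (by omega)
    have e2 : (cells E.target).length * (72 * n + 161) + (ofList E.vectors).length * (72 * n + 163) ≤
        n * (72 * n + 163) := by
      calc _ ≤ (cells E.target).length * (72 * n + 163) +
            (ofList E.vectors).length * (72 * n + 163) := by gcongr; omega
        _ = T * (72 * n + 163) := by rw [hT', add_mul]
        _ ≤ _ := Nat.mul_le_mul_right _ hTn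
    have e3 : n ≤ n * m := Nat.le_mul_of_pos_right _ hm1
    have e4 : n * n ≤ n * n * m := Nat.le_mul_of_pos_right _ hm1
    have e5 : 1000 * ((n + 1) ^ 2 * m) = 1000 * (n * n * m) + 2000 * (n * m) + 1000 * m := by ring
    have e6 : n * (6 * m + 20) = 6 * (n * m) + 20 * n := by ring
    have e7 : n * (72 * n + 163) = 72 * (n * n) + 163 * n := by ring
    have e8 : m * (2 * n + 10) = 2 * (n * m) + 10 * m := by ring
    simp only [List.length_append, List.length_cons]
    omega

theorem computableInExpTime_toVAS : ComputableInExpTime encode VAS.encode toVAS := by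
  -- The polynomial comes from `(n + 1) ^ 2 * 8 ^ n ≤ 2 ^ (2 * n + 3 * n)` and `3 * 1000 + 2 ≤ 2 ^
  -- 12`.
  refine computableInExpTime_of_runs toVASProg (5 * .X + 12) fun E => ⟨_, ?_, runs_toVASProg E⟩
  generalize E.encode.length = n
  have h1 : n + 1 ≤ 2 ^ n := Nat.lt_two_pow_self
  have h2 : (n + 1) ^ 2 * 8 ^ n ≤ 2 ^ (5 * n) := by
    calc (n + 1) ^ 2 * 8 ^ n ≤ (2 ^ n) ^ 2 * (2 ^ 3) ^ n := by gcongr; norm_num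
      _ = 2 ^ (5 * n) := by rw [← pow_mul, ← pow_mul, ← pow_add]; congr 1; ring
  have h3 : 1 ≤ 2 ^ (5 * n) := Nat.one_le_two_pow
  simp only [Polynomial.eval_add, Polynomial.eval_mul, Polynomial.eval_X, Polynomial.eval_ofNat,
    pow_add]
  omega

end DataSystem

theorem mainTheorem1 :
    ReducesWithExpBlowup DataSystem.encode DataSystem.Solvable VAS.encode VAS.Reachable ∧
      ReducesWithExpBlowup VAS.encode VAS.Reachable DataSystem.encode DataSystem.Solvable :=
  ⟨⟨DataSystem.toVAS, DataSystem.computableInExpTime_toVAS, DataSystem.solvable_iff_reachable⟩,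
    VAS.toDataSystem, VAS.computableInExpTime_toDataSystem, VAS.reachable_iff_solvable⟩
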